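/- **Setting.** Let $f,g:\mathbb R^{d_x}\times\mathbb R^{d_y}\to\mathbb R$ be continuously differentiable, $A\in\mathbb R^{d_h\times d_y}$, $b\in\mathbb R^{d_h}$, $h(y)=Ay-b$ and $\mathcal Y=\{y: h(y)\le 0\}\neq\emptyset$. Assume that $f$ is $l_{f,0}$-Lipschitz on $\mathbb R^{d_x}\times\mathcal Y$, that $\nabla f$ and $\nabla g$ are $l_{f,1}$- and $l_{g,1}$-Lipschitz on $\mathbb R^{d_x}\times\mathbb R^{d_y}$, that $g(x,\cdot)$ is $\mu_g$-strongly convex on $\mathbb R^{d_y}$ for every $x$ ($\mu_g>0$), and that $\Phi(x)=f(x,y^*(x))$ is bounded below. For $\delta>0$ with $2l_{f,1}\delta\le\mu_g$ put $g_\delta=\delta f+g$ and $$y^*(x)=z^*(x)=\arg\min_{y\in\mathcal Y}g(x,y),\qquad y^*_\delta(x)=\arg\min_{y\in\mathcal Y}g_\delta(x,y),$$ $$\Phi_\delta(x)=f(x,y^*_\delta(x))+\tfrac1\delta\big[g(x,y^*_\delta(x))-g(x,y^*(x))\big].$$ Let $v^*(x)$ and $u^*_\delta(x)$ be the optimal Lagrange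 multipliers of $y^*(x)$ and $y^*_\delta(x)$, i.e. the maximizers over $u\ge0$ of $\inf_{y\in\mathbb R^{d_y}}\{g(x,y)+u^\top h(y)\}$ and of $\inf_{y\in\mathbb R^{d_y}}\{g_\delta(x,y)+u^\top h(y)\}$. A point $y$ satisfies LICQ if the gradients of the constraints active at $y$ are linearly independent. An $\epsilon$-stationary point of a differentiable $F$ is an $\hat x$ with $\|\nabla F(\hat x)\|\le\epsilon$. **Algorithm (SFLCB).** Let $y'=(y,\alpha)$ and $z'=(z,\beta)$ range over $\mathcal P=\mathbb R^{d_y}\times\mathbb R^{d_h}_{-}$, let $A'=(A,-I)$ and $$K(x,y',z',u,v)=\delta f(x,y)+g(x,y)-g(x,z)+u^\top(A'y'-b)-v^\top(A'z'-b)+\tfrac{\rho_1}2\|A'y'-b\|^2-\tfrac{\rho_2}2\|A'z'-b\|^2,$$ $y'^*_\delta(x,u)=\arg\min_{y'\in\mathcal P}K$ and $z'^*(x,v)=\arg\max_{z'\in\mathcal P}K$. One iteration is $$u_{t+1}=u_t+\eta_u(A'y'_t-b),\quad v_{t+1}=v_t+\eta_v(A'z'_t-b),\quad x_{t+1}=x_t-\eta_x\nabla_xK,$$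 $$y'_{t+1}=\Pi_{\mathcal P}(y'_t-\eta_y\nabla_{y'}K),\quad z'_{t+1}=\Pi_{\mathcal P}(z'_t+\eta_z\nabla_{z'}K),$$ all gradients being taken at $(x_t,y'_t,z'_t,u_{t+1},v_{t+1})$. In SFLCB with $x$ fixed the update of $x$ is omitted. Complexity is the number of iterations; each uses a fixed number of gradient evaluations of $f$ and $g$. **Claim.** There are positive parameters $\rho_1,\rho_2,\eta_x,\eta_y,\eta_z,\eta_u,\eta_v$, with $\rho_1\sigma_{\max}(A)^2\le\mu_g/2$ and $\rho_2\sigma_{\max}(A)^2\le\mu_g$, and a constant $C'$, depending only on the dimensions, $A,\mu_g,l_{f,1},l_{g,1}$, such that the following holds for all $f,g,b$ as above. Let $x_0$, starting values $y',z'\in\mathcal P$, $u,v\in\mathbb R^{d_h}$, and $0<c_1\le c_2$ be given, and let LICQ hold at $y^*(x_0)$. Then there are $C$ and $\epsilon_0>0$ such that for all $0<\epsilon\le\epsilon_0$ and all $\delta\in[c_1\epsilon,c_2\epsilon]$ with $2l_{f,1}\delta\le\mu_g$ for which LICQ holds at $y^*_\delta(x_0)$, the multipliers $u^*_\delta(x_0)$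 and $v^*(x_0)$ exist and are unique, and: 1. After some number $n\le C\epsilon^{-2}$ of iterations, SFLCB with $x$ fixed at $x_0$, run from the starting values, is at $\hat y',\hat z',\hat u,\hat v$ for which each of $$\|\hat y-y^*_\delta(x_0)\|,\ \|A'y'^*_\delta(x_0,\hat u)-b\|,\ \|A'\hat y'-b\|,\ \|\hat u-u^*_\delta(x_0)\|,$$ $$\|\hat z-z^*(x_0)\|,\ \|A'z'^*(x_0,\hat v)-b\|,\ \|A'\hat z'-b\|,\ \|\hat v-v^*(x_0)\|$$ is at most $C'\delta$. 2. $\Phi_\delta$ is differentiable, and SFLCB run from $(x_0,\hat y',\hat z',\hat u,\hat v)$ reaches an $\epsilon$-stationary point $x_m$ of $\Phi_\delta$ after some number $m\le C\epsilon^{-3}$ of iterations, with total complexity $n+m\le C\epsilon^{-3}$. -/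

import Mathlib

open Set

noncomputable section

/-- A minimizer of `φ` over `S`; it is only used where the minimizer exists and is unique. -/
def argminOn {α : Type*} [Nonempty α] (S : Set α) (φ : α → ℝ) : α :=
  Classical.epsilon fun p => p ∈ S ∧ IsMinOn φ S p

/-- A maximizer of `φ` over `S`; it is only used where the maximizer exists and is unique. -/
def argmaxOn {α : Type*} [Nonempty α] (S : Set α) (φ : α → ℝ) : α :=
  Classical.epsilon fun p => p ∈ S ∧ IsMaxOn φ S p

/-- `F` is differentiable and `‖∇F(x)‖ ≤ ε`. -/
def IsEpsStationary {d : ℕ} (F : EuclideanSpace ℝ (Fin d) → ℝ) (ε : ℝ)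
    (x : EuclideanSpace ℝ (Fin d)) : Prop :=
  Differentiable ℝ F ∧ ‖gradient F x‖ ≤ ε

/-- The Euclidean norm of the stacked vector `(x, y)`. -/
def jointNorm {m n : ℕ} (x : EuclideanSpace ℝ (Fin m)) (y : EuclideanSpace ℝ (Fin n)) : ℝ :=
  Real.sqrt (‖x‖ ^ 2 + ‖y‖ ^ 2)

/-- Data of a bilevel problem: upper-level objective `f`, lower-level objective `g`, and the
lower-level constraint `A y - b ≤ 0`. -/
structure Bilevel (dx dy dh : ℕ) where
  f : EuclideanSpace ℝ (Fin dx) → EuclideanSpace ℝ (Fin dy) → ℝ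
  g : EuclideanSpace ℝ (Fin dx) → EuclideanSpace ℝ (Fin dy) → ℝ
  A : EuclideanSpace ℝ (Fin dy) →L[ℝ] EuclideanSpace ℝ (Fin dh)
  b : EuclideanSpace ℝ (Fin dh)

/-- Penalty parameters and step sizes of the algorithm. -/
structure Params where
  ρ₁ : ℝ
  ρ₂ : ℝ
  ηx : ℝ
  ηy : ℝ
  ηz : ℝ
  ηu : ℝ
  ηv : ℝ

/-- Positive parameters, with `ρ₁ σ_max(A)² ≤ μ / 2` and `ρ₂ σ_max(A)² ≤ μ`. -/
structure Params.Admissible {dy dh : ℕ} (prm : Params)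
    (A : EuclideanSpace ℝ (Fin dy) →L[ℝ] EuclideanSpace ℝ (Fin dh)) (μ : ℝ) : Prop where
  ρ₁_pos : 0 < prm.ρ₁
  ρ₂_pos : 0 < prm.ρ₂
  ηx_pos : 0 < prm.ηx
  ηy_pos : 0 < prm.ηy
  ηz_pos : 0 < prm.ηz
  ηu_pos : 0 < prm.ηu
  ηv_pos : 0 < prm.ηv
  ρ₁_le : prm.ρ₁ * ‖A‖ ^ 2 ≤ μ / 2
  ρ₂_le : prm.ρ₂ * ‖A‖ ^ 2 ≤ μ

/-- The variables `x`, `y' = (y, α)`, `z' = (z, β)`, `u`, `v` of the algorithm. -/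
structure State (dx dy dh : ℕ) where
  x : EuclideanSpace ℝ (Fin dx)
  y : EuclideanSpace ℝ (Fin dy)
  α : EuclideanSpace ℝ (Fin dh)
  z : EuclideanSpace ℝ (Fin dy)
  β : EuclideanSpace ℝ (Fin dh)
  u : EuclideanSpace ℝ (Fin dh)
  v : EuclideanSpace ℝ (Fin dh)

/-- The set `𝒫 = {(y, α) : α ≤ 0}`. -/
def slackSet (dy dh : ℕ) : Set (EuclideanSpace ℝ (Fin dy) × EuclideanSpace ℝ (Fin dh)) :=
  {p | ∀ i, p.2 i ≤ 0}

/-- The projection of `α` onto the nonpositive orthant. -/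
def projNeg {dh : ℕ} (α : EuclideanSpace ℝ (Fin dh)) : EuclideanSpace ℝ (Fin dh) :=
  WithLp.toLp 2 fun i => min (α i) 0

/-- `(y, projNeg α)` is the Euclidean projection of `(y, α)` onto `𝒫`. -/
theorem projNeg_isProjection {dy dh : ℕ} (y : EuclideanSpace ℝ (Fin dy))
    (α : EuclideanSpace ℝ (Fin dh)) :
    (y, projNeg α) ∈ slackSet dy dh ∧
      ∀ q ∈ slackSet dy dh,
        jointNorm (y - y) (α - projNeg α) ≤ jointNorm (y - q.1) (α - q.2) := by
  refine ⟨fun i => by simp [projNeg], fun q hq => ?_⟩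
  unfold jointNorm
  apply Real.sqrt_le_sqrt
  have h1 : ‖α - projNeg α‖ ^ 2 ≤ ‖α - q.2‖ ^ 2 := by
    rw [EuclideanSpace.norm_sq_eq, EuclideanSpace.norm_sq_eq]
    apply Finset.sum_le_sum
    intro i _
    have hqi : q.2 i ≤ 0 := hq i
    simp only [PiLp.sub_apply, projNeg, Real.norm_eq_abs, sq_abs]
    rcases le_total (α i) 0 with h | h
    · rw [min_eq_left h]; nlinarith [sq_nonneg (α i - q.2 i)]
    · rw [min_eq_right h]; nlinarith
  have h2 : ‖y - y‖ ^ 2 = 0 := by simp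
  nlinarith [sq_nonneg ‖y - q.1‖]

namespace Bilevel

variable {dx dy dh : ℕ} (P : Bilevel dx dy dh)

/-- The constraint function `h(y) = A y - b`. -/
def h (y : EuclideanSpace ℝ (Fin dy)) : EuclideanSpace ℝ (Fin dh) := P.A y - P.b

/-- The lower-level feasible set `𝒴 = {y : h(y) ≤ 0}`. -/
def feasible : Set (EuclideanSpace ℝ (Fin dy)) := {y | ∀ i, P.h y i ≤ 0}

/-- Linear independence of the gradients of the constraints that are active at `y`. -/
def LICQ (y : EuclideanSpace ℝ (Fin dy)) : Prop :=
  LinearIndependent ℝ fun i : {i : Fin dh // P.h y i = 0} =>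
    gradient (fun y' => P.h y' i.1) y

/-- The penalized lower-level objective `g_δ(x, y) = δ f(x, y) + g(x, y)`. -/
def gPen (δ : ℝ) (x : EuclideanSpace ℝ (Fin dx)) (y : EuclideanSpace ℝ (Fin dy)) : ℝ :=
  δ * P.f x y + P.g x y

/-- The lower-level solution `y*(x) = z*(x)`. -/
def yStar (x : EuclideanSpace ℝ (Fin dx)) : EuclideanSpace ℝ (Fin dy) :=
  argminOn P.feasible (P.g x)

/-- The penalized lower-level solution `y*_δ(x)`. -/
def yPenStar (δ : ℝ) (x : EuclideanSpace ℝ (Fin dx)) : EuclideanSpace ℝ (Fin dy) :=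
  argminOn P.feasible (P.gPen δ x)

/-- The hyper-objective `Φ(x) = f(x, y*(x))`. -/
def hyper (x : EuclideanSpace ℝ (Fin dx)) : ℝ := P.f x (P.yStar x)

/-- The reformulated objective
`Φ_δ(x) = f(x, y*_δ(x)) + (g(x, y*_δ(x)) - g(x, y*(x))) / δ`. -/
def hyperPen (δ : ℝ) (x : EuclideanSpace ℝ (Fin dx)) : ℝ :=
  P.f x (P.yPenStar δ x) + (P.g x (P.yPenStar δ x) - P.g x (P.yStar x)) / δ

/-- The Lagrangian dual function `u ↦ inf_y φ(y) + uᵀ h(y)` of `min φ` over `𝒴`. -/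
def dual (φ : EuclideanSpace ℝ (Fin dy) → ℝ) (u : EuclideanSpace ℝ (Fin dh)) : ℝ :=
  ⨅ y, (φ y + inner ℝ u (P.h y))

/-- `u` is an optimal Lagrange multiplier of `min φ` over `𝒴`. -/
def IsMultiplier (φ : EuclideanSpace ℝ (Fin dy) → ℝ) (u : EuclideanSpace ℝ (Fin dh)) : Prop :=
  u ∈ {u | ∀ i, 0 ≤ u i} ∧ IsMaxOn (P.dual φ) {u | ∀ i, 0 ≤ u i} u

/-- The multiplier `u*_δ(x)` of `y*_δ(x)`. -/
def uStar (δ : ℝ) (x : EuclideanSpace ℝ (Fin dx)) : EuclideanSpace ℝ (Fin dh) :=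
  argmaxOn {u | ∀ i, 0 ≤ u i} (P.dual (P.gPen δ x))

/-- The multiplier `v*(x)` of `y*(x)`. -/
def vStar (x : EuclideanSpace ℝ (Fin dx)) : EuclideanSpace ℝ (Fin dh) :=
  argmaxOn {u | ∀ i, 0 ≤ u i} (P.dual (P.g x))

/-- The residual `A' y' - b = A y - α - b` for `y' = (y, α)` and `A' = (A, -I)`. -/
def resid (p : EuclideanSpace ℝ (Fin dy) × EuclideanSpace ℝ (Fin dh)) :
    EuclideanSpace ℝ (Fin dh) :=
  P.h p.1 - p.2

/-- The augmented Lagrangian `K(x, y', z', u, v)`. -/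
def augLag (prm : Params) (δ : ℝ) (x : EuclideanSpace ℝ (Fin dx))
    (p q : EuclideanSpace ℝ (Fin dy) × EuclideanSpace ℝ (Fin dh))
    (u v : EuclideanSpace ℝ (Fin dh)) : ℝ :=
  δ * P.f x p.1 + P.g x p.1 - P.g x q.1
    + inner ℝ u (P.resid p) - inner ℝ v (P.resid q)
    + prm.ρ₁ / 2 * ‖P.resid p‖ ^ 2 - prm.ρ₂ / 2 * ‖P.resid q‖ ^ 2

/-- `y'*_δ(x, u)`, the minimizer of `K` over `y' ∈ 𝒫`. It does not depend on the values of `z'`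
and `v`, which only enter `K` through terms free of `y'`; both are set to zero. -/
def yAugStar (prm : Params) (δ : ℝ) (x : EuclideanSpace ℝ (Fin dx))
    (u : EuclideanSpace ℝ (Fin dh)) : EuclideanSpace ℝ (Fin dy) × EuclideanSpace ℝ (Fin dh) :=
  argminOn (slackSet dy dh) fun p => P.augLag prm δ x p 0 u 0

/-- `z'*(x, v)`, the maximizer of `K` over `z' ∈ 𝒫`. It does not depend on the values of `y'`, `u`
and `δ`, which only enter `K` through terms free of `z'`; all are set to zero. -/
def zAugStar (prm : Params) (x : EuclideanSpace ℝ (Fin dx))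
    (v : EuclideanSpace ℝ (Fin dh)) : EuclideanSpace ℝ (Fin dy) × EuclideanSpace ℝ (Fin dh) :=
  argmaxOn (slackSet dy dh) fun q => P.augLag prm 0 x 0 q 0 v

/-- One iteration of SFLCB: the multipliers are updated first, and then `x`, `y'`, `z'` take
simultaneous (projected) gradient steps on `K` at the old `x`, `y'`, `z'` and the new `u`, `v`. -/
def step (prm : Params) (δ : ℝ) (s : State dx dy dh) : State dx dy dh :=
  let u := s.u + prm.ηu • P.resid (s.y, s.α)
  let v := s.v + prm.ηv • P.resid (s.z, s.β)
  { x := s.x - prm.ηx • gradient (fun x => P.augLag prm δ x (s.y, s.α) (s.z, s.β) u v) s.x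
    y := s.y - prm.ηy • gradient (fun y => P.augLag prm δ s.x (y, s.α) (s.z, s.β) u v) s.y
    α := projNeg
      (s.α - prm.ηy • gradient (fun α => P.augLag prm δ s.x (s.y, α) (s.z, s.β) u v) s.α)
    z := s.z + prm.ηz • gradient (fun z => P.augLag prm δ s.x (s.y, s.α) (z, s.β) u v) s.z
    β := projNeg
      (s.β + prm.ηz • gradient (fun β => P.augLag prm δ s.x (s.y, s.α) (s.z, β) u v) s.β)
    u := u
    v := v }

/-- One iteration of SFLCB with `x` kept fixed. -/
def stepFixed (prm : Params) (δ : ℝ) (s : State dx dy dh) : State dx dy dh :=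
  { P.step prm δ s with x := s.x }

/-- The state after `n` iterations of SFLCB from `s`. -/
def run (prm : Params) (δ : ℝ) (s : State dx dy dh) (n : ℕ) : State dx dy dh :=
  (P.step prm δ)^[n] s

/-- The state after `n` iterations of SFLCB with fixed `x` from `s`. -/
def runFixed (prm : Params) (δ : ℝ) (s : State dx dy dh) (n : ℕ) : State dx dy dh :=
  (P.stepFixed prm δ)^[n] s

/-- Accuracy `r` of the points and multipliers in `s`, relative to `s.x`. -/
structure Accurate (prm : Params) (δ r : ℝ) (s : State dx dy dh) : Prop where
  y_le : ‖s.y - P.yPenStar δ s.x‖ ≤ r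
  yAug_le : ‖P.resid (P.yAugStar prm δ s.x s.u)‖ ≤ r
  yResid_le : ‖P.resid (s.y, s.α)‖ ≤ r
  u_le : ‖s.u - P.uStar δ s.x‖ ≤ r
  z_le : ‖s.z - P.yStar s.x‖ ≤ r
  zAug_le : ‖P.resid (P.zAugStar prm s.x s.v)‖ ≤ r
  zResid_le : ‖P.resid (s.z, s.β)‖ ≤ r
  v_le : ‖s.v - P.vStar s.x‖ ≤ r

/-- The standing assumptions. The gradient conditions state that the full gradients `∇f`, `∇g`
are jointly Lipschitz in `(x, y)`. -/
structure Assumptions (lf0 lf1 lg1 μ : ℝ) : Prop where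
  f_contDiff : ContDiff ℝ 1
    fun p : EuclideanSpace ℝ (Fin dx) × EuclideanSpace ℝ (Fin dy) => P.f p.1 p.2
  g_contDiff : ContDiff ℝ 1
    fun p : EuclideanSpace ℝ (Fin dx) × EuclideanSpace ℝ (Fin dy) => P.g p.1 p.2
  feasible_nonempty : P.feasible.Nonempty
  hyper_bddBelow : BddBelow (range P.hyper)
  f_lipschitz : ∀ x₁ x₂, ∀ y₁ ∈ P.feasible, ∀ y₂ ∈ P.feasible,
    |P.f x₁ y₁ - P.f x₂ y₂| ≤ lf0 * jointNorm (x₁ - x₂) (y₁ - y₂)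
  grad_f_lipschitz : ∀ x₁ x₂ y₁ y₂,
    jointNorm (gradient (fun x => P.f x y₁) x₁ - gradient (fun x => P.f x y₂) x₂)
      (gradient (P.f x₁) y₁ - gradient (P.f x₂) y₂) ≤ lf1 * jointNorm (x₁ - x₂) (y₁ - y₂)
  grad_g_lipschitz : ∀ x₁ x₂ y₁ y₂,
    jointNorm (gradient (fun x => P.g x y₁) x₁ - gradient (fun x => P.g x y₂) x₂)
      (gradient (P.g x₁) y₁ - gradient (P.g x₂) y₂) ≤ lg1 * jointNorm (x₁ - x₂) (y₁ - y₂)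
  g_strongConvex : ∀ x, StrongConvexOn univ μ (P.g x)

end Bilevel

end

/-! The augmented Lagrangian `K` is a difference of two Lagrangians that share only `x`
(`augLag_eq`): one in `(y', u)` for `g_δ`, one in `(z', v)` for `g`. Each is a `SaddleBlock`, a
smooth strongly convex problem with a linear equality constraint. Its constants are free of `δ`,
because `δ f` changes the modulus and smoothness of `g` by at most `μ / 2` (`regular_gPen`).

One block at fixed `x`. Progress is measured by `gap`, the primal gap `L(p,u) - d(u)` plus the dual
gap `val - d(u)`, where `d` is the dual function. The multiplier step raises `L` by `ηu ‖B p - b‖²`,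
while concavity raises `2 d` by at least `2 ηu ⟪B p - b, res⟫`, with `res` the residual of the
Lagrangian's minimizer. The balance is `ηu ‖B p - b - res‖² - ηu ‖res‖²`. The first square is
absorbed by the descent of the projected gradient step, whose length controls the distance to that
minimizer (`gap_step`).

Moving `x`. `δ Φ_δ` is the difference of the two optimal values, and `merit` adds both gaps to it.
The optimal values are differentiable by an envelope argument. The direction used by the algorithm
misses the true gradient by a multiple of the residuals and step lengths, so Young's inequality and
a small `δ`-free step in `x` give descent (`merit_step`).

This needs the error bound `‖sol - opt‖ ≤ κ ‖res‖` at every `x`. The Lagrangian's minimizer solves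
the constrained problem with right-hand side `b + res`, and solutions are Lipschitz in the
right-hand side with a constant independent of `b` and the multipliers (`KKT.norm_sub_le`): a
difference of multipliers may be replaced by a sign-conformal vector bounded by its image under the
adjoint of `A` (`exists_conformal_norm_le`). No constraint qualification enters there. LICQ at
`y*(x₀)` serves the accuracy of the multipliers, through stability of the inactive constraints, and
LICQ gives uniqueness.

Counting. The initial gaps are bounded uniformly in `δ`, so among order `δ⁻²` iterations at fixed
`x` one has squared residuals plus squared step lengths at most `δ²`. This yields all accuracies and
gaps of order `δ²` (`block_accuracy`). The potential, `δ Φ_δ` plus the gaps, then lies only `O(δ)`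
above its lower bound. So `N` further iterations contain one with `‖δ ∇Φ_δ‖² = O(δ / N)`, and `N` of
order `ε⁻³` suffices. -/

noncomputable section

/-! ### Smooth and strongly convex functions, first-order conditions, averaging. -/

section Optimization

variable {V : Type*} [NormedAddCommGroup V] [InnerProductSpace ℝ V]

/-- The quadratic bound for functions with Lipschitz gradient. -/
theorem abs_sub_sub_inner_gradient_le [CompleteSpace V] {φ : V → ℝ} {ℓ : ℝ}
    (hd : Differentiable ℝ φ)
    (hl : ∀ x y, ‖gradient φ x - gradient φ y‖ ≤ ℓ * ‖x - y‖) (x y : V) :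
    |φ y - φ x - inner ℝ (gradient φ x) (y - x)| ≤ ℓ / 2 * ‖y - x‖ ^ 2 := by
  set Δ := y - x with hΔ
  have hder : ∀ t : ℝ, HasDerivAt (fun t : ℝ => φ (x + t • Δ))
      (inner ℝ (gradient φ (x + t • Δ)) Δ) t := by
    intro t
    have h1 := (hd (x + t • Δ)).hasGradientAt.hasFDerivAt
    have h2 : HasDerivAt (fun t : ℝ => x + t • Δ) Δ t := by
      simpa using ((hasDerivAt_id t).smul_const Δ).const_add x
    exact (h1.comp_hasDerivAt t h2).congr_deriv (by simp)
  have hbd : ∀ t : ℝ, 0 ≤ t →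
      |inner ℝ (gradient φ (x + t • Δ)) Δ - inner ℝ (gradient φ x) Δ| ≤ ℓ * t * ‖Δ‖ ^ 2 := by
    intro t ht
    rw [← inner_sub_left]
    refine (abs_real_inner_le_norm _ _).trans ?_
    have := hl (x + t • Δ) x
    rw [add_sub_cancel_left, norm_smul, Real.norm_eq_abs, abs_of_nonneg ht] at this
    nlinarith [mul_le_mul_of_nonneg_right this (norm_nonneg Δ)]
  -- The sign `s` treats the upper and lower bounds at once; `ψ` is the error along the segment
  -- minus its claimed bound.
  have key : ∀ s : ℝ, |s| = 1 →
      s * (φ y - φ x - inner ℝ (gradient φ x) Δ) ≤ ℓ / 2 * ‖Δ‖ ^ 2 := by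
    intro s hs
    let ψ : ℝ → ℝ := fun t =>
      s * (φ (x + t • Δ) - t * inner ℝ (gradient φ x) Δ) - ℓ / 2 * ‖Δ‖ ^ 2 * t ^ 2
    have hψ : ∀ t, HasDerivAt ψ (s * (inner ℝ (gradient φ (x + t • Δ)) Δ
        - inner ℝ (gradient φ x) Δ) - ℓ / 2 * ‖Δ‖ ^ 2 * (2 * t)) t := by
      intro t
      have h3 := (((hder t).sub ((hasDerivAt_id t).mul_const
        (inner ℝ (gradient φ x) Δ))).const_mul s).sub
        (((hasDerivAt_pow 2 t)).const_mul (ℓ / 2 * ‖Δ‖ ^ 2))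
      exact h3.congr_deriv (by simp)
    have hanti : AntitoneOn ψ (Icc 0 1) := by
      apply antitoneOn_of_deriv_nonpos (convex_Icc 0 1)
      · exact fun t _ => (hψ t).continuousAt.continuousWithinAt
      · exact fun t _ => (hψ t).differentiableAt.differentiableWithinAt
      · intro t ht
        rw [interior_Icc] at ht
        rw [(hψ t).deriv]
        have h4 := hbd t ht.1.le
        have h5 := le_abs_self (s * (inner ℝ (gradient φ (x + t • Δ)) Δ
          - inner ℝ (gradient φ x) Δ))
        rw [abs_mul, hs, one_mul] at h5
        linarith
    have := hanti (left_mem_Icc.2 zero_le_one) (right_mem_Icc.2 zero_le_one) zero_le_one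
    have hxy : x + Δ = y := by simp [hΔ]
    simp only [ψ, one_smul, zero_smul, add_zero, hxy] at this
    linarith
  rw [abs_le]
  constructor
  · have := key (-1) (by simp)
    linarith
  · have := key 1 (by simp)
    linarith

/-- The first-order characterization of strong convexity. -/
theorem StrongConvexOn.add_inner_gradient_le [CompleteSpace V] {φ : V → ℝ} {m : ℝ}
    (hc : StrongConvexOn univ m φ) (hd : Differentiable ℝ φ) (x y : V) :
    φ x + inner ℝ (gradient φ x) (y - x) + m / 2 * ‖y - x‖ ^ 2 ≤ φ y := by
  set Δ := y - x with hΔ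
  have hder : HasDerivAt (fun t : ℝ => φ (x + t • Δ)) (inner ℝ (gradient φ x) Δ) 0 := by
    have h1 := (hd (x + (0 : ℝ) • Δ)).hasGradientAt.hasFDerivAt
    have h2 : HasDerivAt (fun t : ℝ => x + t • Δ) Δ 0 := by
      simpa using ((hasDerivAt_id (0 : ℝ)).smul_const Δ).const_add x
    exact (h1.comp_hasDerivAt 0 h2).congr_deriv (by simp)
  have hlim := hder.tendsto_slope_zero_right
  have hr : Filter.Tendsto (fun t : ℝ => φ y - φ x - (1 - t) * (m / 2 * ‖Δ‖ ^ 2))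
      (nhdsWithin 0 (Ioi 0)) (nhds (φ y - φ x - (1 - 0) * (m / 2 * ‖Δ‖ ^ 2))) := by
    apply Filter.Tendsto.mono_left _ nhdsWithin_le_nhds
    exact (by fun_prop : Continuous fun t : ℝ =>
      φ y - φ x - (1 - t) * (m / 2 * ‖Δ‖ ^ 2)).tendsto 0
  have hle := le_of_tendsto_of_tendsto hlim hr (by
    filter_upwards [Ioo_mem_nhdsGT (zero_lt_one' ℝ)] with t ht
    have h3 := hc.2 (mem_univ x) (mem_univ y) (sub_nonneg.2 ht.2.le) ht.1.le (by ring)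
    have h4 : (1 - t) • x + t • y = x + t • Δ := by simp only [hΔ]; module
    rw [h4, norm_sub_rev, ← hΔ] at h3
    simp only [smul_eq_mul, zero_add, zero_smul, add_zero] at h3 ⊢
    rw [inv_mul_le_iff₀ ht.1]
    nlinarith)
  linarith

/-- A function that grows quadratically attains its minimum on a nonempty closed set. -/
theorem exists_isMinOn_of_quadratic_growth {V : Type*} [NormedAddCommGroup V] [ProperSpace V]
    {S : Set V} (hS : IsClosed S)
    (hne : S.Nonempty) {G : V → ℝ} (hG : Continuous G) {p : V} {a c s : ℝ} (hs : 0 < s)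
    (hlow : ∀ q, a - c * ‖q - p‖ + s * ‖q - p‖ ^ 2 ≤ G q) :
    ∃ q ∈ S, ∀ q' ∈ S, G q ≤ G q' := by
  obtain ⟨p₀, hp₀⟩ := hne
  have hev : ∀ᶠ q in Filter.cocompact V ⊓ Filter.principal S, G p₀ ≤ G q := by
    have ht := tendsto_norm_cocompact_atTop (E := V)
    have h1 := ht.eventually_ge_atTop (‖p‖ + (|c| + 1) / s + |G p₀ - a| + 1)
    filter_upwards [h1.filter_mono inf_le_left] with q hq
    refine le_trans ?_ (hlow q)
    have h2 : ‖q‖ - ‖p‖ ≤ ‖q - p‖ := norm_sub_norm_le q p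
    set N := ‖q - p‖
    have h3 : (|c| + 1) / s + |G p₀ - a| + 1 ≤ N := by linarith
    have h4 : (|c| + 1) / s ≤ N := by linarith [abs_nonneg (G p₀ - a)]
    rw [div_le_iff₀ hs] at h4
    have h5 : |G p₀ - a| ≤ N := by
      have : 0 ≤ (|c| + 1) / s := by positivity
      linarith
    have hN : 0 ≤ N := norm_nonneg _
    nlinarith [le_abs_self c, le_abs_self (G p₀ - a), mul_le_mul_of_nonneg_right h4 hN,
      mul_le_mul_of_nonneg_right (le_abs_self c) hN]
  obtain ⟨q, hq, hmin⟩ := hG.continuousOn.exists_isMinOn' hS hp₀ hev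
  exact ⟨q, hq, fun q' hq' => hmin hq'⟩

/-- A minimizer of `G` over a convex set satisfies the first-order condition. -/
theorem first_order_condition {C : Set V} (hC : Convex ℝ C) {G : V → ℝ} {p : V} (hp : p ∈ C)
    (D : V →ₗ[ℝ] ℝ) {Λ : ℝ} (hsm : ∀ q, G q ≤ G p + D (q - p) + Λ / 2 * ‖q - p‖ ^ 2)
    (hmin : ∀ q ∈ C, G p ≤ G q) {q : V} (hq : q ∈ C) : 0 ≤ D (q - p) := by
  have hr : Filter.Tendsto (fun t : ℝ => D (q - p) + t * (Λ / 2 * ‖q - p‖ ^ 2))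
      (nhdsWithin 0 (Ioi 0)) (nhds (D (q - p) + 0 * (Λ / 2 * ‖q - p‖ ^ 2))) := by
    apply Filter.Tendsto.mono_left _ nhdsWithin_le_nhds
    exact (by fun_prop : Continuous fun t : ℝ =>
      D (q - p) + t * (Λ / 2 * ‖q - p‖ ^ 2)).tendsto 0
  have := ge_of_tendsto (b := 0) hr (by
    filter_upwards [Ioo_mem_nhdsGT (zero_lt_one' ℝ)] with t ht
    have h1 := hmin (p + t • (q - p)) (hC.add_smul_sub_mem hp hq ⟨ht.1.le, ht.2.le⟩)
    have h2 := hsm (p + t • (q - p))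
    rw [add_sub_cancel_left, map_smul, norm_smul, Real.norm_eq_abs, abs_of_pos ht.1,
      smul_eq_mul] at h2
    have h3 : 0 ≤ t * (D (q - p) + t * (Λ / 2 * ‖q - p‖ ^ 2)) := by nlinarith
    exact nonneg_of_mul_nonneg_right h3 ht.1)
  linarith

/-- If `s t² ≤ l (t d + d²)` then `t` is at most a multiple of `d`. -/
theorem le_of_sq_le_mul_add_sq {s l t d : ℝ} (hs : 0 < s) (hl : 0 ≤ l) (hd : 0 ≤ d)
    (h : s * t ^ 2 ≤ l * (t * d + d ^ 2)) : t ≤ (1 + 2 * l / s) * d := by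
  have h0 : 0 ≤ 2 * l / s * d := by positivity
  rcases le_or_gt t d with htd | htd
  · linarith
  · have ht' : 0 < t := lt_of_le_of_lt hd htd
    have h1 : s * t ≤ 2 * l * d := by
      have : (s * t) * t ≤ (2 * l * d) * t := by
        nlinarith [mul_le_mul_of_nonneg_left htd.le (mul_nonneg hl hd)]
      exact le_of_mul_le_mul_right this ht'
    have h2 : t ≤ 2 * l * d / s := by rw [le_div_iff₀ hs]; linarith
    have h3 : 2 * l * d / s = 2 * l / s * d := by ring
    linarith

/-- A telescoping bound: among the first `N` decrements one is at most the average. -/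
theorem exists_decrement_le {W D : ℕ → ℝ} {a : ℝ} {N : ℕ} (hN : 0 < N)
    (hstep : ∀ t, W (t + 1) ≤ W t - D t) (hlow : ∀ t, a ≤ W t) :
    ∃ t < N, N * D t ≤ W 0 - a := by
  have hsum : ∀ n, ∑ t ∈ Finset.range n, D t ≤ W 0 - W n := by
    intro n
    induction n with
    | zero => simp
    | succ n ih => rw [Finset.sum_range_succ]; linarith [hstep n]
  by_contra! hcon
  have h1 : ∑ t ∈ Finset.range N, (W 0 - a) < ∑ t ∈ Finset.range N, N * D t :=
    Finset.sum_lt_sum_of_nonempty (by simpa using hN.ne') fun t h =>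
      hcon t (Finset.mem_range.1 h)
  rw [Finset.sum_const, ← Finset.mul_sum, Finset.card_range, nsmul_eq_mul] at h1
  have h2 : (0 : ℝ) < N := by exact_mod_cast hN
  have h3 := lt_of_mul_lt_mul_left h1 h2.le
  linarith [hsum N, hlow N]

end Optimization

/-! ### One primal-dual block: growth, sensitivity in `x`, descent of the gap. -/

/-- A parametric problem `min F(x, p)` over `p ∈ S` with `B p = b`, together with the gradients
of `F`, the minimizer `sol x u` over `S` of the Lagrangian and the solution `opt x`. -/
structure SaddleBlock (V X H : Type*) [NormedAddCommGroup V] [InnerProductSpace ℝ V]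
    [NormedAddCommGroup X] [InnerProductSpace ℝ X]
    [NormedAddCommGroup H] [InnerProductSpace ℝ H] where
  F : X → V → ℝ
  gp : X → V → V
  gx : X → V → X
  B : V →L[ℝ] H
  b : H
  S : Set V
  sol : X → H → V
  opt : X → V

namespace SaddleBlock

variable {V X H : Type*} [NormedAddCommGroup V] [InnerProductSpace ℝ V]
  [NormedAddCommGroup X] [InnerProductSpace ℝ X] [NormedAddCommGroup H] [InnerProductSpace ℝ H]

section Defs

variable (K : SaddleBlock V X H)

/-- The Lagrangian. -/
def lag (x : X) (p : V) (u : H) : ℝ := K.F x p + inner ℝ u (K.B p - K.b)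

/-- The dual function. -/
def dualVal (x : X) (u : H) : ℝ := K.lag x (K.sol x u) u

/-- The optimal value. -/
def val (x : X) : ℝ := K.F x (K.opt x)

/-- The residual of the minimizer of the Lagrangian. -/
def res (x : X) (u : H) : H := K.B (K.sol x u) - K.b

/-- The sum of the primal gap and the dual gap. -/
def gap (x : X) (p : V) (u : H) : ℝ := K.lag x p u + K.val x - 2 * K.dualVal x u

/-- The derivative of the Lagrangian in `p`. -/
def dlag (x : X) (p : V) (u : H) : V →ₗ[ℝ] ℝ :=
  (innerSL ℝ (K.gp x p) + (innerSL ℝ u).comp K.B : V →L[ℝ] ℝ)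

/-- `(p', u')` is obtained from `(p, u)` by a multiplier step with step size `ηu` and a projected
gradient step with step size `η`; the projection is expressed by its variational inequality. -/
structure IsStep (ηu η : ℝ) (x : X) (p : V) (u : H) (p' : V) (u' : H) : Prop where
  mem : p' ∈ K.S
  dual_eq : u' = u + ηu • (K.B p - K.b)
  proj : ∀ q ∈ K.S, inner ℝ (p - p') (q - p') ≤ η * K.dlag x p u' (q - p')

/-- Strong convexity, smoothness and the error bound. -/
structure Regular (σ Λ ℓ κ β : ℝ) : Prop where
  convex_S : Convex ℝ K.S
  strong : ∀ x p q, K.F x p + inner ℝ (K.gp x p) (q - p) + σ / 2 * ‖q - p‖ ^ 2 ≤ K.F x q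
  smooth : ∀ x p q, K.F x q ≤ K.F x p + inner ℝ (K.gp x p) (q - p) + Λ / 2 * ‖q - p‖ ^ 2
  smooth_x : ∀ x x' p, |K.F x' p - K.F x p - inner ℝ (K.gx x p) (x' - x)| ≤ ℓ / 2 * ‖x' - x‖ ^ 2
  gx_lip : ∀ x p q, ‖K.gx x p - K.gx x q‖ ≤ ℓ * ‖p - q‖
  B_le : ∀ p, ‖K.B p‖ ≤ β * ‖p‖
  sol_mem : ∀ x u, K.sol x u ∈ K.S
  sol_min : ∀ x u, ∀ q ∈ K.S, K.lag x (K.sol x u) u ≤ K.lag x q u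
  opt_mem : ∀ x, K.opt x ∈ K.S
  opt_res : ∀ x, K.B (K.opt x) = K.b
  opt_min : ∀ x, ∀ q ∈ K.S, K.B q = K.b → K.F x (K.opt x) ≤ K.F x q
  error_bound : ∀ x u, ‖K.sol x u - K.opt x‖ ≤ κ * ‖K.res x u‖

end Defs

variable {K : SaddleBlock V X H} {σ Λ ℓ κ β : ℝ}

theorem dlag_apply (x : X) (p : V) (u : H) (v : V) :
    K.dlag x p u v = inner ℝ (K.gp x p) v + inner ℝ u (K.B v) := by
  simp [dlag]

theorem lag_of_feasible {x : X} {p : V} (hp : K.B p = K.b) (u : H) : K.lag x p u = K.F x p := by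
  simp [lag, hp]

theorem lag_dual_change (x : X) (p : V) (u u' : H) :
    K.lag x p u' = K.lag x p u + inner ℝ (u' - u) (K.B p - K.b) := by
  simp only [lag, inner_sub_left]; ring

namespace Regular

variable (hK : K.Regular σ Λ ℓ κ β)
include hK

theorem lag_strong (x : X) (u : H) (p q : V) :
    K.lag x p u + K.dlag x p u (q - p) + σ / 2 * ‖q - p‖ ^ 2 ≤ K.lag x q u := by
  have := hK.strong x p q
  simp only [lag, dlag_apply, map_sub, inner_sub_right] at *
  linarith

theorem lag_smooth (x : X) (u : H) (p q : V) :
    K.lag x q u ≤ K.lag x p u + K.dlag x p u (q - p) + Λ / 2 * ‖q - p‖ ^ 2 := by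
  have := hK.smooth x p q
  simp only [lag, dlag_apply, map_sub, inner_sub_right] at *
  linarith

theorem lag_x_sub_le (x x' : X) (u : H) (p : V) :
    |K.lag x' p u - K.lag x p u - inner ℝ (K.gx x p) (x' - x)| ≤ ℓ / 2 * ‖x' - x‖ ^ 2 := by
  have := hK.smooth_x x x' p
  simpa only [lag, add_sub_add_right_eq_sub] using this

/-- The derivative at a minimizer over a convex set is nonnegative in feasible directions, so the
quadratic term of strong convexity survives in full. -/
theorem sol_growth (x : X) (u : H) {q : V} (hq : q ∈ K.S) :
    K.dualVal x u + σ / 2 * ‖q - K.sol x u‖ ^ 2 ≤ K.lag x q u := by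
  have h1 := first_order_condition hK.convex_S (hK.sol_mem x u) _
    (hK.lag_smooth x u (K.sol x u)) (hK.sol_min x u) hq
  have h2 := hK.lag_strong x u (K.sol x u) q
  unfold dualVal
  linarith

/-- The same argument on the slice of `S` where `B p = b`, which is again convex. -/
theorem opt_growth (x : X) {q : V} (hq : q ∈ K.S) (hqb : K.B q = K.b) :
    K.val x + σ / 2 * ‖q - K.opt x‖ ^ 2 ≤ K.F x q := by
  have hc : Convex ℝ (K.S ∩ {q | K.B q = K.b}) := by
    refine hK.convex_S.inter fun p hp q hq a c _ _ hac => ?_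
    rw [mem_ofPred_eq] at *
    rw [map_add, map_smul, map_smul, hp, hq, ← add_smul, hac, one_smul]
  have h1 := first_order_condition (G := K.F x) hc (p := K.opt x)
    ⟨hK.opt_mem x, hK.opt_res x⟩ (innerSL ℝ (K.gp x (K.opt x)) : V →L[ℝ] ℝ).toLinearMap
    (fun q => by simpa using hK.smooth x (K.opt x) q) (fun q hq => hK.opt_min x q hq.1 hq.2)
    ⟨hq, hqb⟩
  have h2 := hK.strong x (K.opt x) q
  simp only [ContinuousLinearMap.coe_coe, innerSL_apply_apply] at h1
  unfold val
  linarith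

theorem dualVal_le_val (x : X) (u : H) : K.dualVal x u ≤ K.val x := by
  have := hK.sol_min x u _ (hK.opt_mem x)
  rwa [lag_of_feasible (hK.opt_res x)] at this

/-- The primal part is nonnegative by minimality of `sol`, the dual part by weak duality. This is
the lower bound for telescoping. -/
theorem gap_nonneg (hσ : 0 < σ) (x : X) (u : H) {p : V} (hp : p ∈ K.S) : 0 ≤ K.gap x p u := by
  have h1 := hK.dualVal_le_val x u
  have h2 := hK.sol_growth x u hp
  have h3 : 0 ≤ σ / 2 * ‖p - K.sol x u‖ ^ 2 := by positivity
  unfold gap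
  linarith

/-- The Lagrangian dual function is concave, with supergradient the residual. -/
theorem dualVal_le (x : X) (u u' : H) :
    K.dualVal x u' ≤ K.dualVal x u + inner ℝ (u' - u) (K.res x u) := by
  have h1 := hK.sol_min x u' _ (hK.sol_mem x u)
  rw [lag_dual_change x (K.sol x u) u u'] at h1
  exact h1

/-- The difference of the Lagrangian at two points under a change of `x`. -/
theorem mixed_difference (x x' : X) (p q : V) :
    (K.F x p - K.F x' p) - (K.F x q - K.F x' q) ≤
      ℓ * (‖p - q‖ * ‖x' - x‖ + ‖x' - x‖ ^ 2) := by
  have h1 := (abs_le.1 (hK.smooth_x x x' p)).1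
  have h2 := (abs_le.1 (hK.smooth_x x x' q)).2
  have h3 : inner ℝ (K.gx x q - K.gx x p) (x' - x) ≤ ℓ * ‖p - q‖ * ‖x' - x‖ := by
    refine (real_inner_le_norm _ _).trans ?_
    have := hK.gx_lip x q p
    rw [norm_sub_rev q p] at this
    gcongr
  rw [inner_sub_left] at h3
  nlinarith

/-- Test the growth inequality at `x` and at `x'` with the other's minimizer and add. The multiplier
terms cancel and leave a mixed difference of `F`, which is small when `x'` is close to `x`. -/
theorem sol_lipschitz (hσ : 0 < σ) (hℓ : 0 ≤ ℓ) (x x' : X) (u : H) :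
    ‖K.sol x' u - K.sol x u‖ ≤ (1 + 2 * ℓ / σ) * ‖x' - x‖ := by
  refine le_of_sq_le_mul_add_sq hσ hℓ (norm_nonneg _) ?_
  have h1 := hK.sol_growth x u (hK.sol_mem x' u)
  have h2 := hK.sol_growth x' u (hK.sol_mem x u)
  have h3 := hK.mixed_difference x x' (K.sol x' u) (K.sol x u)
  rw [norm_sub_rev (K.sol x u)] at h2
  simp only [dualVal, lag] at h1 h2
  linarith

theorem opt_lipschitz (hσ : 0 < σ) (hℓ : 0 ≤ ℓ) (x x' : X) :
    ‖K.opt x' - K.opt x‖ ≤ (1 + 2 * ℓ / σ) * ‖x' - x‖ := by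
  refine le_of_sq_le_mul_add_sq hσ hℓ (norm_nonneg _) ?_
  have h1 := hK.opt_growth x (hK.opt_mem x') (hK.opt_res x')
  have h2 := hK.opt_growth x' (hK.opt_mem x) (hK.opt_res x)
  have h3 := hK.mixed_difference x x' (K.opt x') (K.opt x)
  rw [norm_sub_rev (K.opt x)] at h2
  simp only [val] at h1 h2
  linarith

/-- The optimal value is differentiable, with a quadratic bound on the remainder. -/
theorem val_sub_le (hσ : 0 < σ) (hℓ : 0 ≤ ℓ) (x x' : X) :
    |K.val x' - K.val x - inner ℝ (K.gx x (K.opt x)) (x' - x)| ≤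
      ℓ * (3 / 2 + 2 * ℓ / σ) * ‖x' - x‖ ^ 2 := by
  -- The constraints do not depend on `x`, so each solution competes in the other problem; this
  -- brackets the increment of `val`.
  have h1 := hK.opt_min x' _ (hK.opt_mem x) (hK.opt_res x)
  have h2 := hK.opt_min x _ (hK.opt_mem x') (hK.opt_res x')
  have h3 := (abs_le.1 (hK.smooth_x x x' (K.opt x))).2
  have h4 := (abs_le.1 (hK.smooth_x x x' (K.opt x'))).1
  have h5 : inner ℝ (K.gx x (K.opt x) - K.gx x (K.opt x')) (x' - x) ≤
      ℓ * ((1 + 2 * ℓ / σ) * ‖x' - x‖) * ‖x' - x‖ := by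
    refine (real_inner_le_norm _ _).trans ?_
    have := hK.gx_lip x (K.opt x) (K.opt x')
    rw [norm_sub_rev] at this
    have h6 := hK.opt_lipschitz hσ hℓ x x'
    rw [norm_sub_rev (K.opt x)] at this
    rw [norm_sub_rev]
    gcongr
    exact this.trans (by gcongr)
  rw [inner_sub_left] at h5
  have h7 : 0 ≤ ℓ * (1 + 2 * ℓ / σ) * ‖x' - x‖ ^ 2 := by positivity
  simp only [val] at *
  rw [abs_le]
  constructor <;> nlinarith

/-- Only this side is needed, since the dual value enters the gap with a negative sign. -/
theorem dualVal_sub_ge (hσ : 0 < σ) (hℓ : 0 ≤ ℓ) (x x' : X) (u : H) :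
    inner ℝ (K.gx x (K.sol x u)) (x' - x) - ℓ * (3 / 2 + 2 * ℓ / σ) * ‖x' - x‖ ^ 2 ≤
      K.dualVal x' u - K.dualVal x u := by
  have h2 := hK.sol_min x u _ (hK.sol_mem x' u)
  have h4 := (abs_le.1 (hK.lag_x_sub_le x x' u (K.sol x' u))).1
  have h5 : inner ℝ (K.gx x (K.sol x u) - K.gx x (K.sol x' u)) (x' - x) ≤
      ℓ * ((1 + 2 * ℓ / σ) * ‖x' - x‖) * ‖x' - x‖ := by
    refine (real_inner_le_norm _ _).trans ?_
    have := hK.gx_lip x (K.sol x u) (K.sol x' u)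
    rw [norm_sub_rev (K.sol x u)] at this
    have h6 := hK.sol_lipschitz hσ hℓ x x' u
    gcongr
    exact this.trans (by gcongr)
  rw [inner_sub_left] at h5
  simp only [dualVal] at *
  nlinarith

/-- The change of the gap under a change of `x`. -/
theorem gap_x_change (hσ : 0 < σ) (hℓ : 0 ≤ ℓ) (x x' : X) (p : V) (u : H) :
    K.gap x' p u ≤ K.gap x p u
      + ℓ * (‖p - K.sol x u‖ + κ * ‖K.res x u‖) * ‖x' - x‖
      + ℓ * (5 + 6 * ℓ / σ) * ‖x' - x‖ ^ 2 := by
  -- The first-order terms carry `gx` at `p`, at `opt` and, with weight minus two, at `sol`. They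
  -- pair into two differences that vanish at a saddle point.
  have h1 := (abs_le.1 (hK.lag_x_sub_le x x' u p)).2
  have h2 := (abs_le.1 (hK.val_sub_le hσ hℓ x x')).2
  have h3 := hK.dualVal_sub_ge hσ hℓ x x' u
  have h4 : inner ℝ (K.gx x p - K.gx x (K.sol x u)) (x' - x) ≤
      ℓ * ‖p - K.sol x u‖ * ‖x' - x‖ :=
    (real_inner_le_norm _ _).trans (by gcongr; exact hK.gx_lip x _ _)
  have h5 : inner ℝ (K.gx x (K.opt x) - K.gx x (K.sol x u)) (x' - x) ≤
      ℓ * (κ * ‖K.res x u‖) * ‖x' - x‖ := by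
    refine (real_inner_le_norm _ _).trans ?_
    have := hK.gx_lip x (K.opt x) (K.sol x u)
    rw [norm_sub_rev (K.opt x)] at this
    gcongr
    refine this.trans ?_
    gcongr
    exact hK.error_bound x u
  rw [inner_sub_left] at h4 h5
  have h6 : ℓ * (5 + 6 * ℓ / σ) * ‖x' - x‖ ^ 2 =
    ℓ / 2 * ‖x' - x‖ ^ 2 + 3 * (ℓ * (3 / 2 + 2 * ℓ / σ) * ‖x' - x‖ ^ 2) := by ring
  unfold gap
  linarith

/-- The distance to the minimizer of the Lagrangian is bounded by the length of a projected
gradient step. -/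
theorem norm_sub_sol_le (hσ : 0 < σ) (hΛ : 0 < Λ) {ηu : ℝ} {x : X} {p p' : V} {u u' : H}
    (hs : K.IsStep ηu Λ⁻¹ x p u p' u') :
    ‖p - K.sol x u'‖ ≤ 2 * Λ / σ * ‖p' - p‖ ∧
      K.lag x p' u' ≤ K.dualVal x u' + 2 * Λ ^ 2 / σ * ‖p' - p‖ ^ 2 := by
  set s := K.sol x u'
  have h1 := hK.lag_strong x u' p s
  have h2 := hK.lag_smooth x u' p p'
  have h3 := hs.proj s (hK.sol_mem x u')
  have h4 := hK.sol_growth x u' hs.mem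
  rw [inv_mul_eq_div, le_div_iff₀ hΛ] at h3
  -- Rewritten relative to `p`, the derivative terms of `h1`, `h2` and `h3` cancel on addition; what
  -- remains is `h7`.
  have e1 : s - p' = (s - p) - (p' - p) := by abel
  have e2 : p - p' = -(p' - p) := by abel
  rw [e1, e2, map_sub, inner_neg_left, inner_sub_right, real_inner_self_eq_norm_sq] at h3
  have h5 : inner ℝ (p' - p) (s - p) ≤ ‖p' - p‖ * ‖p - s‖ := by
    rw [norm_sub_rev p s]; exact real_inner_le_norm _ _
  rw [norm_sub_rev s p] at h1
  have h6 : 0 ≤ σ / 2 * ‖p' - s‖ ^ 2 := by positivity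
  have hd : K.dualVal x u' = K.lag x s u' := rfl
  have h7 : K.lag x p' u' - K.dualVal x u' ≤
      Λ * (‖p' - p‖ * ‖p - s‖) - σ / 2 * ‖p - s‖ ^ 2 := by
    rw [hd]; nlinarith [mul_le_mul_of_nonneg_left h5 hΛ.le, sq_nonneg ‖p' - p‖]
  have h8 : ‖p - s‖ ≤ 2 * Λ / σ * ‖p' - p‖ := by
    rcases (norm_nonneg (p - s)).eq_or_lt with h0 | h0
    · rw [← h0]; positivity
    · have h9 : σ / 2 * ‖p - s‖ ≤ Λ * ‖p' - p‖ := by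
        refine le_of_mul_le_mul_right ?_ h0
        nlinarith
      rw [div_mul_eq_mul_div, le_div_iff₀ hσ]
      linarith
  refine ⟨h8, ?_⟩
  have h10 : Λ * (‖p' - p‖ * ‖p - s‖) ≤ Λ * (‖p' - p‖ * (2 * Λ / σ * ‖p' - p‖)) := by gcongr
  have h11 : Λ * (‖p' - p‖ * (2 * Λ / σ * ‖p' - p‖)) = 2 * Λ ^ 2 / σ * ‖p' - p‖ ^ 2 := by ring
  have h12 : 0 ≤ σ / 2 * ‖p - s‖ ^ 2 := by positivity
  linarith

theorem norm_step_sub_sol_le (hσ : 0 < σ) (hΛ : 0 < Λ) {ηu : ℝ} {x : X} {p p' : V} {u u' : H}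
    (hs : K.IsStep ηu Λ⁻¹ x p u p' u') :
    ‖p' - K.sol x u'‖ ≤ (1 + 2 * Λ / σ) * ‖p' - p‖ := by
  have h1 := (hK.norm_sub_sol_le hσ hΛ hs).1
  have h2 : ‖p' - K.sol x u'‖ ≤ ‖p' - p‖ + ‖p - K.sol x u'‖ := norm_sub_le_norm_sub_add_norm_sub ..
  linarith

/-- One iteration at fixed `x` decreases the gap. -/
theorem gap_step (hσ : 0 < σ) (hΛ : 0 < Λ) {ηu : ℝ} (hηu : 0 ≤ ηu)
    (hsmall : ηu * (β * (2 * Λ / σ)) ^ 2 ≤ Λ / 4) {x : X} {p p' : V} {u u' : H}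
    (hs : K.IsStep ηu Λ⁻¹ x p u p' u') (hp : p ∈ K.S) (hβ : 0 ≤ β) :
    K.gap x p' u' ≤ K.gap x p u - ηu * ‖K.res x u'‖ ^ 2 - Λ / 4 * ‖p' - p‖ ^ 2 := by
  have h1 := hK.dualVal_le x u' u
  have h2 := hK.lag_smooth x u' p p'
  -- Testing the projection at the old iterate gives `-Λ ‖p' - p‖ ^ 2` in the linear term: half of
  -- it pays for smoothness, a quarter for `h7`, and a quarter is left.
  have h3 := hs.proj p hp
  rw [inv_mul_eq_div, le_div_iff₀ hΛ, real_inner_self_eq_norm_sq] at h3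
  rw [← neg_sub p' p, map_neg, norm_neg] at h3
  have h4 : K.lag x p u' = K.lag x p u + ηu * ‖K.B p - K.b‖ ^ 2 := by
    rw [lag_dual_change x p u u', hs.dual_eq, add_sub_cancel_left, inner_smul_left,
      real_inner_self_eq_norm_sq]
    simp
  have h5 : u - u' = -(ηu • (K.B p - K.b)) := by rw [hs.dual_eq]; abel
  rw [h5, inner_neg_left, inner_smul_left] at h1
  simp only [conj_trivial] at h1
  have h6 : ‖(K.B p - K.b) - K.res x u'‖ ≤ β * (2 * Λ / σ) * ‖p' - p‖ := by
    have : (K.B p - K.b) - K.res x u' = K.B (p - K.sol x u') := by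
      rw [res, map_sub]; abel
    rw [this]
    refine (hK.B_le _).trans ?_
    rw [mul_assoc]
    exact mul_le_mul_of_nonneg_left (hK.norm_sub_sol_le hσ hΛ hs).1 hβ
  have h7 : ηu * ‖(K.B p - K.b) - K.res x u'‖ ^ 2 ≤ Λ / 4 * ‖p' - p‖ ^ 2 := by
    calc _ ≤ ηu * (β * (2 * Λ / σ) * ‖p' - p‖) ^ 2 := by gcongr
      _ = ηu * (β * (2 * Λ / σ)) ^ 2 * ‖p' - p‖ ^ 2 := by ring
      _ ≤ _ := by gcongr
  -- Expanding the square produces the cross term by which twice the dual value rises; this is why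
  -- `gap` subtracts the dual value twice.
  rw [norm_sub_sq_real] at h7
  unfold gap
  nlinarith

end Regular
end SaddleBlock

/-! ### Two blocks coupled through `x`: descent of the potential. -/

namespace SaddleBlock

variable {V X H : Type*} [NormedAddCommGroup V] [InnerProductSpace ℝ V]
  [NormedAddCommGroup X] [InnerProductSpace ℝ X] [NormedAddCommGroup H] [InnerProductSpace ℝ H]
  {σ Λ ℓ κ β : ℝ}

/-- The squared length of a step in `p`, plus the squared residual after it. -/
def stepSq (K : SaddleBlock V X H) (x : X) (p p' : V) (u' : H) : ℝ :=
  ‖K.res x u'‖ ^ 2 + ‖p' - p‖ ^ 2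

theorem stepSq_nonneg (K : SaddleBlock V X H) (x : X) (p p' : V) (u' : H) :
    0 ≤ K.stepSq x p p' u' := by unfold stepSq; positivity

/-- The potential for the primal-dual method with two blocks. -/
def merit (K₁ K₂ : SaddleBlock V X H) (x : X) (p : V) (u : H) (q : V) (v : H) : ℝ :=
  K₁.val x - K₂.val x + (K₁.gap x p u + K₂.gap x q v)

/-- Constant in the first-order coupling of the two blocks through `x`. -/
def couplingConst (σ Λ ℓ κ : ℝ) : ℝ := ℓ * (1 + 2 * Λ / σ + κ)

/-- Constant in the second-order coupling of the two blocks through `x`. -/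
def curvatureConst (σ ℓ : ℝ) : ℝ := ℓ * (13 + 16 * ℓ / σ)

/-- The decrease rate at fixed `x`. -/
def rate (ηu Λ : ℝ) : ℝ := min ηu (Λ / 4)

/-- The step size in `x`. -/
def xStep (σ Λ ℓ κ ηu : ℝ) : ℝ :=
  (curvatureConst σ ℓ + 8 * (couplingConst σ Λ ℓ κ ^ 2 / rate ηu Λ) + 1)⁻¹

theorem rate_pos {ηu : ℝ} (hΛ : 0 < Λ) (hηu : 0 < ηu) : 0 < rate ηu Λ :=
  lt_min hηu (by positivity)

theorem xStep_pos (hσ : 0 < σ) (hΛ : 0 < Λ) (hℓ : 0 ≤ ℓ) {ηu : ℝ} (hηu : 0 < ηu) :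
    0 < xStep σ Λ ℓ κ ηu := by
  have := rate_pos hΛ hηu
  unfold xStep curvatureConst
  positivity

theorem sq_sum_five_le (a b c d e : ℝ) :
    (a + b + c + d + e) ^ 2 ≤ 5 * (a ^ 2 + b ^ 2 + c ^ 2 + d ^ 2 + e ^ 2) := by
  linarith [sq_nonneg (a - b), sq_nonneg (a - c), sq_nonneg (a - d), sq_nonneg (a - e),
    sq_nonneg (b - c), sq_nonneg (b - d), sq_nonneg (b - e), sq_nonneg (c - d),
    sq_nonneg (c - e), sq_nonneg (d - e)]

namespace Regular

theorem gap_step_rate {K : SaddleBlock V X H} (hK : K.Regular σ Λ ℓ κ β) (hσ : 0 < σ)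
    (hΛ : 0 < Λ) {ηu : ℝ} (hηu : 0 ≤ ηu) (hβ : 0 ≤ β)
    (hsmall : ηu * (β * (2 * Λ / σ)) ^ 2 ≤ Λ / 4) {x : X} {p p' : V} {u u' : H}
    (hs : K.IsStep ηu Λ⁻¹ x p u p' u') (hp : p ∈ K.S) :
    K.gap x p' u' ≤ K.gap x p u - rate ηu Λ * K.stepSq x p p' u' := by
  have h1 := hK.gap_step hσ hΛ hηu hsmall hs hp hβ
  have h2 : rate ηu Λ * ‖K.res x u'‖ ^ 2 ≤ ηu * ‖K.res x u'‖ ^ 2 := by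
    gcongr; exact min_le_left _ _
  have h3 : rate ηu Λ * ‖p' - p‖ ^ 2 ≤ Λ / 4 * ‖p' - p‖ ^ 2 := by
    gcongr; exact min_le_right _ _
  unfold stepSq
  linarith

/-- The distance of the old iterate to the constrained solution. -/
theorem norm_sub_opt_le {K : SaddleBlock V X H} (hK : K.Regular σ Λ ℓ κ β) (hσ : 0 < σ)
    (hΛ : 0 < Λ) {ηu : ℝ} {x : X} {p p' : V} {u u' : H}
    (hs : K.IsStep ηu Λ⁻¹ x p u p' u') :
    ‖p - K.opt x‖ ≤ 2 * Λ / σ * ‖p' - p‖ + κ * ‖K.res x u'‖ :=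
  (norm_sub_le_norm_sub_add_norm_sub _ (K.sol x u') _).trans
    (add_le_add (hK.norm_sub_sol_le hσ hΛ hs).1 (hK.error_bound x u'))

/-- The algorithm evaluates the `x`-gradient at `p`, while the envelope formula asks for it at
`opt`. The error bound makes this discrepancy controllable by quantities that the gap decrease
dominates. -/
theorem gx_sub_le {K : SaddleBlock V X H} (hK : K.Regular σ Λ ℓ κ β) (hσ : 0 < σ)
    (hΛ : 0 < Λ) (hℓ : 0 ≤ ℓ) (hκ : 0 ≤ κ) {ηu : ℝ} {x : X} {p p' : V} {u u' : H}
    (hs : K.IsStep ηu Λ⁻¹ x p u p' u') :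
    ‖K.gx x (K.opt x) - K.gx x p‖ ≤
      couplingConst σ Λ ℓ κ * (‖K.res x u'‖ + ‖p' - p‖) := by
  rw [norm_sub_rev]
  refine (hK.gx_lip _ _ _).trans ?_
  have h1 := mul_le_mul_of_nonneg_left (hK.norm_sub_opt_le hσ hΛ hs) hℓ
  have h2 : 0 ≤ ℓ * (1 + 2 * Λ / σ) * ‖K.res x u'‖ := by positivity
  have h3 : 0 ≤ ℓ * (1 + κ) * ‖p' - p‖ := by positivity
  unfold couplingConst
  linarith

/-- Young's inequality in the form used for the descent of the potential. -/
theorem coupling_le {C c r d e : ℝ} (hc : 0 < c) :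
    2 * C * (r + d) * e ≤ c / 2 * (r ^ 2 + d ^ 2) + 4 * (C ^ 2 / c) * e ^ 2 := by
  have h1 : 0 ≤ (c * r - 2 * C * e) ^ 2 + (c * d - 2 * C * e) ^ 2 := by positivity
  have h2 : c / 2 * (r ^ 2 + d ^ 2) + 4 * (C ^ 2 / c) * e ^ 2 - 2 * C * (r + d) * e =
      ((c * r - 2 * C * e) ^ 2 + (c * d - 2 * C * e) ^ 2) / (2 * c) := by
    field_simp; ring
  have h3 : 0 ≤ ((c * r - 2 * C * e) ^ 2 + (c * d - 2 * C * e) ^ 2) / (2 * c) := by positivity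
  linarith

/-- The block moves at the old `x`, and the gap is then transported to `x'`, at the price of one
coupling term linear in `‖x' - x‖` and a quadratic one. -/
theorem gap_step_x {K : SaddleBlock V X H} (hK : K.Regular σ Λ ℓ κ β) (hσ : 0 < σ)
    (hΛ : 0 < Λ) (hℓ : 0 ≤ ℓ) (hκ : 0 ≤ κ) {ηu : ℝ} (hηu : 0 ≤ ηu) (hβ : 0 ≤ β)
    (hsmall : ηu * (β * (2 * Λ / σ)) ^ 2 ≤ Λ / 4) {x x' : X} {p p' : V} {u u' : H}
    (hs : K.IsStep ηu Λ⁻¹ x p u p' u') (hp : p ∈ K.S) :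
    K.gap x' p' u' ≤ K.gap x p u - rate ηu Λ * K.stepSq x p p' u'
      + couplingConst σ Λ ℓ κ * (‖K.res x u'‖ + ‖p' - p‖) * ‖x' - x‖
      + ℓ * (5 + 6 * ℓ / σ) * ‖x' - x‖ ^ 2 := by
  have h1 := hK.gap_step_rate hσ hΛ hηu hβ hsmall hs hp
  have h2 := hK.gap_x_change hσ hℓ x x' p' u'
  have h3 : ℓ * (‖p' - K.sol x u'‖ + κ * ‖K.res x u'‖) ≤
      couplingConst σ Λ ℓ κ * (‖K.res x u'‖ + ‖p' - p‖) := by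
    have h1 := mul_le_mul_of_nonneg_left (hK.norm_step_sub_sol_le hσ hΛ hs) hℓ
    have h2 : 0 ≤ ℓ * (1 + 2 * Λ / σ) * ‖K.res x u'‖ := by positivity
    have h3 : 0 ≤ ℓ * κ * ‖p' - p‖ := by positivity
    unfold couplingConst
    linarith
  have h4 := mul_le_mul_of_nonneg_right h3 (norm_nonneg (x' - x))
  linarith

/-- One iteration decreases the potential. -/
theorem merit_step {K₁ K₂ : SaddleBlock V X H} (hK₁ : K₁.Regular σ Λ ℓ κ β)
    (hK₂ : K₂.Regular σ Λ ℓ κ β) (hσ : 0 < σ) (hΛ : 0 < Λ) (hℓ : 0 ≤ ℓ) (hκ : 0 ≤ κ) {ηu : ℝ}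
    (hηu : 0 < ηu) (hβ : 0 ≤ β) (hsmall : ηu * (β * (2 * Λ / σ)) ^ 2 ≤ Λ / 4) {x x' : X}
    {p p' q q' : V} {u u' v v' : H} (hs₁ : K₁.IsStep ηu Λ⁻¹ x p u p' u') (hp : p ∈ K₁.S)
    (hs₂ : K₂.IsStep ηu Λ⁻¹ x q v q' v') (hq : q ∈ K₂.S)
    (hx : x' = x - xStep σ Λ ℓ κ ηu • (K₁.gx x p - K₂.gx x q)) :
    merit K₁ K₂ x' p' u' q' v' ≤ merit K₁ K₂ x p u q v
      - (rate ηu Λ / 2 * (K₁.stepSq x p p' u' + K₂.stepSq x q q' v') + ‖x' - x‖ ^ 2) := by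
  have g1 := hK₁.gap_step_x (x' := x') hσ hΛ hℓ hκ hηu.le hβ hsmall hs₁ hp
  have g2 := hK₂.gap_step_x (x' := x') hσ hΛ hℓ hκ hηu.le hβ hsmall hs₂ hq
  have m1 := (abs_le.1 (hK₁.val_sub_le hσ hℓ x x')).2
  have m2 := (abs_le.1 (hK₂.val_sub_le hσ hℓ x x')).1
  have hc := rate_pos hΛ hηu
  have hη := xStep_pos (κ := κ) hσ hΛ hℓ hηu
  have n1 : inner ℝ (K₁.gx x (K₁.opt x) - K₁.gx x p) (x' - x) ≤
      couplingConst σ Λ ℓ κ * (‖K₁.res x u'‖ + ‖p' - p‖) * ‖x' - x‖ :=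
    (real_inner_le_norm _ _).trans (by gcongr; exact hK₁.gx_sub_le hσ hΛ hℓ hκ hs₁)
  have n2 : -inner ℝ (K₂.gx x (K₂.opt x) - K₂.gx x q) (x' - x) ≤
      couplingConst σ Λ ℓ κ * (‖K₂.res x v'‖ + ‖q' - q‖) * ‖x' - x‖ :=
    (neg_le_abs _).trans ((abs_real_inner_le_norm _ _).trans
      (by gcongr; exact hK₂.gx_sub_le hσ hΛ hℓ hκ hs₂))
  -- Each block meets its coupling term twice, in the transport of the gap and in the gradient error
  -- of `val`; hence the factor two in `coupling_le`.
  have y1 := coupling_le (C := couplingConst σ Λ ℓ κ) (r := ‖K₁.res x u'‖) (d := ‖p' - p‖)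
    (e := ‖x' - x‖) hc
  have y2 := coupling_le (C := couplingConst σ Λ ℓ κ) (r := ‖K₂.res x v'‖) (d := ‖q' - q‖)
    (e := ‖x' - x‖) hc
  -- The inverse step size is the total curvature plus the two Young coefficients plus one; that one
  -- is the surplus `‖x' - x‖ ^ 2` in the decrease.
  have hG : inner ℝ (K₁.gx x p - K₂.gx x q) (x' - x) =
      -(curvatureConst σ ℓ + 8 * (couplingConst σ Λ ℓ κ ^ 2 / rate ηu Λ) + 1) * ‖x' - x‖ ^ 2 := by
    have h1 : x' - x = -(xStep σ Λ ℓ κ ηu • (K₁.gx x p - K₂.gx x q)) := by rw [hx]; abel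
    have h2 : K₁.gx x p - K₂.gx x q =
        -((xStep σ Λ ℓ κ ηu)⁻¹ • (x' - x)) := by
      rw [h1, smul_neg, neg_neg, smul_smul, inv_mul_cancel₀ hη.ne', one_smul]
    rw [h2, inner_neg_left, inner_smul_left, real_inner_self_eq_norm_sq, xStep, inv_inv]
    simp only [conj_trivial, neg_mul]
  rw [inner_sub_left] at n1 n2 hG
  have hcurv : curvatureConst σ ℓ * ‖x' - x‖ ^ 2 = 2 * (ℓ * (5 + 6 * ℓ / σ) * ‖x' - x‖ ^ 2)
      + 2 * (ℓ * (3 / 2 + 2 * ℓ / σ) * ‖x' - x‖ ^ 2) := by unfold curvatureConst; ring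
  unfold merit
  unfold stepSq at *
  linarith

/-- The gradient of the difference of the optimal values is bounded by the decrease of the
potential. -/
theorem norm_gradient_sq_le {K₁ K₂ : SaddleBlock V X H} (hK₁ : K₁.Regular σ Λ ℓ κ β)
    (hK₂ : K₂.Regular σ Λ ℓ κ β) (hσ : 0 < σ) (hΛ : 0 < Λ) (hℓ : 0 ≤ ℓ) (hκ : 0 ≤ κ) {ηu : ℝ}
    (hηu : 0 < ηu) {x x' : X} {p p' q q' : V} {u u' v v' : H}
    (hs₁ : K₁.IsStep ηu Λ⁻¹ x p u p' u') (hs₂ : K₂.IsStep ηu Λ⁻¹ x q v q' v')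
    (hx : x' = x - xStep σ Λ ℓ κ ηu • (K₁.gx x p - K₂.gx x q)) :
    ‖K₁.gx x (K₁.opt x) - K₂.gx x (K₂.opt x)‖ ^ 2 ≤
      (5 / xStep σ Λ ℓ κ ηu ^ 2 + 10 * couplingConst σ Λ ℓ κ ^ 2 / rate ηu Λ) *
        (rate ηu Λ / 2 * (K₁.stepSq x p p' u' + K₂.stepSq x q q' v') + ‖x' - x‖ ^ 2) := by
  have hc := rate_pos hΛ hηu
  have hη := xStep_pos (κ := κ) hσ hΛ hℓ hηu
  have n1 := hK₁.gx_sub_le hσ hΛ hℓ hκ hs₁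
  have n2 := hK₂.gx_sub_le hσ hΛ hℓ hκ hs₂
  have n3 : ‖K₁.gx x p - K₂.gx x q‖ = (xStep σ Λ ℓ κ ηu)⁻¹ * ‖x' - x‖ := by
    have h1 : x' - x = -(xStep σ Λ ℓ κ ηu • (K₁.gx x p - K₂.gx x q)) := by rw [hx]; abel
    rw [h1, norm_neg, norm_smul, Real.norm_of_nonneg hη.le, inv_mul_cancel_left₀ hη.ne']
  have n4 : ‖K₁.gx x (K₁.opt x) - K₂.gx x (K₂.opt x)‖ ≤
      ‖K₁.gx x p - K₂.gx x q‖ + ‖K₁.gx x (K₁.opt x) - K₁.gx x p‖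
        + ‖K₂.gx x (K₂.opt x) - K₂.gx x q‖ := by
    have e : K₁.gx x (K₁.opt x) - K₂.gx x (K₂.opt x) = (K₁.gx x p - K₂.gx x q)
      + (K₁.gx x (K₁.opt x) - K₁.gx x p) - (K₂.gx x (K₂.opt x) - K₂.gx x q) := by abel
    rw [e]
    exact (norm_sub_le _ _).trans (by gcongr; exact norm_add_le _ _)
  set C := couplingConst σ Λ ℓ κ
  set η := xStep σ Λ ℓ κ ηu
  set c := rate ηu Λ
  set r₁ := ‖K₁.res x u'‖
  set r₂ := ‖K₂.res x v'‖
  set d₁ := ‖p' - p‖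
  set d₂ := ‖q' - q‖
  set e := ‖x' - x‖
  have hS : 0 ≤ r₁ ^ 2 + d₁ ^ 2 + (r₂ ^ 2 + d₂ ^ 2) := by positivity
  have n5 : ‖K₁.gx x (K₁.opt x) - K₂.gx x (K₂.opt x)‖ ≤
      η⁻¹ * e + C * r₁ + C * d₁ + C * r₂ + C * d₂ := by linarith
  calc _ ≤ (η⁻¹ * e + C * r₁ + C * d₁ + C * r₂ + C * d₂) ^ 2 := by gcongr
    _ ≤ 5 * ((η⁻¹ * e) ^ 2 + (C * r₁) ^ 2 + (C * d₁) ^ 2 + (C * r₂) ^ 2 + (C * d₂) ^ 2) := by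
      exact sq_sum_five_le _ _ _ _ _
    _ = 5 / η ^ 2 * e ^ 2 + 10 * C ^ 2 / c * (c / 2 * (r₁ ^ 2 + d₁ ^ 2 + (r₂ ^ 2 + d₂ ^ 2))) := by
      field_simp; ring
    _ ≤ (5 / η ^ 2 + 10 * C ^ 2 / c) *
        (c / 2 * (r₁ ^ 2 + d₁ ^ 2 + (r₂ ^ 2 + d₂ ^ 2)) + e ^ 2) := by
      have h1 : 0 ≤ 5 / η ^ 2 * (c / 2 * (r₁ ^ 2 + d₁ ^ 2 + (r₂ ^ 2 + d₂ ^ 2))) := by positivity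
      have h2 : 0 ≤ 10 * C ^ 2 / c * e ^ 2 := by positivity
      linarith
    _ = _ := rfl

end Regular
end SaddleBlock

/-! ### Sign-conformal representatives with bounded norm. -/

section Conformal

variable {ι : Type*} [Fintype ι] {E : Type*} [NormedAddCommGroup E] [NormedSpace ℝ E]

/-- `w'` has no entry of sign opposite to that of `w`, and vanishes where `w` does. -/
def SignConformal (w' w : EuclideanSpace ℝ ι) : Prop :=
  ∀ i, (0 ≤ w i → 0 ≤ w' i) ∧ (w i ≤ 0 → w' i ≤ 0)

theorem SignConformal.eq_zero {ι : Type*} {w' w : EuclideanSpace ℝ ι} (h : SignConformal w' w) {i : ι}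
    (hi : w i = 0) : w' i = 0 :=
  le_antisymm ((h i).2 hi.le) ((h i).1 hi.ge)

/-- Carathéodory's reduction: if a nonzero kernel vector lives on the support of `w`, moving along
it until a coordinate first vanishes keeps the image and the signs and shrinks the support. It stops
when `T` is injective on vectors with that support. -/
theorem exists_conformal_injective (T : EuclideanSpace ℝ ι →ₗ[ℝ] E) (w : EuclideanSpace ℝ ι) :
    ∃ w', T w' = T w ∧ SignConformal w' w ∧
      ∀ c : EuclideanSpace ℝ ι, (∀ i, w' i = 0 → c i = 0) → T c = 0 → c = 0 := by
  classical
  induction hn : (Finset.univ.filter fun i => w i ≠ 0).card using Nat.strong_induction_on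
    generalizing w with
  | _ n ih =>
    by_cases hinj : ∀ c : EuclideanSpace ℝ ι, (∀ i, w i = 0 → c i = 0) → T c = 0 → c = 0
    · exact ⟨w, rfl, fun i => ⟨id, id⟩, hinj⟩
    push Not at hinj
    obtain ⟨c, hcs, hTc, hc⟩ : ∃ c : EuclideanSpace ℝ ι,
        (∀ i, w i = 0 → c i = 0) ∧ T c = 0 ∧ ∃ i, 0 < c i * w i := by
      obtain ⟨c, hcs, hTc, hc⟩ := hinj
      obtain ⟨i, hi⟩ : ∃ i, c i ≠ 0 := by
        by_contra! h
        exact hc (by ext i; simpa using h i)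
      have hwi : w i ≠ 0 := fun h => hi (hcs i h)
      rcases lt_or_gt_of_ne (mul_ne_zero hi hwi) with h | h
      · exact ⟨-c, fun i hi => by simp [hcs i hi], by simp [hTc], i, by simpa using h⟩
      · exact ⟨c, hcs, hTc, i, h⟩
    let J := Finset.univ.filter fun i => 0 < c i * w i
    have hJ : J.Nonempty := by
      obtain ⟨i, hi⟩ := hc
      exact ⟨i, by simpa [J] using hi⟩
    -- Along `w - t • c` with `t` growing, only coordinates in `J` move towards zero; the smallest
    -- ratio belongs to the first to arrive.
    obtain ⟨j, hj, hjmin⟩ := J.exists_min_image (fun i => w i / c i) hJ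
    have hjc : 0 < c j * w j := by simpa [J] using hj
    have hcj : c j ≠ 0 := fun h => by simp [h] at hjc
    set t := w j / c j with ht
    have htpos : 0 < t := by
      have : t = c j * w j / (c j ^ 2) := by rw [ht]; field_simp
      rw [this]; positivity
    have hconf : SignConformal (w - t • c) w := by
      intro i
      simp only [PiLp.sub_apply, PiLp.smul_apply, smul_eq_mul]
      by_cases hi : 0 < c i * w i
      · have h1 := hjmin i (by simpa [J] using hi)
        have hci : c i ≠ 0 := fun h => by simp [h] at hi
        have h2 : w i = w i / c i * c i := by field_simp
        constructor
        · intro h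
          have hci' : 0 < c i := by
            by_contra! hcon
            nlinarith
          have h3 := mul_le_mul_of_nonneg_right h1 hci'.le
          linarith
        · intro h
          have hci' : c i < 0 := by
            by_contra! hcon
            nlinarith
          have h3 := mul_le_mul_of_nonpos_right h1 hci'.le
          linarith
      · push Not at hi
        rcases eq_or_ne (w i) 0 with h0 | h0
        · simp [h0, hcs i h0]
        constructor
        · intro h
          have : c i ≤ 0 := by
            by_contra! hcon
            have := lt_of_le_of_ne h h0.symm
            nlinarith [mul_pos hcon this]
          nlinarith
        · intro h
          have : 0 ≤ c i := by
            by_contra! hcon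
            have := lt_of_le_of_ne h h0
            nlinarith [mul_pos_of_neg_of_neg hcon this]
          nlinarith
    have hlt : (Finset.univ.filter fun i => (w - t • c) i ≠ 0).card < n := by
      rw [← hn]
      apply Finset.card_lt_card
      refine Finset.ssubset_iff_subset_ne.2 ⟨?_, ?_⟩
      · intro i hi
        simp only [Finset.mem_filter, Finset.mem_univ, true_and] at *
        exact fun h => hi (hconf.eq_zero h)
      · intro h
        have hwj : w j ≠ 0 := fun h => by simp [h] at hjc
        have h1 : j ∈ Finset.univ.filter fun i => w i ≠ 0 := by simpa using hwj
        rw [← h] at h1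
        simp [ht, hcj] at h1
    obtain ⟨w', h1, h2, h3⟩ := ih _ hlt (w - t • c) rfl
    refine ⟨w', by rw [h1]; simp [hTc], fun i => ⟨fun h => ?_, fun h => ?_⟩, h3⟩
    · exact (h2 i).1 ((hconf i).1 h)
    · exact (h2 i).2 ((hconf i).2 h)

/-- An injective linear map on a finite-dimensional space is bounded below. Injectivity is assumed
inside the existential so that a constant can be chosen for every `I` at once. -/
theorem exists_norm_le_of_supported (T : EuclideanSpace ℝ ι →ₗ[ℝ] E) (I : Finset ι) :
    ∃ C : ℝ, 0 ≤ C ∧ ((∀ c : EuclideanSpace ℝ ι, (∀ i ∉ I, c i = 0) → T c = 0 → c = 0) →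
      ∀ c : EuclideanSpace ℝ ι, (∀ i ∉ I, c i = 0) → ‖c‖ ≤ C * ‖T c‖) := by
  by_cases hinj : ∀ c : EuclideanSpace ℝ ι, (∀ i ∉ I, c i = 0) → T c = 0 → c = 0
  · let W : Submodule ℝ (EuclideanSpace ℝ ι) :=
      { carrier := {c | ∀ i ∉ I, c i = 0}
        add_mem' := fun {a b} ha hb i hi => by simp [ha i hi, hb i hi]
        zero_mem' := fun i _ => by simp
        smul_mem' := fun a b hb i hi => by simp [hb i hi] }
    obtain ⟨k, -, hk⟩ := (T.domRestrict W).exists_antilipschitzWith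
      (LinearMap.ker_eq_bot'.2 fun c hc => Subtype.ext (hinj c.1 c.2 hc))
    refine ⟨k, k.2, fun _ c hc => ?_⟩
    have := hk.le_mul_dist ⟨c, hc⟩ 0
    simpa using this
  · exact ⟨0, le_rfl, fun h => absurd h hinj⟩

/-- Every vector has a conformal representative, with the same image, whose norm is controlled
by the norm of the image. -/
theorem exists_conformal_norm_le (T : EuclideanSpace ℝ ι →ₗ[ℝ] E) :
    ∃ C : ℝ, 0 ≤ C ∧ ∀ w, ∃ w', T w' = T w ∧ SignConformal w' w ∧ ‖w'‖ ≤ C * ‖T w‖ := by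
  classical
  choose C hC0 hC using exists_norm_le_of_supported T
  -- There are finitely many supports, so the sum of their constants dominates each.
  refine ⟨∑ I, C I, Finset.sum_nonneg fun I _ => hC0 I, fun w => ?_⟩
  obtain ⟨w', h1, h2, h3⟩ := exists_conformal_injective T w
  refine ⟨w', h1, h2, ?_⟩
  let I := Finset.univ.filter fun i => w' i ≠ 0
  have h4 := hC I (fun c hc => h3 c fun i hi => hc i (by simpa [I] using hi)) w'
    (fun i hi => by simpa [I] using hi)
  rw [h1] at h4
  refine h4.trans ?_
  gcongr
  exact Finset.single_le_sum (fun I _ => hC0 I) (Finset.mem_univ I)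

end Conformal

/-! ### Farkas' lemma by projection onto a finitely generated cone. -/

section Cone

variable {ι : Type*} [Fintype ι] {E : Type*} [NormedAddCommGroup E] [InnerProductSpace ℝ E]

/-- Farkas' lemma: if no direction `d` with `⟪T e_i, d⟫ ≤ 0` for `i ∈ I` decreases `⟪c, ·⟫`, then
`-c` is in the cone generated by the `T e_i`, `i ∈ I`. -/
theorem exists_nonneg_of_forall_inner_nonneg [DecidableEq ι] (T : EuclideanSpace ℝ ι →ₗ[ℝ] E)
    (c : E) (I : Set ι)
    (h : ∀ d : E, (∀ i ∈ I, inner ℝ (T (EuclideanSpace.single i 1)) d ≤ 0) → 0 ≤ inner ℝ c d) :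
    ∃ w : EuclideanSpace ℝ ι, (∀ i, 0 ≤ w i) ∧ (∀ i ∉ I, w i = 0) ∧ c + T w = 0 := by
  obtain ⟨C, hC0, hC⟩ := exists_conformal_norm_le T
  let Q : Set (EuclideanSpace ℝ ι) := {w | (∀ i, 0 ≤ w i) ∧ ∀ i ∉ I, w i = 0}
  have hQ : IsClosed Q := by
    have : Q = (⋂ i, {w | 0 ≤ w i}) ∩ ⋂ i ∈ Iᶜ, {w | w i = 0} := by
      ext w; simp [Q]
    rw [this]
    refine (isClosed_iInter fun i => ?_).inter (isClosed_biInter fun i _ => ?_)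
    · exact isClosed_le continuous_const (by fun_prop)
    · exact isClosed_eq (by fun_prop) continuous_const
  have hT : Continuous T := T.continuous_of_finiteDimensional
  have hcomp : IsCompact (Q ∩ Metric.closedBall 0 (C * (2 * ‖c‖))) :=
    (isCompact_closedBall _ _).inter_left hQ
  have hQ0 : (0 : EuclideanSpace ℝ ι) ∈ Q := ⟨fun i => by simp, fun i _ => by simp⟩
  have hB0 : (0 : EuclideanSpace ℝ ι) ∈ Metric.closedBall 0 (C * (2 * ‖c‖)) := by
    simp only [Metric.mem_closedBall, dist_self]; positivity
  obtain ⟨w₀, hw₀, hmin⟩ := hcomp.exists_isMinOn (f := fun w => ‖c + T w‖) ⟨0, hQ0, hB0⟩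
    (by fun_prop)
  -- Minimality extends from the ball to the whole cone: a competitor no worse than zero has a
  -- conformal representative in `Q` with the same image and inside the ball.
  have hmin' : ∀ w ∈ Q, ‖c + T w₀‖ ≤ ‖c + T w‖ := by
    intro w hw
    rcases le_or_gt ‖c + T w‖ ‖c‖ with hle | hgt
    · obtain ⟨w', h1, h2, h3⟩ := hC w
      have h4 : ‖T w‖ ≤ 2 * ‖c‖ := by
        have : T w = (c + T w) - c := by abel
        rw [this]; exact (norm_sub_le _ _).trans (by linarith)
      have h5 : w' ∈ Q ∩ Metric.closedBall 0 (C * (2 * ‖c‖)) := by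
        refine ⟨⟨fun i => (h2 i).1 (hw.1 i), fun i hi => h2.eq_zero (hw.2 i hi)⟩, ?_⟩
        rw [mem_closedBall_zero_iff]
        exact h3.trans (by gcongr)
      have := hmin h5
      simpa [h1] using this
    · have := hmin ⟨hQ0, hB0⟩
      simp only [map_zero, add_zero, mem_ofPred_eq] at this
      exact this.trans hgt.le
  refine ⟨w₀, hw₀.1.1, hw₀.1.2, ?_⟩
  set ρ := c + T w₀ with hρ
  have hquad : ∀ v : E, (∀ t : ℝ, 0 < t → t < 1 → ‖ρ‖ ≤ ‖ρ + t • v‖) → 0 ≤ inner ℝ ρ v := by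
    intro v hv
    by_contra! hneg
    obtain ⟨t, ht0, ht1, ht⟩ : ∃ t : ℝ, 0 < t ∧ t < 1 ∧ t * ‖v‖ ^ 2 < -(2 * inner ℝ ρ v) := by
      refine ⟨min (1 / 2) (-(inner ℝ ρ v) / (‖v‖ ^ 2 + 1)), lt_min (by norm_num)
        (div_pos (by linarith) (by positivity)), (min_le_left _ _).trans_lt (by norm_num), ?_⟩
      calc _ ≤ -(inner ℝ ρ v) / (‖v‖ ^ 2 + 1) * (‖v‖ ^ 2 + 1) := by
            gcongr
            · exact div_nonneg (by linarith) (by positivity)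
            · exact min_le_right _ _
            · linarith
        _ = -(inner ℝ ρ v) := by field_simp
        _ < _ := by linarith
    have h1 := hv t ht0 ht1
    have h2 : ‖ρ‖ ^ 2 ≤ ‖ρ + t • v‖ ^ 2 := by gcongr
    rw [norm_add_sq_real ρ, inner_smul_right, norm_smul, Real.norm_of_nonneg ht0.le] at h2
    nlinarith
  have h1 : ∀ i ∈ I, inner ℝ (T (EuclideanSpace.single i 1)) (-ρ) ≤ 0 := by
    intro i hi
    rw [inner_neg_right, real_inner_comm, neg_nonpos]
    refine hquad _ fun t ht0 _ => ?_
    have : ρ + t • T (EuclideanSpace.single i 1) = c + T (w₀ + t • EuclideanSpace.single i 1) := by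
      rw [map_add, map_smul, hρ]; abel
    rw [this]
    refine hmin' _ ⟨fun k => ?_, fun k hk => ?_⟩
    · have := hw₀.1.1 k
      simp only [PiLp.add_apply, PiLp.smul_apply, PiLp.single_apply, smul_eq_mul]
      split_ifs <;> nlinarith
    · have hki : k ≠ i := fun h => hk (h ▸ hi)
      simp [hw₀.1.2 k hk, hki]
  have h2 : 0 ≤ inner ℝ ρ (-T w₀) := by
    refine hquad _ fun t ht0 ht1 => ?_
    have : ρ + t • -T w₀ = c + T ((1 - t) • w₀) := by
      rw [map_smul, hρ]; module
    rw [this]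
    refine hmin' _ ⟨fun k => ?_, fun k hk => ?_⟩
    · have := hw₀.1.1 k
      simp only [PiLp.smul_apply, smul_eq_mul]
      nlinarith
    · simp [hw₀.1.2 k hk]
  -- By `h1` the direction `-ρ` is admissible, so `⟪c, ρ⟫ ≤ 0`; with `h2`, from shrinking `w₀`, this
  -- forces `‖ρ‖² ≤ 0`.
  have h3 := h (-ρ) h1
  have h4 : inner ℝ ρ ρ = inner ℝ c ρ + inner ℝ ρ (T w₀) := by
    rw [real_inner_comm (T w₀) ρ, ← inner_add_left]
  rw [inner_neg_right] at h2 h3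
  have h5 : inner ℝ ρ ρ ≤ 0 := by linarith
  exact real_inner_self_nonpos.1 h5

end Cone

/-! ### Karush-Kuhn-Tucker systems and their stability. -/

theorem argminOn_spec {α : Type*} [Nonempty α] {S : Set α} {φ : α → ℝ}
    (h : ∃ p ∈ S, ∀ q ∈ S, φ p ≤ φ q) :
    argminOn S φ ∈ S ∧ ∀ q ∈ S, φ (argminOn S φ) ≤ φ q := by
  obtain ⟨p, hp, hmin⟩ := h
  have := Classical.epsilon_spec (p := fun p => p ∈ S ∧ IsMinOn φ S p)
    ⟨p, hp, fun q hq => hmin q hq⟩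
  exact ⟨this.1, fun q hq => this.2 hq⟩

/-- A differentiable `m`-strongly convex function with `ℓ`-Lipschitz gradient. -/
structure RegularFun {Y : Type*} [NormedAddCommGroup Y] [InnerProductSpace ℝ Y] [CompleteSpace Y]
    (f : Y → ℝ) (m ℓ : ℝ) : Prop where
  diff : Differentiable ℝ f
  strong : ∀ y y', f y + inner ℝ (gradient f y) (y' - y) + m / 2 * ‖y' - y‖ ^ 2 ≤ f y'
  lip : ∀ y y', ‖gradient f y - gradient f y'‖ ≤ ℓ * ‖y - y'‖

/-- The Karush-Kuhn-Tucker conditions for minimizing `f` subject to `A y - b ≤ 0`. -/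
structure KKT {Y : Type*} [NormedAddCommGroup Y] [InnerProductSpace ℝ Y] [CompleteSpace Y] {n : ℕ}
    (f : Y → ℝ) (A : Y →L[ℝ] EuclideanSpace ℝ (Fin n)) (b : EuclideanSpace ℝ (Fin n)) (y : Y)
    (u : EuclideanSpace ℝ (Fin n)) : Prop where
  feasible : ∀ i, (A y - b) i ≤ 0
  nonneg : ∀ i, 0 ≤ u i
  stationary : gradient f y + A.adjoint u = 0
  slack : ∀ i, u i * (A y - b) i = 0

section Linear

variable {Y : Type*} [NormedAddCommGroup Y] [InnerProductSpace ℝ Y] [CompleteSpace Y] {n : ℕ}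
  {f : Y → ℝ} {A : Y →L[ℝ] EuclideanSpace ℝ (Fin n)} {b b' : EuclideanSpace ℝ (Fin n)}
  {m ℓ : ℝ}

theorem inner_eq_sum (u v : EuclideanSpace ℝ (Fin n)) : inner ℝ u v = ∑ i, u i * v i := by
  simp [PiLp.inner_apply, mul_comm]

namespace RegularFun

variable (hf : RegularFun f m ℓ)
include hf

theorem smooth (y y' : Y) :
    f y' ≤ f y + inner ℝ (gradient f y) (y' - y) + ℓ / 2 * ‖y' - y‖ ^ 2 := by
  have := (abs_le.1 (abs_sub_sub_inner_gradient_le hf.diff hf.lip y y')).2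
  linarith

theorem strong_monotone (y y' : Y) :
    m * ‖y' - y‖ ^ 2 ≤ inner ℝ (gradient f y' - gradient f y) (y' - y) := by
  have h1 := hf.strong y y'
  have h2 := hf.strong y' y
  rw [norm_sub_rev y y', ← neg_sub y' y, inner_neg_right] at h2
  rw [inner_sub_left]
  linarith

theorem exists_isMinOn [FiniteDimensional ℝ Y] (hm : 0 < m) {S : Set Y} (hS : IsClosed S)
    (hne : S.Nonempty) : ∃ y ∈ S, ∀ y' ∈ S, f y ≤ f y' := by
  refine exists_isMinOn_of_quadratic_growth (p := 0) (a := f 0) (c := ‖gradient f 0‖) hS hne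
    hf.diff.continuous (half_pos hm) fun q => ?_
  have h1 := hf.strong 0 q
  have h2 := neg_le_of_abs_le (abs_real_inner_le_norm (gradient f 0) (q - 0))
  linarith

end RegularFun

theorem convex_feasible {Y : Type*} [NormedAddCommGroup Y] [InnerProductSpace ℝ Y]
    (A : Y →L[ℝ] EuclideanSpace ℝ (Fin n)) (b : EuclideanSpace ℝ (Fin n)) :
    Convex ℝ {y | ∀ i, (A y - b) i ≤ 0} := by
  intro y hy z hz s t hs ht hst i
  have h1 := hy i
  have h2 := hz i
  simp only [PiLp.sub_apply, map_add, map_smul, PiLp.add_apply, PiLp.smul_apply,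
    smul_eq_mul] at *
  have : b i = s * b i + t * b i := by rw [← add_mul, hst, one_mul]
  nlinarith

theorem isClosed_feasible {Y : Type*} [NormedAddCommGroup Y] [InnerProductSpace ℝ Y]
    (A : Y →L[ℝ] EuclideanSpace ℝ (Fin n))
    (b : EuclideanSpace ℝ (Fin n)) : IsClosed {y | ∀ i, (A y - b) i ≤ 0} := by
  rw [ofPred_forall]
  exact isClosed_iInter fun i => isClosed_le (by fun_prop) continuous_const

/-- A minimizer satisfies the Karush-Kuhn-Tucker conditions. -/
theorem RegularFun.exists_kkt (hf : RegularFun f m ℓ) {y : Y}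
    (hy : ∀ i, (A y - b) i ≤ 0) (hmin : ∀ y', (∀ i, (A y' - b) i ≤ 0) → f y ≤ f y') :
    ∃ u, KKT f A b y u := by
  classical
  obtain ⟨u, h1, h2, h3⟩ := exists_nonneg_of_forall_inner_nonneg
    (A.adjoint : EuclideanSpace ℝ (Fin n) →ₗ[ℝ] Y) (gradient f y) {i | (A y - b) i = 0} (by
      intro d hd
      have hd' : ∀ i, (A y - b) i = 0 → (A d) i ≤ 0 := by
        intro i hi
        have := hd i hi
        simpa [ContinuousLinearMap.adjoint_inner_left, EuclideanSpace.inner_single_left] using this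
      -- Active constraints do not increase along `d` and inactive ones have room, so a short move
      -- is feasible.
      have hev : ∀ᶠ t : ℝ in nhdsWithin 0 (Ioi 0), ∀ i, (A (y + t • d) - b) i ≤ 0 := by
        refine Filter.eventually_all.2 fun i => ?_
        rcases (hy i).eq_or_lt with hi | hi
        · filter_upwards [self_mem_nhdsWithin] with t ht
          have h1 := hd' i hi
          have h2 : (A (y + t • d) - b) i = (A y - b) i + t * (A d) i := by
            simp; ring
          rw [h2, hi, zero_add]
          exact mul_nonpos_of_nonneg_of_nonpos (le_of_lt ht) h1
        · have hc : ContinuousAt (fun t : ℝ => (A (y + t • d) - b) i) 0 :=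
            Continuous.continuousAt (by fun_prop)
          have h3 := hc.eventually_lt continuousAt_const (show (A (y + (0 : ℝ) • d) - b) i < 0 by
            simpa using hi)
          exact (h3.filter_mono nhdsWithin_le_nhds).mono fun t ht => ht.le
      obtain ⟨t, ht, ht0⟩ := (hev.and self_mem_nhdsWithin).exists
      have ht0' : 0 < t := ht0
      have h4 := first_order_condition (G := f) (convex_feasible A b) (p := y) hy
        (innerSL ℝ (gradient f y) : Y →L[ℝ] ℝ).toLinearMap
        (fun q => by simpa using hf.smooth y q) (fun q hq => hmin q hq) (q := y + t • d) ht
      simp only [ContinuousLinearMap.coe_coe, innerSL_apply_apply, add_sub_cancel_left,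
        inner_smul_right] at h4
      exact nonneg_of_mul_nonneg_right h4 ht0')
  refine ⟨u, hy, h1, h3, fun i => ?_⟩
  by_cases hi : (A y - b) i = 0
  · rw [hi, mul_zero]
  · rw [h2 i hi, zero_mul]

namespace KKT

/-- Weak duality, with the quadratic growth of `f`. -/
theorem lagrangian_ge {y : Y} {u : EuclideanSpace ℝ (Fin n)} (h : KKT f A b y u)
    (hf : RegularFun f m ℓ) (y' : Y) :
    f y + m / 2 * ‖y' - y‖ ^ 2 ≤ f y' + inner ℝ u (A y' - b) := by
  have h1 := hf.strong y y'
  have h2 : inner ℝ u (A y - b) = 0 := by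
    rw [inner_eq_sum]; exact Finset.sum_eq_zero fun i _ => h.slack i
  have h3 : inner ℝ (gradient f y) (y' - y) = -inner ℝ u (A y' - b) := by
    rw [eq_neg_of_add_eq_zero_left h.stationary, inner_neg_left,
      ContinuousLinearMap.adjoint_inner_left, map_sub]
    rw [show A y' - A y = (A y' - b) - (A y - b) by abel, inner_sub_right, h2, sub_zero]
  linarith

/-- The solution of a linearly constrained strongly convex problem depends on the right-hand side
of the constraint in a Lipschitz way. -/
theorem norm_sub_le (hf : RegularFun f m ℓ) (hm : 0 < m) (hℓ : 0 ≤ ℓ) {C : ℝ} (hC0 : 0 ≤ C)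
    (hC : ∀ w, ∃ w', A.adjoint w' = A.adjoint w ∧ SignConformal w' w ∧
      ‖w'‖ ≤ C * ‖A.adjoint w‖)
    {y y' : Y} {u u' : EuclideanSpace ℝ (Fin n)} (h : KKT f A b y u) (h' : KKT f A b' y' u') :
    ‖y' - y‖ ≤ C * ℓ / m * ‖b' - b‖ := by
  -- Multipliers may be large and non-unique, but only the image of their difference enters. A
  -- conformal representative has the same image and is bounded by the difference of gradients.
  obtain ⟨w, hw1, hw2, hw3⟩ := hC (u - u')
  have hq : A.adjoint (u - u') = gradient f y' - gradient f y := by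
    rw [map_sub, eq_neg_of_add_eq_zero_left h.stationary,
      eq_neg_of_add_eq_zero_left h'.stationary]
    abel
  have h1 : inner ℝ w (A (y' - y)) ≤ inner ℝ w (b' - b) := by
    rw [inner_eq_sum, inner_eq_sum]
    refine Finset.sum_le_sum fun i _ => ?_
    have e : (A (y' - y)) i = (A y' - b') i - (A y - b) i + (b' - b) i := by simp; ring
    rw [e, mul_add]
    -- Complementarity in signs: if both multipliers vanish, so does `w i`; if exactly one
    -- constraint is known to be tight, `w i` has the sign opposite to the bracket; if both are, the
    -- bracket is zero.
    have key : w i * ((A y' - b') i - (A y - b) i) ≤ 0 := by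
      have hs := h.slack i
      have hs' := h'.slack i
      have hfe := h.feasible i
      have hfe' := h'.feasible i
      have hw2i : (0 ≤ u i - u' i → 0 ≤ w i) ∧ (u i - u' i ≤ 0 → w i ≤ 0) := hw2 i
      rcases mul_eq_zero.1 hs with h0 | h0 <;> rcases mul_eq_zero.1 hs' with h0' | h0'
      · have : w i = 0 := hw2.eq_zero (by simp [h0, h0'])
        simp [this]
      · have : w i ≤ 0 := hw2i.2 (by rw [h0]; linarith [h'.nonneg i])
        rw [h0']; nlinarith
      · have : 0 ≤ w i := hw2i.1 (by rw [h0']; linarith [h.nonneg i])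
        rw [h0]; nlinarith
      · simp [h0, h0']
    linarith
  have h2 := hf.strong_monotone y y'
  rw [← hq, ← hw1, ContinuousLinearMap.adjoint_inner_left] at h2
  have h3 : inner ℝ w (b' - b) ≤ C * (ℓ * ‖y' - y‖) * ‖b' - b‖ := by
    refine (real_inner_le_norm _ _).trans ?_
    gcongr
    refine hw3.trans ?_
    rw [hq]
    gcongr
    exact hf.lip y' y
  rcases (norm_nonneg (y' - y)).eq_or_lt with h0 | h0
  · rw [← h0]; positivity
  · have h5 : m * ‖y' - y‖ ≤ C * ℓ * ‖b' - b‖ := by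
      refine le_of_mul_le_mul_right ?_ h0
      nlinarith
    rw [div_mul_eq_mul_div, le_div_iff₀ hm]
    linarith

/-- Multipliers supported on constraints with linearly independent gradients are stable. -/
theorem norm_multiplier_sub_le (hf : RegularFun f m ℓ) {C : ℝ} (hC0 : 0 ≤ C)
    (hC : ∀ w, ∃ w', A.adjoint w' = A.adjoint w ∧ SignConformal w' w ∧
      ‖w'‖ ≤ C * ‖A.adjoint w‖) {I : Set (Fin n)}
    (hI : ∀ w : EuclideanSpace ℝ (Fin n), (∀ i ∉ I, w i = 0) → A.adjoint w = 0 → w = 0)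
    {y y' : Y} {u u' : EuclideanSpace ℝ (Fin n)} (h : KKT f A b y u) (h' : KKT f A b' y' u')
    (hu : ∀ i ∉ I, u i = 0) (hu' : ∀ i ∉ I, u' i = 0) :
    ‖u' - u‖ ≤ C * (ℓ * ‖y' - y‖) := by
  obtain ⟨w, hw1, hw2, hw3⟩ := hC (u' - u)
  -- Injectivity on `I` leaves no freedom: the conformal representative is the difference itself, so
  -- the constant of `A` alone applies.
  have hw : w = u' - u := by
    refine sub_eq_zero.1 (hI _ (fun i hi => ?_) (by rw [map_sub, hw1, sub_self]))
    rw [PiLp.sub_apply, hw2.eq_zero (by simp [hu i hi, hu' i hi])]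
    simp [hu i hi, hu' i hi]
  have hq : A.adjoint (u' - u) = gradient f y - gradient f y' := by
    rw [map_sub, eq_neg_of_add_eq_zero_left h.stationary,
      eq_neg_of_add_eq_zero_left h'.stationary]
    abel
  rw [hw, hq] at hw3
  refine hw3.trans ?_
  gcongr
  rw [norm_sub_rev y' y]
  exact hf.lip y y'

end KKT
end Linear

set_option linter.unusedSectionVars false

/-! ### The augmented Lagrangian with slack variables as a regular block. -/

/-- An objective `φ(x, y)` that is smooth in both variables and strongly convex in `y`. -/
structure RegularObjective {X Y : Type*} [NormedAddCommGroup X] [InnerProductSpace ℝ X]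
    [CompleteSpace X] [NormedAddCommGroup Y] [InnerProductSpace ℝ Y] [CompleteSpace Y]
    (φ : X → Y → ℝ) (m ℓ : ℝ) : Prop where
  regular_y : ∀ x, RegularFun (φ x) m ℓ
  diff_x : ∀ y, Differentiable ℝ fun x => φ x y
  lip_x : ∀ x x' y, ‖gradient (fun x => φ x y) x - gradient (fun x => φ x y) x'‖ ≤ ℓ * ‖x - x'‖
  lip_xy : ∀ x y y', ‖gradient (fun x => φ x y) x - gradient (fun x => φ x y') x‖ ≤ ℓ * ‖y - y'‖

section Penalty

variable {X Y : Type*} [NormedAddCommGroup X] [InnerProductSpace ℝ X]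
    [CompleteSpace X] [NormedAddCommGroup Y] [InnerProductSpace ℝ Y] [FiniteDimensional ℝ Y]
    {n : ℕ}

/-- The linear map `(y, α) ↦ A y - α`. -/
def slackMap (A : Y →L[ℝ] EuclideanSpace ℝ (Fin n)) :
    WithLp 2 (Y × EuclideanSpace ℝ (Fin n)) →L[ℝ] EuclideanSpace ℝ (Fin n) :=
  A.comp (WithLp.fstL 2 ℝ Y (EuclideanSpace ℝ (Fin n)))
    - WithLp.sndL 2 ℝ Y (EuclideanSpace ℝ (Fin n))

@[simp] theorem slackMap_apply (A : Y →L[ℝ] EuclideanSpace ℝ (Fin n))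
    (p : WithLp 2 (Y × EuclideanSpace ℝ (Fin n))) : slackMap A p = A p.fst - p.snd := rfl

/-- The augmented Lagrangian problem for `min φ(x, ·)` subject to `A y - b ≤ 0`. -/
def penaltyBlock (φ : X → Y → ℝ) (A : Y →L[ℝ] EuclideanSpace ℝ (Fin n))
    (b : EuclideanSpace ℝ (Fin n)) (ρ : ℝ) :
    SaddleBlock (WithLp 2 (Y × EuclideanSpace ℝ (Fin n))) X (EuclideanSpace ℝ (Fin n)) where
  F x p := φ x p.fst + ρ / 2 * ‖slackMap A p - b‖ ^ 2
  gp x p := WithLp.toLp 2 (gradient (φ x) p.fst, 0) + ρ • (slackMap A).adjoint (slackMap A p - b)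
  gx x p := gradient (fun x => φ x p.fst) x
  B := slackMap A
  b := b
  S := {p | ∀ i, p.snd i ≤ 0}
  sol x u := argminOn {p | ∀ i, p.snd i ≤ 0} fun p =>
    φ x p.fst + ρ / 2 * ‖slackMap A p - b‖ ^ 2 + inner ℝ u (slackMap A p - b)
  opt x := WithLp.toLp 2 (argminOn {y | ∀ i, (A y - b) i ≤ 0} (φ x),
    A (argminOn {y | ∀ i, (A y - b) i ≤ 0} (φ x)) - b)

/-- The strong convexity constant of the augmented Lagrangian. -/
def convConst (m ρ : ℝ) : ℝ := min (m / 2) (ρ / 4)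

/-- The bound for the constraint map. -/
def slackBound (a : ℝ) : ℝ := a + 1

/-- The smoothness constant of the augmented Lagrangian. -/
def smoothConst (ℓ ρ a : ℝ) : ℝ := ℓ + ρ * slackBound a ^ 2

theorem norm_slackMap_le (A : Y →L[ℝ] EuclideanSpace ℝ (Fin n))
    (p : WithLp 2 (Y × EuclideanSpace ℝ (Fin n))) : ‖slackMap A p‖ ≤ slackBound ‖A‖ * ‖p‖ := by
  have h1 := WithLp.norm_fst_le _ p
  have h2 := WithLp.norm_snd_le _ p
  rw [slackMap_apply, slackBound, add_mul, one_mul]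
  refine (norm_sub_le _ _).trans (add_le_add ((A.le_opNorm _).trans ?_) h2)
  gcongr

theorem norm_le_fst_add_snd (p : WithLp 2 (Y × EuclideanSpace ℝ (Fin n))) :
    ‖p‖ ≤ ‖p.fst‖ + ‖p.snd‖ := by
  refine le_of_sq_le_sq ?_ (by positivity)
  rw [WithLp.prod_norm_sq_eq_of_L2]
  nlinarith [norm_nonneg p.fst, norm_nonneg p.snd]

section Basic

variable {φ : X → Y → ℝ} {A : Y →L[ℝ] EuclideanSpace ℝ (Fin n)} {b : EuclideanSpace ℝ (Fin n)}
  {ρ m ℓ : ℝ}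

theorem penaltyBlock_inner_gp (x : X) (p v : WithLp 2 (Y × EuclideanSpace ℝ (Fin n))) :
    inner ℝ ((penaltyBlock φ A b ρ).gp x p) v =
      inner ℝ (gradient (φ x) p.fst) v.fst + ρ * inner ℝ (slackMap A p - b) (slackMap A v) := by
  simp only [penaltyBlock]
  rw [inner_add_left, inner_smul_left, ContinuousLinearMap.adjoint_inner_left,
    WithLp.prod_inner_apply]
  simp

theorem norm_sq_slackMap (p q : WithLp 2 (Y × EuclideanSpace ℝ (Fin n))) :
    ‖slackMap A q - b‖ ^ 2 = ‖slackMap A p - b‖ ^ 2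
      + 2 * inner ℝ (slackMap A p - b) (slackMap A (q - p)) + ‖slackMap A (q - p)‖ ^ 2 := by
  rw [← norm_add_sq_real, map_sub]
  congr 2
  abel

/-- The objective gives no curvature in the slack. The penalty controls `slackMap A v`, and the
slack is recovered as `A v.fst - slackMap A v`; the bound on `ρ` lets half of the modulus in `y` pay
for the term `A v.fst`. -/
theorem convConst_le (hρ : 0 < ρ) (hA : ρ * ‖A‖ ^ 2 ≤ m)
    (v : WithLp 2 (Y × EuclideanSpace ℝ (Fin n))) :
    convConst m ρ / 2 * ‖v‖ ^ 2 ≤ m / 2 * ‖v.fst‖ ^ 2 + ρ / 2 * ‖slackMap A v‖ ^ 2 := by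
  rw [WithLp.prod_norm_sq_eq_of_L2]
  have h1 : convConst m ρ * ‖v.fst‖ ^ 2 ≤ m / 2 * ‖v.fst‖ ^ 2 := by
    gcongr; exact min_le_left _ _
  have h2 : convConst m ρ * ‖v.snd‖ ^ 2 ≤ ρ / 4 * ‖v.snd‖ ^ 2 := by
    gcongr; exact min_le_right _ _
  have h3 : ‖v.snd‖ ≤ ‖A‖ * ‖v.fst‖ + ‖slackMap A v‖ := by
    have : v.snd = A v.fst - slackMap A v := by simp
    rw [this]
    refine (norm_sub_le _ _).trans ?_
    gcongr
    exact A.le_opNorm _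
  have h4 : ‖v.snd‖ ^ 2 ≤ 2 * (‖A‖ ^ 2 * ‖v.fst‖ ^ 2) + 2 * ‖slackMap A v‖ ^ 2 := by
    calc _ ≤ (‖A‖ * ‖v.fst‖ + ‖slackMap A v‖) ^ 2 := by gcongr
      _ ≤ _ := by linarith [sq_nonneg (‖A‖ * ‖v.fst‖ - ‖slackMap A v‖)]
  have h5 := mul_le_mul_of_nonneg_left h4 hρ.le
  have h6 := mul_le_mul_of_nonneg_right hA (sq_nonneg ‖v.fst‖)
  have h7 : 0 ≤ ρ * ‖slackMap A v‖ ^ 2 := by positivity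
  linarith

theorem convex_slack : Convex ℝ {p : WithLp 2 (Y × EuclideanSpace ℝ (Fin n)) | ∀ i, p.snd i ≤ 0} :=
    by
  intro p hp q hq s t hs ht _ i
  have h1 := mul_nonpos_of_nonneg_of_nonpos hs (hp i)
  have h2 := mul_nonpos_of_nonneg_of_nonpos ht (hq i)
  simpa using add_nonpos h1 h2

theorem isClosed_slack :
    IsClosed {p : WithLp 2 (Y × EuclideanSpace ℝ (Fin n)) | ∀ i, p.snd i ≤ 0} := by
  rw [ofPred_forall]
  refine isClosed_iInter fun i => isClosed_le ?_ continuous_const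
  have := (WithLp.sndL 2 ℝ Y (EuclideanSpace ℝ (Fin n))).continuous
  exact (EuclideanSpace.proj i : EuclideanSpace ℝ (Fin n) →L[ℝ] ℝ).continuous.comp this

variable (hφ : RegularObjective φ m ℓ)
include hφ

theorem penaltyBlock_strong (hρ : 0 < ρ) (hA : ρ * ‖A‖ ^ 2 ≤ m) (x : X)
    (p q : WithLp 2 (Y × EuclideanSpace ℝ (Fin n))) :
    (penaltyBlock φ A b ρ).F x p + inner ℝ ((penaltyBlock φ A b ρ).gp x p) (q - p)
      + convConst m ρ / 2 * ‖q - p‖ ^ 2 ≤ (penaltyBlock φ A b ρ).F x q := by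
  have h1 := (hφ.regular_y x).strong p.fst q.fst
  have h2 := convConst_le hρ hA (q - p)
  rw [penaltyBlock_inner_gp]
  simp only [penaltyBlock]
  rw [norm_sq_slackMap p q]
  rw [WithLp.sub_fst] at *
  linarith

theorem penaltyBlock_smooth (hρ : 0 < ρ) (hℓ : 0 ≤ ℓ) (x : X)
    (p q : WithLp 2 (Y × EuclideanSpace ℝ (Fin n))) :
    (penaltyBlock φ A b ρ).F x q ≤ (penaltyBlock φ A b ρ).F x p
      + inner ℝ ((penaltyBlock φ A b ρ).gp x p) (q - p)
      + smoothConst ℓ ρ ‖A‖ / 2 * ‖q - p‖ ^ 2 := by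
  have h1 := (hφ.regular_y x).smooth p.fst q.fst
  have h2 : ‖slackMap A (q - p)‖ ^ 2 ≤ (slackBound ‖A‖ * ‖q - p‖) ^ 2 := by
    gcongr; exact norm_slackMap_le A _
  have h3 : ‖(q - p).fst‖ ^ 2 ≤ ‖q - p‖ ^ 2 := by
    gcongr; exact WithLp.norm_fst_le _ _
  have h4 := mul_le_mul_of_nonneg_left h2 hρ.le
  have h5 := mul_le_mul_of_nonneg_left h3 hℓ
  rw [penaltyBlock_inner_gp]
  simp only [penaltyBlock, smoothConst]
  rw [norm_sq_slackMap p q]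
  rw [WithLp.sub_fst] at *
  linarith

theorem penaltyBlock_continuous (x : X) : Continuous ((penaltyBlock φ A b ρ).F x) := by
  have h1 := (hφ.regular_y x).diff.continuous.comp
    (WithLp.fstL 2 ℝ Y (EuclideanSpace ℝ (Fin n))).continuous
  exact h1.add (by fun_prop)

theorem penaltyBlock_sol_spec (hm : 0 < m) (hρ : 0 < ρ) (hA : ρ * ‖A‖ ^ 2 ≤ m) (x : X)
    (u : EuclideanSpace ℝ (Fin n)) :
    (penaltyBlock φ A b ρ).sol x u ∈ (penaltyBlock φ A b ρ).S ∧
      ∀ q ∈ (penaltyBlock φ A b ρ).S,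
        (penaltyBlock φ A b ρ).lag x ((penaltyBlock φ A b ρ).sol x u) u
          ≤ (penaltyBlock φ A b ρ).lag x q u := by
  refine argminOn_spec (φ := fun p => (penaltyBlock φ A b ρ).lag x p u) ?_
  have hσ : 0 < convConst m ρ := lt_min (by positivity) (by positivity)
  set K := penaltyBlock φ A b ρ with hKdef
  let D : WithLp 2 (Y × EuclideanSpace ℝ (Fin n)) →L[ℝ] ℝ :=
    innerSL ℝ (K.gp x 0) + (innerSL ℝ u).comp K.B
  refine exists_isMinOn_of_quadratic_growth (p := 0) (a := K.lag x 0 u) (c := ‖D‖) isClosed_slack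
    ⟨0, fun i => by simp⟩ ?_ (half_pos hσ) fun q => ?_
  · refine (penaltyBlock_continuous hφ x).add ?_
    fun_prop
  · have h1 := penaltyBlock_strong (b := b) hφ hρ hA x 0 q
    have h2 := neg_le_of_abs_le (D.le_opNorm (q - 0))
    simp only [D, add_apply, innerSL_apply_apply,
      ContinuousLinearMap.comp_apply] at h2
    simp only [SaddleBlock.lag, ← hKdef, map_sub, map_zero, inner_sub_right, inner_zero_right] at *
    linarith

/-- The feasible minimizer. -/
theorem RegularObjective.argmin_spec (hm : 0 < m) (hne : {y | ∀ i, (A y - b) i ≤ 0}.Nonempty)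
    (x : X) : argminOn {y | ∀ i, (A y - b) i ≤ 0} (φ x) ∈ {y | ∀ i, (A y - b) i ≤ 0} ∧
      ∀ q ∈ {y | ∀ i, (A y - b) i ≤ 0},
        φ x (argminOn {y | ∀ i, (A y - b) i ≤ 0} (φ x)) ≤ φ x q :=
  argminOn_spec ((hφ.regular_y x).exists_isMinOn hm (isClosed_feasible A b) hne)

theorem RegularObjective.exists_kkt (hm : 0 < m) (hne : {y | ∀ i, (A y - b) i ≤ 0}.Nonempty)
    (x : X) : ∃ u, KKT (φ x) A b (argminOn {y | ∀ i, (A y - b) i ≤ 0} (φ x)) u :=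
  (hφ.regular_y x).exists_kkt (hφ.argmin_spec hm hne x).1 (hφ.argmin_spec hm hne x).2

/-- The minimizer of the augmented Lagrangian solves the problem with a perturbed constraint. -/
theorem penaltyBlock_sol_kkt (hm : 0 < m) (hℓ : 0 ≤ ℓ) (hρ : 0 < ρ) (hA : ρ * ‖A‖ ^ 2 ≤ m) (x : X)
    (u : EuclideanSpace ℝ (Fin n)) :
    KKT (φ x) A (b + (penaltyBlock φ A b ρ).res x u) ((penaltyBlock φ A b ρ).sol x u).fst
      (u + ρ • (penaltyBlock φ A b ρ).res x u) := by
  classical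
  set K := penaltyBlock φ A b ρ with hKdef
  set p := K.sol x u with hp
  set r := K.res x u with hr
  set w := u + ρ • r with hw
  obtain ⟨hmem, hmin⟩ := penaltyBlock_sol_spec (b := b) hφ hm hρ hA x u
  rw [← hKdef, ← hp] at hmem hmin
  have hrp : slackMap A p - b = r := rfl
  -- The penalty gradient `ρ • r` and `u` merge into one multiplier `w`.
  have hfo : ∀ q ∈ K.S, 0 ≤ inner ℝ (gradient (φ x) p.fst) (q - p).fst
      + inner ℝ w (A (q - p).fst) - inner ℝ w (q - p).snd := by
    intro q hq
    have := first_order_condition convex_slack hmem (K.dlag x p u)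
      (Λ := smoothConst ℓ ρ ‖A‖) (G := fun q => K.lag x q u) (fun q => by
        have := penaltyBlock_smooth (A := A) (b := b) hφ hρ hℓ x p q
        simp only [SaddleBlock.lag, SaddleBlock.dlag_apply, map_sub, inner_sub_right, ← hKdef] at *
        linarith) hmin hq
    rw [SaddleBlock.dlag_apply, hKdef, penaltyBlock_inner_gp, hrp] at this
    have e : inner ℝ w (slackMap A (q - p)) = ρ * inner ℝ r (slackMap A (q - p))
        + inner ℝ u (slackMap A (q - p)) := by
      rw [hw, inner_add_left, inner_smul_left]; simp only [conj_trivial]; ring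
    rw [slackMap_apply, inner_sub_right] at e
    change 0 ≤ _ + inner ℝ u (slackMap A (q - p)) at this
    rw [slackMap_apply] at this
    linarith
  -- With right-hand side `b + r` the constraint value is exactly the slack variable, so feasibility
  -- is its sign condition.
  have hα : A p.fst - (b + r) = p.snd := by
    rw [← hrp, slackMap_apply]; abel
  have hstat : gradient (φ x) p.fst + A.adjoint w = 0 := by
    have := hfo (WithLp.toLp 2 (p.fst - (gradient (φ x) p.fst + A.adjoint w), p.snd))
      (fun i => hmem i)
    simp only [WithLp.sub_fst, WithLp.sub_snd, WithLp.toLp_fst, WithLp.toLp_snd, sub_self,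
      inner_zero_right, sub_zero, sub_sub_cancel_left, ← ContinuousLinearMap.adjoint_inner_left]
      at this
    rw [← inner_add_left, inner_neg_right] at this
    exact real_inner_self_nonpos.1 (by linarith)
  -- Vary one slack coordinate: `t = -1` yields the sign of `w i`, and `t = -p.snd i` yields
  -- complementarity.
  have hcomp : ∀ i (t : ℝ), p.snd i + t ≤ 0 → w i * t ≤ 0 := by
    intro i t ht
    have := hfo (WithLp.toLp 2 (p.fst, p.snd + EuclideanSpace.single i t)) (fun j => by
      simp only [WithLp.toLp_snd, PiLp.add_apply, PiLp.single_apply]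
      split_ifs with h
      · rw [h]; exact ht
      · simpa using hmem j)
    simp only [WithLp.sub_fst, WithLp.sub_snd, WithLp.toLp_fst, WithLp.toLp_snd, sub_self,
      map_zero, inner_zero_right, add_sub_cancel_left, EuclideanSpace.inner_single_right] at this
    simp only [conj_trivial, zero_add, zero_sub] at this
    linarith
  have hnn : ∀ i, 0 ≤ w i := fun i => by
    have := hcomp i (-1) (by linarith [hmem i])
    linarith
  refine ⟨fun i => ?_, hnn, hstat, fun i => ?_⟩
  · rw [hα]; exact hmem i
  · rw [hα]
    have h1 := hcomp i (-p.snd i) (by simp)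
    have h2 := mul_nonpos_of_nonneg_of_nonpos (hnn i) (hmem i)
    linarith

/-- The constant of the error bound. -/
def errConst (C m ℓ a : ℝ) : ℝ := (1 + a) * (C * ℓ / m) + 1

omit hφ in
theorem errConst_nonneg {C m ℓ a : ℝ} (hC : 0 ≤ C) (hm : 0 < m) (hℓ : 0 ≤ ℓ) (ha : 0 ≤ a) :
    0 ≤ errConst C m ℓ a := by unfold errConst; positivity

/-- The field with content is `error_bound`: compare the KKT system of the solution with that of the
Lagrangian's minimizer, whose right-hand side is shifted by the residual. The slack component then
follows from the linear relation `h3`. -/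
theorem penaltyBlock_regular (hm : 0 < m) (hℓ : 0 ≤ ℓ) (hρ : 0 < ρ) (hA : ρ * ‖A‖ ^ 2 ≤ m)
    (hne : {y | ∀ i, (A y - b) i ≤ 0}.Nonempty) {C : ℝ} (hC0 : 0 ≤ C)
    (hC : ∀ w, ∃ w', A.adjoint w' = A.adjoint w ∧ SignConformal w' w ∧
      ‖w'‖ ≤ C * ‖A.adjoint w‖) :
    (penaltyBlock φ A b ρ).Regular (convConst m ρ) (smoothConst ℓ ρ ‖A‖) ℓ
      (errConst C m ℓ ‖A‖) (slackBound ‖A‖) where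
  convex_S := convex_slack
  strong := penaltyBlock_strong hφ hρ hA
  smooth := penaltyBlock_smooth hφ hρ hℓ
  smooth_x x x' p := by
    simp only [penaltyBlock, add_sub_add_right_eq_sub]
    exact abs_sub_sub_inner_gradient_le (hφ.diff_x p.fst) (fun x x' => hφ.lip_x x x' p.fst) x x'
  gx_lip x p q := by
    refine (hφ.lip_xy x p.fst q.fst).trans ?_
    gcongr
    rw [← WithLp.sub_fst]
    exact WithLp.norm_fst_le _ _
  B_le := norm_slackMap_le A
  sol_mem x u := (penaltyBlock_sol_spec hφ hm hρ hA x u).1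
  sol_min x u := (penaltyBlock_sol_spec hφ hm hρ hA x u).2
  opt_mem x := (hφ.argmin_spec hm hne x).1
  opt_res x := by simp [penaltyBlock]
  opt_min x q hq hqb := by
    have hqb' : A q.fst - q.snd = b := hqb
    have h1 : A q.fst - b = q.snd := by rw [← hqb']; abel
    have h2 := (hφ.argmin_spec hm hne x).2 q.fst (fun i => by rw [h1]; exact hq i)
    simpa [penaltyBlock, hqb'] using h2
  error_bound x u := by
    obtain ⟨u₀, hu₀⟩ := hφ.exists_kkt (A := A) (b := b) hm hne x
    have h1 := KKT.norm_sub_le (hφ.regular_y x) hm hℓ hC0 hC hu₀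
      (penaltyBlock_sol_kkt (b := b) hφ hm hℓ hρ hA x u)
    rw [add_sub_cancel_left] at h1
    set K := penaltyBlock φ A b ρ with hK
    have h2 : (K.sol x u - K.opt x).fst =
        (K.sol x u).fst - argminOn {y | ∀ i, (A y - b) i ≤ 0} (φ x) := rfl
    have h3 : (K.sol x u - K.opt x).snd = A (K.sol x u - K.opt x).fst - K.res x u := by
      rw [WithLp.sub_snd, WithLp.sub_fst, map_sub]
      change _ - (A (K.opt x).fst - b) = _ - (A (K.sol x u).fst - (K.sol x u).snd - b)
      abel
    rw [← h2] at h1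
    refine (norm_le_fst_add_snd _).trans ?_
    have h4 : ‖(K.sol x u - K.opt x).snd‖ ≤ ‖A‖ * ‖(K.sol x u - K.opt x).fst‖ + ‖K.res x u‖ := by
      rw [h3]
      exact (norm_sub_le _ _).trans (by gcongr; exact A.le_opNorm _)
    have h5 := mul_le_mul_of_nonneg_left h1 (norm_nonneg A)
    unfold errConst
    linarith

end Basic
end Penalty

/-! ### Dual multipliers, LICQ and stability of the active set. -/

section Multipliers

variable {dx dy dh : ℕ} {P : Bilevel dx dy dh} {φ : EuclideanSpace ℝ (Fin dy) → ℝ} {m ℓ : ℝ}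

theorem gradient_constraint (P : Bilevel dx dy dh) (i : Fin dh) (y : EuclideanSpace ℝ (Fin dy)) :
    gradient (fun y' => P.h y' i) y = P.A.adjoint (EuclideanSpace.single i 1) := by
  refine HasGradientAt.gradient ?_
  rw [hasGradientAt_iff_hasFDerivAt]
  have h1 : HasFDerivAt (fun y' => P.h y' i)
      ((EuclideanSpace.proj i : EuclideanSpace ℝ (Fin dh) →L[ℝ] ℝ).comp P.A) y := by
    have h2 := (EuclideanSpace.proj i : EuclideanSpace ℝ (Fin dh) →L[ℝ] ℝ).hasFDerivAt.comp y
      (P.A.hasFDerivAt.sub_const P.b)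
    exact h2
  refine h1.congr_fderiv (ContinuousLinearMap.ext fun v => ?_)
  simp [ContinuousLinearMap.adjoint_inner_left, EuclideanSpace.inner_single_left]

/-- Constraint gradients are the images of unit vectors under the adjoint of `A`, so LICQ is
injectivity of that adjoint on vectors supported on the active set. -/
theorem Bilevel.LICQ.injective {y : EuclideanSpace ℝ (Fin dy)} (h : P.LICQ y)
    {w : EuclideanSpace ℝ (Fin dh)} (hw : ∀ i ∉ {i | P.h y i = 0}, w i = 0)
    (h0 : P.A.adjoint w = 0) : w = 0 := by
  classical
  have hsum : w = ∑ i : {i : Fin dh // P.h y i = 0}, w i • EuclideanSpace.single i.1 (1 : ℝ) := by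
    ext j
    simp only [PiLp.smul_apply, WithLp.ofLp_sum, Finset.sum_apply, PiLp.single_apply, smul_eq_mul,
      mul_ite, mul_one, mul_zero]
    by_cases hj : P.h y j = 0
    · rw [Finset.sum_eq_single ⟨j, hj⟩] <;> simp +contextual [Subtype.ext_iff, eq_comm]
    · rw [hw j hj, eq_comm]
      refine Finset.sum_eq_zero fun i _ => ?_
      rw [if_neg]
      rintro rfl
      exact hj i.2
  have h1 : ∑ i : {i : Fin dh // P.h y i = 0}, w i • gradient (fun y' => P.h y' i.1) y = 0 := by
    simp only [gradient_constraint]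
    rw [hsum, map_sum] at h0
    simpa only [map_smul] using h0
  have h2 := Fintype.linearIndependent_iff.1 h _ h1
  ext j
  by_cases hj : P.h y j = 0
  · exact h2 ⟨j, hj⟩
  · exact hw j hj

theorem KKT.eq_zero_of_inactive {y : EuclideanSpace ℝ (Fin dy)} {u b : EuclideanSpace ℝ (Fin dh)}
    (h : KKT φ P.A b y u) {i : Fin dh} (hi : (P.A y - b) i ≠ 0) : u i = 0 :=
  (mul_eq_zero.1 (h.slack i)).resolve_right hi

/-- The real infimum of a family unbounded below is zero by default, so `dual` can be compared with
values only once boundedness is known. -/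
theorem KKT.bddBelow_lagrangian (hφ : RegularFun φ m ℓ) (hm : 0 < m)
    (u : EuclideanSpace ℝ (Fin dh)) : BddBelow (range fun y => φ y + inner ℝ u (P.h y)) := by
  refine ⟨φ 0 - inner ℝ u P.b - ‖gradient φ 0 + P.A.adjoint u‖ ^ 2 / (2 * m), ?_⟩
  rintro _ ⟨y, rfl⟩
  have h1 := hφ.strong 0 y
  have h2 := neg_le_of_abs_le (abs_real_inner_le_norm (gradient φ 0 + P.A.adjoint u) y)
  rw [inner_add_left, ContinuousLinearMap.adjoint_inner_left] at h2
  simp only [Bilevel.h, inner_sub_right, sub_zero] at *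
  set N := ‖gradient φ 0 + P.A.adjoint u‖
  have h3 : N * ‖y‖ ≤ N ^ 2 / (2 * m) + m / 2 * ‖y‖ ^ 2 := by
    have e : N ^ 2 / (2 * m) + m / 2 * ‖y‖ ^ 2 - N * ‖y‖ = (N - m * ‖y‖) ^ 2 / (2 * m) := by
      field_simp; ring
    have : 0 ≤ (N - m * ‖y‖) ^ 2 / (2 * m) := by positivity
    linarith
  linarith

/-- Strong duality: `y` minimizes the Lagrangian at `u`, and slackness removes the multiplier term.
-/
theorem KKT.dual_eq (hφ : RegularFun φ m ℓ) (hm : 0 < m) {y : EuclideanSpace ℝ (Fin dy)}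
    {u : EuclideanSpace ℝ (Fin dh)} (h : KKT φ P.A P.b y u) : P.dual φ u = φ y := by
  refine le_antisymm ?_ (le_ciInf fun y' => ?_)
  · refine (ciInf_le (KKT.bddBelow_lagrangian hφ hm u) y).trans ?_
    have : inner ℝ u (P.h y) = 0 := by
      rw [inner_eq_sum]; exact Finset.sum_eq_zero fun i _ => h.slack i
    rw [this, add_zero]
  · have h1 := h.lagrangian_ge hφ y'
    have h2 : 0 ≤ m / 2 * ‖y' - y‖ ^ 2 := by positivity
    unfold Bilevel.h
    linarith

theorem Bilevel.dual_le (hφ : RegularFun φ m ℓ) (hm : 0 < m) {y : EuclideanSpace ℝ (Fin dy)}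
    (hy : y ∈ P.feasible) {u : EuclideanSpace ℝ (Fin dh)} (hu : ∀ i, 0 ≤ u i) :
    P.dual φ u ≤ φ y := by
  refine (ciInf_le (KKT.bddBelow_lagrangian hφ hm u) y).trans ?_
  have : inner ℝ u (P.h y) ≤ 0 := by
    rw [inner_eq_sum]
    exact Finset.sum_nonpos fun i _ => mul_nonpos_of_nonneg_of_nonpos (hu i) (hy i)
  linarith

theorem KKT.isMultiplier (hφ : RegularFun φ m ℓ) (hm : 0 < m) {y : EuclideanSpace ℝ (Fin dy)}
    {u : EuclideanSpace ℝ (Fin dh)} (h : KKT φ P.A P.b y u) : P.IsMultiplier φ u := by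
  refine ⟨h.nonneg, fun u' hu' => ?_⟩
  change P.dual φ u' ≤ P.dual φ u
  rw [h.dual_eq hφ hm]
  exact Bilevel.dual_le hφ hm h.feasible hu'

/-- An optimal multiplier satisfies the Karush-Kuhn-Tucker conditions at the solution. -/
theorem KKT.of_isMultiplier (hφ : RegularFun φ m ℓ) (hm : 0 < m) {y : EuclideanSpace ℝ (Fin dy)}
    {u₀ u : EuclideanSpace ℝ (Fin dh)} (h₀ : KKT φ P.A P.b y u₀) (hu : P.IsMultiplier φ u) :
    KKT φ P.A P.b y u := by
  have h1 : φ y ≤ P.dual φ u := by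
    rw [← h₀.dual_eq hφ hm]; exact hu.2 h₀.nonneg
  have h2 : ∀ y', φ y ≤ φ y' + inner ℝ u (P.h y') := fun y' =>
    h1.trans (ciInf_le (KKT.bddBelow_lagrangian hφ hm u) y')
  have hle : ∀ i, u i * (P.h y) i ≤ 0 := fun i =>
    mul_nonpos_of_nonneg_of_nonpos (hu.1 i) (h₀.feasible i)
  -- Signs give `≤ 0`, and optimality of `u`, through `h2` at `y`, gives `≥ 0`. Hence `y` minimizes
  -- the Lagrangian over the whole space, and each slackness product vanishes.
  have h3 : inner ℝ u (P.h y) = 0 := by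
    refine le_antisymm ?_ (by linarith [h2 y])
    rw [inner_eq_sum]
    exact Finset.sum_nonpos fun i _ => hle i
  refine ⟨h₀.feasible, hu.1, ?_, fun i => ?_⟩
  · have h4 := first_order_condition (G := fun y' => φ y' + inner ℝ u (P.h y')) convex_univ
      (mem_univ y) (innerSL ℝ (gradient φ y + P.A.adjoint u)).toLinearMap (Λ := ℓ) (fun q => by
        have := hφ.smooth y q
        simp only [Bilevel.h, ContinuousLinearMap.coe_coe, innerSL_apply_apply, inner_add_left,
          ContinuousLinearMap.adjoint_inner_left, map_sub, inner_sub_right] at *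
        linarith) (fun q _ => by rw [h3, add_zero]; exact h2 q)
      (mem_univ (y - (gradient φ y + P.A.adjoint u)))
    simp only [ContinuousLinearMap.coe_coe, innerSL_apply_apply, sub_sub_cancel_left,
      inner_neg_right] at h4
    exact real_inner_self_nonpos.1 (by linarith)
  · rw [inner_eq_sum] at h3
    exact (Finset.sum_eq_zero_iff_of_nonpos fun i _ => hle i).1 h3 i (Finset.mem_univ i)

/-- Two optimal multipliers are both KKT multipliers at `y`: their images under the adjoint agree
and both live on the active set. -/
theorem KKT.existsUnique (hφ : RegularFun φ m ℓ) (hm : 0 < m) {y : EuclideanSpace ℝ (Fin dy)}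
    {u : EuclideanSpace ℝ (Fin dh)} (h : KKT φ P.A P.b y u) (hL : P.LICQ y) :
    ∃! u, P.IsMultiplier φ u := by
  refine ⟨u, h.isMultiplier hφ hm, fun w hw => ?_⟩
  have h' := h.of_isMultiplier hφ hm hw
  refine sub_eq_zero.1 (hL.injective (fun i hi => ?_) ?_)
  · rw [PiLp.sub_apply, h.eq_zero_of_inactive hi, h'.eq_zero_of_inactive hi, sub_zero]
  · rw [map_sub, eq_neg_of_add_eq_zero_right h.stationary,
      eq_neg_of_add_eq_zero_right h'.stationary, sub_self]

/-- The multiplier selected by `argmaxOn` satisfies the Karush-Kuhn-Tucker conditions. -/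
theorem KKT.argmaxOn_dual (hφ : RegularFun φ m ℓ) (hm : 0 < m) {y : EuclideanSpace ℝ (Fin dy)}
    {u : EuclideanSpace ℝ (Fin dh)} (h : KKT φ P.A P.b y u) :
    KKT φ P.A P.b y (argmaxOn {u | ∀ i, 0 ≤ u i} (P.dual φ)) :=
  h.of_isMultiplier hφ hm (Classical.epsilon_spec
    (p := fun u => u ∈ {u : EuclideanSpace ℝ (Fin dh) | ∀ i, 0 ≤ u i} ∧
      IsMaxOn (P.dual φ) {u | ∀ i, 0 ≤ u i} u) ⟨u, h.isMultiplier hφ hm⟩)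

/-- Constraints that are inactive at `y` remain inactive under small perturbations. -/
theorem exists_inactive_radius (A : EuclideanSpace ℝ (Fin dy) →L[ℝ] EuclideanSpace ℝ (Fin dh))
    (b : EuclideanSpace ℝ (Fin dh)) (y : EuclideanSpace ℝ (Fin dy)) :
    ∃ τ > 0, ∀ y' b', ‖y' - y‖ ≤ τ → ‖b' - b‖ ≤ τ →
      ∀ i, (A y - b) i ≠ 0 → (A y' - b') i ≠ 0 := by
  have hev : ∀ᶠ q : EuclideanSpace ℝ (Fin dy) × EuclideanSpace ℝ (Fin dh) in nhds (y, b),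
      ∀ i, (A y - b) i ≠ 0 → (A q.1 - q.2) i ≠ 0 := by
    refine Filter.eventually_all.2 fun i => ?_
    by_cases hi : (A y - b) i = 0
    · exact Filter.Eventually.of_forall fun q h => absurd hi h
    · have hc : Continuous fun q : EuclideanSpace ℝ (Fin dy) × EuclideanSpace ℝ (Fin dh) =>
          (A q.1 - q.2) i := by fun_prop
      exact (hc.continuousAt.eventually_ne hi).mono fun q hq _ => hq
  obtain ⟨τ, hτ, hball⟩ := Metric.nhds_basis_closedBall.eventually_iff.1 hev
  refine ⟨τ, hτ, fun y' b' hy hb => hball (x := (y', b')) ?_⟩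
  rw [Metric.mem_closedBall, dist_eq_norm, Prod.norm_def]
  exact max_le hy hb

/-- Multipliers close to a point where LICQ holds are stable. -/
theorem KKT.norm_sub_le_of_licq (hφ : RegularFun φ m ℓ) {C : ℝ} (hC0 : 0 ≤ C)
    (hC : ∀ w, ∃ w', P.A.adjoint w' = P.A.adjoint w ∧ SignConformal w' w ∧
      ‖w'‖ ≤ C * ‖P.A.adjoint w‖) {y₀ : EuclideanSpace ℝ (Fin dy)} (hL : P.LICQ y₀) {τ : ℝ}
    (hτ : ∀ y' b', ‖y' - y₀‖ ≤ τ → ‖b' - P.b‖ ≤ τ →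
      ∀ i, (P.A y₀ - P.b) i ≠ 0 → (P.A y' - b') i ≠ 0)
    {y y' : EuclideanSpace ℝ (Fin dy)} {u u' b b' : EuclideanSpace ℝ (Fin dh)}
    (h : KKT φ P.A b y u) (h' : KKT φ P.A b' y' u') (hy : ‖y - y₀‖ ≤ τ) (hb : ‖b - P.b‖ ≤ τ)
    (hy' : ‖y' - y₀‖ ≤ τ) (hb' : ‖b' - P.b‖ ≤ τ) : ‖u' - u‖ ≤ C * (ℓ * ‖y' - y‖) :=
  KKT.norm_multiplier_sub_le hφ hC0 hC (I := {i | P.h y₀ i = 0})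
    (fun _ hw h0 => hL.injective hw h0) h h'
    (fun i hi => h.eq_zero_of_inactive (hτ y b hy hb i hi))
    (fun i hi => h'.eq_zero_of_inactive (hτ y' b' hy' hb' i hi))

end Multipliers

/-! ### Gradient formulas and `δ`-free regularity of `g_δ`. -/

section Gradients

variable {Y : Type*} [NormedAddCommGroup Y] [InnerProductSpace ℝ Y] [CompleteSpace Y]

theorem HasGradientAt.add' {f g : Y → ℝ} {a b y : Y} (hf : HasGradientAt f a y)
    (hg : HasGradientAt g b y) : HasGradientAt (fun y => f y + g y) (a + b) y := by
  rw [hasGradientAt_iff_hasFDerivAt] at *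
  rw [map_add]
  exact hf.add hg

theorem HasGradientAt.const_mul' {f : Y → ℝ} {a y : Y} (c : ℝ) (hf : HasGradientAt f a y) :
    HasGradientAt (fun y => c * f y) (c • a) y := by
  rw [hasGradientAt_iff_hasFDerivAt] at *
  rw [map_smul]
  exact hf.const_mul c

/-- The gradient of the linear and quadratic penalty terms. -/
theorem hasGradientAt_penalty {H : Type*} [NormedAddCommGroup H] [InnerProductSpace ℝ H]
    [CompleteSpace H] (T : Y →L[ℝ] H) (c u : H) (ρ : ℝ) (y : Y) :
    HasGradientAt (fun y => inner ℝ u (T y - c) + ρ / 2 * ‖T y - c‖ ^ 2)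
      (T.adjoint (u + ρ • (T y - c))) y := by
  rw [hasGradientAt_iff_hasFDerivAt]
  have hT : HasFDerivAt (fun y => T y - c) T y := T.hasFDerivAt.sub_const c
  have h1 := ((innerSL ℝ u).hasFDerivAt.comp y hT).add (hT.norm_sq.const_mul (ρ / 2))
  refine h1.congr_fderiv (ContinuousLinearMap.ext fun v => ?_)
  simp [ContinuousLinearMap.adjoint_inner_left]
  ring

end Gradients

variable {dx dy dh : ℕ} {P : Bilevel dx dy dh}

theorem norm_left_le_jointNorm {m n : ℕ} (x : EuclideanSpace ℝ (Fin m))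
    (y : EuclideanSpace ℝ (Fin n)) : ‖x‖ ≤ jointNorm x y :=
  Real.le_sqrt_of_sq_le (by nlinarith [sq_nonneg ‖y‖])

theorem norm_right_le_jointNorm {m n : ℕ} (x : EuclideanSpace ℝ (Fin m))
    (y : EuclideanSpace ℝ (Fin n)) : ‖y‖ ≤ jointNorm x y :=
  Real.le_sqrt_of_sq_le (by nlinarith [sq_nonneg ‖x‖])

theorem jointNorm_zero_right {m n : ℕ} (x : EuclideanSpace ℝ (Fin m)) :
    jointNorm x (0 : EuclideanSpace ℝ (Fin n)) = ‖x‖ := by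
  simp [jointNorm, Real.sqrt_sq]

theorem jointNorm_zero_left {m n : ℕ} (y : EuclideanSpace ℝ (Fin n)) :
    jointNorm (0 : EuclideanSpace ℝ (Fin m)) y = ‖y‖ := by
  simp [jointNorm, Real.sqrt_sq]

theorem Bilevel.gPen_zero : P.gPen 0 = P.g := by
  funext x y; simp [Bilevel.gPen]

namespace Bilevel.Assumptions

variable {lf0 lf1 lg1 μ δ : ℝ} (hP : P.Assumptions lf0 lf1 lg1 μ)
include hP

theorem differentiable_f_y (x : EuclideanSpace ℝ (Fin dx)) : Differentiable ℝ (P.f x) :=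
  (hP.f_contDiff.differentiable (by norm_num)).comp
    ((differentiable_const x).prodMk differentiable_id)

theorem differentiable_g_y (x : EuclideanSpace ℝ (Fin dx)) : Differentiable ℝ (P.g x) :=
  (hP.g_contDiff.differentiable (by norm_num)).comp
    ((differentiable_const x).prodMk differentiable_id)

theorem differentiable_f_x (y : EuclideanSpace ℝ (Fin dy)) :
    Differentiable ℝ fun x => P.f x y :=
  (hP.f_contDiff.differentiable (by norm_num)).comp
    (differentiable_id.prodMk (differentiable_const y))

theorem differentiable_g_x (y : EuclideanSpace ℝ (Fin dy)) :
    Differentiable ℝ fun x => P.g x y :=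
  (hP.g_contDiff.differentiable (by norm_num)).comp
    (differentiable_id.prodMk (differentiable_const y))

theorem hasGradientAt_gPen_y (δ : ℝ) (x : EuclideanSpace ℝ (Fin dx))
    (y : EuclideanSpace ℝ (Fin dy)) :
    HasGradientAt (P.gPen δ x) (δ • gradient (P.f x) y + gradient (P.g x) y) y :=
  ((hP.differentiable_f_y x y).hasGradientAt.const_mul' δ).add'
    (hP.differentiable_g_y x y).hasGradientAt

theorem hasGradientAt_gPen_x (δ : ℝ) (x : EuclideanSpace ℝ (Fin dx))
    (y : EuclideanSpace ℝ (Fin dy)) :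
    HasGradientAt (fun x => P.gPen δ x y)
      (δ • gradient (fun x => P.f x y) x + gradient (fun x => P.g x y) x) x :=
  ((hP.differentiable_f_x y x).hasGradientAt.const_mul' δ).add'
    (hP.differentiable_g_x y x).hasGradientAt

/-- `g_δ` inherits the regularity of `f` and `g` for small `δ`. -/
theorem regular_gPen (hδ : 0 ≤ δ) (hδμ : 2 * lf1 * δ ≤ μ) :
    RegularObjective (P.gPen δ) (μ / 2) (lg1 + μ / 2) := by
  -- The bound `lf1 * δ ≤ μ / 2` enters here and in the strong convexity below; it removes `δ` from
  -- all constants.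
  have hcomb : ∀ {n : ℕ} (a a' c c' : EuclideanSpace ℝ (Fin n)) (t : ℝ), 0 ≤ t →
      ‖a - a'‖ ≤ lf1 * t → ‖c - c'‖ ≤ lg1 * t →
      ‖(δ • a + c) - (δ • a' + c')‖ ≤ (lg1 + μ / 2) * t := by
    intro n a a' c c' t ht ha hc
    have e : (δ • a + c) - (δ • a' + c') = δ • (a - a') + (c - c') := by module
    rw [e]
    refine (norm_add_le _ _).trans ?_
    rw [norm_smul, Real.norm_of_nonneg hδ]
    have h1 := mul_le_mul_of_nonneg_left ha hδ
    have h2 := mul_le_mul_of_nonneg_right hδμ ht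
    linarith
  refine ⟨fun x => ⟨fun y => (hP.hasGradientAt_gPen_y δ x y).differentiableAt, fun y y' => ?_,
    fun y y' => ?_⟩, fun y x => (hP.hasGradientAt_gPen_x δ x y).differentiableAt,
    fun x x' y => ?_, fun x y y' => ?_⟩
  · rw [(hP.hasGradientAt_gPen_y δ x y).gradient, inner_add_left, inner_smul_left]
    have h1 := (hP.g_strongConvex x).add_inner_gradient_le (hP.differentiable_g_y x) y y'
    have h2 := (abs_le.1 (abs_sub_sub_inner_gradient_le (hP.differentiable_f_y x)
      (fun y y' => by
        have := (norm_right_le_jointNorm _ _).trans (hP.grad_f_lipschitz x x y y')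
        rwa [sub_self, jointNorm_zero_left] at this) y y')).1
    have h3 := mul_le_mul_of_nonneg_left h2 hδ
    have h4 := mul_le_mul_of_nonneg_right hδμ (sq_nonneg ‖y' - y‖)
    simp only [gPen, conj_trivial]
    linarith
  · rw [(hP.hasGradientAt_gPen_y δ x y).gradient, (hP.hasGradientAt_gPen_y δ x y').gradient]
    refine hcomb _ _ _ _ _ (norm_nonneg _) ?_ ?_
    · have := (norm_right_le_jointNorm _ _).trans (hP.grad_f_lipschitz x x y y')
      rwa [sub_self, jointNorm_zero_left] at this
    · have := (norm_right_le_jointNorm _ _).trans (hP.grad_g_lipschitz x x y y')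
      rwa [sub_self, jointNorm_zero_left] at this
  · rw [(hP.hasGradientAt_gPen_x δ x y).gradient, (hP.hasGradientAt_gPen_x δ x' y).gradient]
    refine hcomb _ _ _ _ _ (norm_nonneg _) ?_ ?_
    · have := (norm_left_le_jointNorm _ _).trans (hP.grad_f_lipschitz x x' y y)
      rwa [sub_self, jointNorm_zero_right] at this
    · have := (norm_left_le_jointNorm _ _).trans (hP.grad_g_lipschitz x x' y y)
      rwa [sub_self, jointNorm_zero_right] at this
  · rw [(hP.hasGradientAt_gPen_x δ x y).gradient, (hP.hasGradientAt_gPen_x δ x y').gradient]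
    refine hcomb _ _ _ _ _ (norm_nonneg _) ?_ ?_
    · have := (norm_left_le_jointNorm _ _).trans (hP.grad_f_lipschitz x x y y')
      rwa [sub_self, jointNorm_zero_left] at this
    · have := (norm_left_le_jointNorm _ _).trans (hP.grad_g_lipschitz x x y y')
      rwa [sub_self, jointNorm_zero_left] at this

theorem regular_g (hμ : 0 ≤ μ) : RegularObjective P.g (μ / 2) (lg1 + μ / 2) := by
  have := hP.regular_gPen (δ := 0) le_rfl (by simpa using hμ)
  rwa [gPen_zero] at this

end Bilevel.Assumptions

/-! ### The algorithm as two independent block steps and a step in `x`. -/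

namespace Bilevel

/-- The block of the variables `y', u`. -/
def blockY (P : Bilevel dx dy dh) (δ ρ : ℝ) :
    SaddleBlock (WithLp 2 (EuclideanSpace ℝ (Fin dy) × EuclideanSpace ℝ (Fin dh)))
      (EuclideanSpace ℝ (Fin dx)) (EuclideanSpace ℝ (Fin dh)) :=
  penaltyBlock (P.gPen δ) P.A P.b ρ

/-- The block of the variables `z', v`. -/
def blockZ (P : Bilevel dx dy dh) (ρ : ℝ) :
    SaddleBlock (WithLp 2 (EuclideanSpace ℝ (Fin dy) × EuclideanSpace ℝ (Fin dh)))
      (EuclideanSpace ℝ (Fin dx)) (EuclideanSpace ℝ (Fin dh)) :=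
  penaltyBlock P.g P.A P.b ρ

theorem lag_penaltyBlock {φ : EuclideanSpace ℝ (Fin dx) → EuclideanSpace ℝ (Fin dy) → ℝ}
    {ρ : ℝ} (x : EuclideanSpace ℝ (Fin dx)) (y : EuclideanSpace ℝ (Fin dy))
    (α u : EuclideanSpace ℝ (Fin dh)) :
    (penaltyBlock φ P.A P.b ρ).lag x (WithLp.toLp 2 (y, α)) u =
      φ x y + ρ / 2 * ‖P.resid (y, α)‖ ^ 2 + inner ℝ u (P.resid (y, α)) := by
  have e : P.A y - α - P.b = P.resid (y, α) := by simp only [resid, h]; abel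
  simp only [SaddleBlock.lag, penaltyBlock, slackMap_apply, WithLp.toLp_fst, WithLp.toLp_snd, e]

/-- Given `x`, the two blocks evolve independently, and ascent on `K` in `z'` is descent on the
second Lagrangian. -/
theorem augLag_eq (prm : Params) (δ : ℝ) (x : EuclideanSpace ℝ (Fin dx))
    (p q : EuclideanSpace ℝ (Fin dy) × EuclideanSpace ℝ (Fin dh))
    (u v : EuclideanSpace ℝ (Fin dh)) :
    P.augLag prm δ x p q u v = (P.blockY δ prm.ρ₁).lag x (WithLp.toLp 2 p) u
      - (P.blockZ prm.ρ₂).lag x (WithLp.toLp 2 q) v := by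
  obtain ⟨y, α⟩ := p
  obtain ⟨z, β⟩ := q
  rw [blockY, blockZ, lag_penaltyBlock, lag_penaltyBlock, augLag, gPen]
  ring

/-- A projected gradient step on the augmented Lagrangian of one block. -/
theorem isStep_penaltyBlock
    {φ : EuclideanSpace ℝ (Fin dx) → EuclideanSpace ℝ (Fin dy) → ℝ} {ρ ηu η : ℝ}
    {x : EuclideanSpace ℝ (Fin dx)} {y y' : EuclideanSpace ℝ (Fin dy)}
    {α α' u u' : EuclideanSpace ℝ (Fin dh)} (hu : u' = u + ηu • P.resid (y, α))
    (hy : y' = y - η • (gradient (φ x) y + P.A.adjoint (u' + ρ • P.resid (y, α))))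
    (hα : α' = projNeg (α - η • (-(u' + ρ • P.resid (y, α))))) :
    (penaltyBlock φ P.A P.b ρ).IsStep ηu η x (WithLp.toLp 2 (y, α)) u
      (WithLp.toLp 2 (y', α')) u' := by
  have e : slackMap P.A (WithLp.toLp 2 (y, α)) - P.b = P.resid (y, α) := by
    simp only [slackMap_apply, WithLp.toLp_fst, WithLp.toLp_snd, resid, h]; abel
  refine ⟨fun i => ?_, ?_, fun q hq => ?_⟩
  · simp [hα, projNeg]
  · rw [hu]
    change _ = u + ηu • (slackMap P.A (WithLp.toLp 2 (y, α)) - P.b)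
    rw [e]
  · rw [SaddleBlock.dlag_apply, penaltyBlock_inner_gp, e, WithLp.prod_inner_apply]
    change _ ≤ η * (_ + inner ℝ u' (slackMap P.A _))
    set w := u' + ρ • P.resid (y, α) with hw
    have e2 : ρ * inner ℝ (P.resid (y, α)) (slackMap P.A (q - WithLp.toLp 2 (y', α')))
        + inner ℝ u' (slackMap P.A (q - WithLp.toLp 2 (y', α')))
        = inner ℝ (P.A.adjoint w) (q.fst - y') - inner ℝ w (q.snd - α') := by
      rw [ContinuousLinearMap.adjoint_inner_left, ← inner_sub_right, hw, inner_add_left,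
        inner_smul_left, slackMap_apply]
      simp only [WithLp.sub_fst, WithLp.sub_snd, WithLp.toLp_fst, WithLp.toLp_snd, conj_trivial]
      ring
    have h1 : inner ℝ (y - y') (q.fst - y') =
        η * (inner ℝ (gradient (φ x) y) (q.fst - y') + inner ℝ (P.A.adjoint w) (q.fst - y')) := by
      rw [← inner_add_left, ← real_inner_smul_left, hy, sub_sub_cancel]
    -- Coordinatewise projection inequality: without truncation it is an equality, and with
    -- truncation `α' i = 0` and `q.snd i ≤ 0` give the sign.
    have h2 : inner ℝ (α - α') (q.snd - α') ≤ -(η * inner ℝ w (q.snd - α')) := by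
      rw [← real_inner_smul_left, inner_eq_sum, inner_eq_sum, ← Finset.sum_neg_distrib]
      refine Finset.sum_le_sum fun i _ => ?_
      have hqi : q.snd i ≤ 0 := hq i
      have hαi : α' i = min (α i + η * w i) 0 := by simp [hα, projNeg]
      simp only [PiLp.sub_apply, PiLp.smul_apply, smul_eq_mul]
      rcases le_total (α i + η * w i) 0 with h | h
      · rw [min_eq_left h] at hαi
        rw [hαi]; linarith
      · rw [min_eq_right h] at hαi
        rw [hαi]; nlinarith
    simp only [WithLp.ofLp_sub, Prod.fst_sub, Prod.snd_sub, WithLp.sub_fst, WithLp.toLp_fst]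
    change inner ℝ (y - y') (q.fst - y') + inner ℝ (α - α') (q.snd - α') ≤ _
    rw [add_assoc, e2]
    linarith

theorem hasGradientAt_lag_y {φ : EuclideanSpace ℝ (Fin dx) → EuclideanSpace ℝ (Fin dy) → ℝ}
    {ρ : ℝ} (x : EuclideanSpace ℝ (Fin dx)) (hd : Differentiable ℝ (φ x))
    (y : EuclideanSpace ℝ (Fin dy)) (α u : EuclideanSpace ℝ (Fin dh)) :
    HasGradientAt (fun y => (penaltyBlock φ P.A P.b ρ).lag x (WithLp.toLp 2 (y, α)) u)
      (gradient (φ x) y + P.A.adjoint (u + ρ • P.resid (y, α))) y := by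
  have h1 := (hd y).hasGradientAt.add' (hasGradientAt_penalty P.A (P.b + α) u ρ y)
  have e : ∀ y, P.A y - (P.b + α) = P.resid (y, α) := fun y => by simp only [resid, h]; abel
  simp only [e] at h1
  refine h1.congr_of_eventuallyEq (Filter.Eventually.of_forall fun y => ?_)
  simp only [lag_penaltyBlock]
  ring

theorem hasGradientAt_lag_α {φ : EuclideanSpace ℝ (Fin dx) → EuclideanSpace ℝ (Fin dy) → ℝ}
    {ρ : ℝ} (x : EuclideanSpace ℝ (Fin dx)) (y : EuclideanSpace ℝ (Fin dy))
    (α u : EuclideanSpace ℝ (Fin dh)) :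
    HasGradientAt (fun α => (penaltyBlock φ P.A P.b ρ).lag x (WithLp.toLp 2 (y, α)) u)
      (-(u + ρ • P.resid (y, α))) α := by
  have h1 := (hasGradientAt_const (𝕜 := ℝ) α (φ x y)).add' (hasGradientAt_penalty
    (-ContinuousLinearMap.id ℝ (EuclideanSpace ℝ (Fin dh))) (-P.h y) u ρ α)
  have e : ∀ α, (-ContinuousLinearMap.id ℝ (EuclideanSpace ℝ (Fin dh))) α - -P.h y
      = P.resid (y, α) := fun α => by simp [resid]; abel
  simp only [e] at h1
  have e2 : (0 : EuclideanSpace ℝ (Fin dh)) + (-ContinuousLinearMap.id ℝ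
      (EuclideanSpace ℝ (Fin dh))).adjoint (u + ρ • P.resid (y, α))
      = -(u + ρ • P.resid (y, α)) := by
    refine ext_inner_right ℝ fun v => ?_
    rw [zero_add, ContinuousLinearMap.adjoint_inner_left, inner_neg_left, ← inner_neg_right]
    rfl
  rw [e2] at h1
  refine h1.congr_of_eventuallyEq (Filter.Eventually.of_forall fun α => ?_)
  simp only [lag_penaltyBlock]
  ring

theorem HasGradientAt.sub_const' {f : EuclideanSpace ℝ (Fin dy) → ℝ}
    {a y : EuclideanSpace ℝ (Fin dy)} (hf : HasGradientAt f a y) (c : ℝ) :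
    HasGradientAt (fun y => f y - c) a y := by
  rw [hasGradientAt_iff_hasFDerivAt] at *
  exact hf.sub_const c

theorem HasGradientAt.const_sub' {f : EuclideanSpace ℝ (Fin dy) → ℝ}
    {a y : EuclideanSpace ℝ (Fin dy)} (hf : HasGradientAt f a y) (c : ℝ) :
    HasGradientAt (fun y => c - f y) (-a) y := by
  rw [hasGradientAt_iff_hasFDerivAt] at *
  rw [map_neg]
  exact hf.const_sub c

end Bilevel

/-- The pair `y'` of a state. -/
def State.p (s : State dx dy dh) :
    WithLp 2 (EuclideanSpace ℝ (Fin dy) × EuclideanSpace ℝ (Fin dh)) := WithLp.toLp 2 (s.y, s.α)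

/-- The pair `z'` of a state. -/
def State.q (s : State dx dy dh) :
    WithLp 2 (EuclideanSpace ℝ (Fin dy) × EuclideanSpace ℝ (Fin dh)) := WithLp.toLp 2 (s.z, s.β)

namespace Bilevel.Assumptions

variable {lf0 lf1 lg1 μ : ℝ} (hP : P.Assumptions lf0 lf1 lg1 μ)
include hP

theorem isStep_blockY (prm : Params) (δ : ℝ) (s : State dx dy dh) :
    (P.blockY δ prm.ρ₁).IsStep prm.ηu prm.ηy s.x s.p s.u (P.step prm δ s).p
      (P.step prm δ s).u := by
  refine isStep_penaltyBlock rfl ?_ ?_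
  · simp only [step, augLag_eq, blockY, blockZ]
    rw [(HasGradientAt.sub_const' (hasGradientAt_lag_y (P := P) s.x
      (fun y => (hP.hasGradientAt_gPen_y δ s.x y).differentiableAt) s.y s.α _) _).gradient]
  · simp only [step, augLag_eq, blockY, blockZ]
    rw [(HasGradientAt.sub_const' (hasGradientAt_lag_α (P := P) s.x s.y s.α _) _).gradient]

theorem isStep_blockZ (prm : Params) (δ : ℝ) (s : State dx dy dh) :
    (P.blockZ prm.ρ₂).IsStep prm.ηv prm.ηz s.x s.q s.v (P.step prm δ s).q
      (P.step prm δ s).v := by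
  refine isStep_penaltyBlock rfl ?_ ?_
  · simp only [step, augLag_eq, blockY, blockZ]
    rw [(HasGradientAt.const_sub' (hasGradientAt_lag_y (P := P) s.x
      (hP.differentiable_g_y s.x) s.z s.β _) _).gradient, smul_neg, sub_eq_add_neg]
  · simp only [step, augLag_eq, blockY, blockZ]
    rw [(HasGradientAt.const_sub' (hasGradientAt_lag_α (P := P) s.x s.z s.β _) _).gradient, smul_neg,
      smul_neg, sub_eq_add_neg]

theorem step_x (prm : Params) (δ : ℝ) (s : State dx dy dh) :
    (P.step prm δ s).x = s.x - prm.ηx •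
      ((P.blockY δ prm.ρ₁).gx s.x s.p - (P.blockZ prm.ρ₂).gx s.x s.q) := by
  simp only [step]
  congr 2
  refine HasGradientAt.gradient ?_
  have h1 := hP.hasGradientAt_gPen_x δ s.x s.y
  have h2 : HasGradientAt (fun x => P.g x s.z) (gradient (fun x => P.g x s.z) s.x) s.x :=
    (hP.differentiable_g_x s.z s.x).hasGradientAt
  have h3 : (P.blockY δ prm.ρ₁).gx s.x s.p =
      δ • gradient (fun x => P.f x s.y) s.x + gradient (fun x => P.g x s.y) s.x := h1.gradient
  have h4 : (P.blockZ prm.ρ₂).gx s.x s.q = gradient (fun x => P.g x s.z) s.x := rfl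
  rw [h3, h4]
  generalize s.u + prm.ηu • P.resid (s.y, s.α) = u
  generalize s.v + prm.ηv • P.resid (s.z, s.β) = v
  have h5 := (h1.add' (h2.const_mul' (-1))).add' (hasGradientAt_const (𝕜 := ℝ) s.x
    (inner ℝ u (P.resid (s.y, s.α)) - inner ℝ v (P.resid (s.z, s.β))
      + prm.ρ₁ / 2 * ‖P.resid (s.y, s.α)‖ ^ 2 - prm.ρ₂ / 2 * ‖P.resid (s.z, s.β)‖ ^ 2))
  rw [add_zero, neg_one_smul, ← sub_eq_add_neg] at h5
  refine h5.congr_of_eventuallyEq (Filter.Eventually.of_forall fun x => ?_)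
  simp only [augLag, gPen]
  ring

end Bilevel.Assumptions

/-! ### A priori bounds on the gap. -/

namespace SaddleBlock.Regular

variable {V X H : Type*} [NormedAddCommGroup V] [InnerProductSpace ℝ V]
  [NormedAddCommGroup X] [InnerProductSpace ℝ X] [NormedAddCommGroup H] [InnerProductSpace ℝ H]
  {K : SaddleBlock V X H} {σ Λ ℓ κ β : ℝ} (hK : K.Regular σ Λ ℓ κ β)
include hK

theorem eq_sol (hσ : 0 < σ) {x : X} {u : H} {q : V} (hq : q ∈ K.S)
    (hle : K.lag x q u ≤ K.lag x (K.sol x u) u) : q = K.sol x u := by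
  have h1 := hK.sol_growth x u hq
  unfold dualVal at h1
  have h2 : ‖q - K.sol x u‖ ^ 2 ≤ 0 := by
    by_contra! hcon
    have : 0 < σ / 2 * ‖q - K.sol x u‖ ^ 2 := by positivity
    linarith
  exact sub_eq_zero.1 (norm_eq_zero.1 (pow_eq_zero_iff two_ne_zero |>.1
    (le_antisymm h2 (sq_nonneg _))))

/-- Minimizing the quadratic lower model `-c t + σ / 2 t²` over `t` shows the largest possible
suboptimality. -/
theorem lag_sub_dualVal_le (hσ : 0 < σ) {x : X} {p : V} {u : H} {c : ℝ}
    (hc : ∀ v, -(c * ‖v‖) ≤ K.dlag x p u v) :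
    K.lag x p u - K.dualVal x u ≤ c ^ 2 / (2 * σ) := by
  have h1 := hK.lag_strong x u p (K.sol x u)
  have h2 := hc (K.sol x u - p)
  set t := ‖K.sol x u - p‖
  have e : c ^ 2 / (2 * σ) - c * t + σ / 2 * t ^ 2 = (c - σ * t) ^ 2 / (2 * σ) := by
    field_simp; ring
  have : 0 ≤ (c - σ * t) ^ 2 / (2 * σ) := by positivity
  unfold dualVal
  linarith

/-- Any feasible `p₀` bounds `val` from above, and there `F` equals the Lagrangian; so both parts of
the gap become suboptimalities of explicit points, with no reference to the solution. -/
theorem gap_le (hσ : 0 < σ) {x : X} {p p₀ : V} {u : H} {c c₀ : ℝ}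
    (hc : ∀ v, -(c * ‖v‖) ≤ K.dlag x p u v) (hc₀ : ∀ v, -(c₀ * ‖v‖) ≤ K.dlag x p₀ u v)
    (hp₀ : p₀ ∈ K.S) (hp₀b : K.B p₀ = K.b) :
    K.gap x p u ≤ c ^ 2 / (2 * σ) + c₀ ^ 2 / (2 * σ) := by
  have h1 := hK.lag_sub_dualVal_le hσ hc
  have h2 := hK.lag_sub_dualVal_le hσ hc₀
  have h3 := hK.opt_min x p₀ hp₀ hp₀b
  rw [lag_of_feasible hp₀b] at h2
  unfold gap val
  linarith

end SaddleBlock.Regular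

/-- A function with a quadratic bound on the remainder is differentiable. -/
theorem hasGradientAt_of_abs_sub_le {X : Type*} [NormedAddCommGroup X] [InnerProductSpace ℝ X]
    [CompleteSpace X] {F : X → ℝ} {g x : X} {c : ℝ}
    (h : ∀ x', |F x' - F x - inner ℝ g (x' - x)| ≤ c * ‖x' - x‖ ^ 2) : HasGradientAt F g x := by
  rw [hasGradientAt_iff_isLittleO]
  refine Asymptotics.IsBigO.trans_isLittleO (Asymptotics.IsBigO.of_bound c
    (Filter.Eventually.of_forall fun x' => ?_)) (Asymptotics.isLittleO_pow_sub_sub x one_lt_two)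
  rw [Real.norm_eq_abs, norm_pow, norm_norm]
  exact h x'

/-! ### From a short step with small residual to accuracy of points and multipliers. -/

section Accuracy

variable {φ : EuclideanSpace ℝ (Fin dx) → EuclideanSpace ℝ (Fin dy) → ℝ} {m ℓ ρ C τ r ηu : ℝ}

/-- The accuracy constant for the multipliers. -/
def multConst (C ℓ κ ρ : ℝ) : ℝ := C * (ℓ * κ) + ρ

/-- The multiplier after a short step with small residual is accurate, near a point where LICQ
holds. -/
theorem norm_multiplier_sub_le (hφ : RegularObjective φ m ℓ) (hm : 0 < m) (hℓ : 0 ≤ ℓ)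
    (hρ : 0 < ρ) (hA : ρ * ‖P.A‖ ^ 2 ≤ m) (hne : P.feasible.Nonempty) (hC0 : 0 ≤ C)
    (hC : ∀ w, ∃ w', P.A.adjoint w' = P.A.adjoint w ∧ SignConformal w' w ∧
      ‖w'‖ ≤ C * ‖P.A.adjoint w‖) {y₀ : EuclideanSpace ℝ (Fin dy)} (hL : P.LICQ y₀)
    (hτ : ∀ y' b', ‖y' - y₀‖ ≤ τ → ‖b' - P.b‖ ≤ τ →
      ∀ i, (P.A y₀ - P.b) i ≠ 0 → (P.A y' - b') i ≠ 0)
    {x : EuclideanSpace ℝ (Fin dx)} {u : EuclideanSpace ℝ (Fin dh)}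
    (hy : ‖argminOn P.feasible (φ x) - y₀‖ + errConst C m ℓ ‖P.A‖ * r ≤ τ) (hrτ : r ≤ τ)
    (hr : ‖(penaltyBlock φ P.A P.b ρ).res x u‖ ≤ r) :
    ‖u - argmaxOn {u | ∀ i, 0 ≤ u i} (P.dual (φ x))‖ ≤
      multConst C ℓ (errConst C m ℓ ‖P.A‖) ρ * r := by
  set K := penaltyBlock φ P.A P.b ρ with hKdef
  have hK := penaltyBlock_regular hφ hm hℓ hρ hA hne hC0 hC
  set κ := errConst C m ℓ ‖P.A‖ with hκ
  have hκ0 : 0 ≤ κ := errConst_nonneg hC0 hm hℓ (norm_nonneg _)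
  have hr0 : 0 ≤ r := (norm_nonneg _).trans hr
  have hκr : 0 ≤ κ * r := mul_nonneg hκ0 hr0
  obtain ⟨u₀, hu₀⟩ := hφ.exists_kkt hm hne x
  have h1 := hu₀.argmaxOn_dual (hφ.regular_y x) hm
  have h2 := penaltyBlock_sol_kkt (b := P.b) hφ hm hℓ hρ hA x u
  set us := argmaxOn {u | ∀ i, 0 ≤ u i} (P.dual (φ x))
  have h3 : ‖(K.sol x u).fst - argminOn P.feasible (φ x)‖ ≤ κ * r := by
    have h4 : (K.sol x u).fst - argminOn P.feasible (φ x) = (K.sol x u - K.opt x).fst := rfl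
    rw [h4]
    refine (WithLp.norm_fst_le _ _).trans ((hK.error_bound x u).trans ?_)
    gcongr
  have h5 : ‖(u + ρ • K.res x u) - us‖ ≤ C * (ℓ * (κ * r)) := by
    refine (KKT.norm_sub_le_of_licq (hφ.regular_y x) hC0 hC hL hτ h1 h2 ?_ ?_ ?_ ?_).trans ?_
    · have : argminOn P.feasible (φ x) = argminOn {y | ∀ i, (P.A y - P.b) i ≤ 0} (φ x) := rfl
      rw [← this]; linarith
    · simpa using hr0.trans hrτ
    · refine (norm_sub_le_norm_sub_add_norm_sub _ (argminOn P.feasible (φ x)) _).trans ?_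
      linarith
    · rw [add_sub_cancel_left]; exact hr.trans hrτ
    · gcongr; exact h3
  -- The KKT multiplier of the perturbed problem is `u + ρ • res`, not `u`; undoing the shift costs
  -- the extra `ρ` in `multConst`.
  have h6 : u - us = ((u + ρ • K.res x u) - us) - ρ • K.res x u := by abel
  rw [h6]
  refine (norm_sub_le _ _).trans ?_
  rw [norm_smul, Real.norm_of_nonneg hρ.le]
  have h7 := mul_le_mul_of_nonneg_left hr hρ.le
  unfold multConst
  linarith

/-- The dual gap is bounded by the residual. -/
theorem val_sub_dualVal_le (hφ : RegularObjective φ m ℓ) (hm : 0 < m)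
    (hρ : 0 < ρ) (hA : ρ * ‖P.A‖ ^ 2 ≤ m) (hne : P.feasible.Nonempty)
    (x : EuclideanSpace ℝ (Fin dx)) (u : EuclideanSpace ℝ (Fin dh)) :
    (penaltyBlock φ P.A P.b ρ).val x - (penaltyBlock φ P.A P.b ρ).dualVal x u ≤
      ‖u - argmaxOn {u | ∀ i, 0 ≤ u i} (P.dual (φ x))‖ *
        ‖(penaltyBlock φ P.A P.b ρ).res x u‖ := by
  set K := penaltyBlock φ P.A P.b ρ with hKdef
  obtain ⟨u₀, hu₀⟩ := hφ.exists_kkt hm hne x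
  have h1 := hu₀.argmaxOn_dual (hφ.regular_y x) hm
  set us := argmaxOn {u | ∀ i, 0 ≤ u i} (P.dual (φ x))
  have hval : K.val x = φ x (argminOn P.feasible (φ x)) := by
    simp only [hKdef, SaddleBlock.val, penaltyBlock, slackMap_apply, WithLp.toLp_fst,
      WithLp.toLp_snd, sub_sub_cancel, sub_self, norm_zero]
    simp [Bilevel.feasible, Bilevel.h]
  set p := K.sol x u with hp
  have hmem : p ∈ K.S := (penaltyBlock_sol_spec hφ hm hρ hA x u).1
  have h2 := h1.lagrangian_ge (hφ.regular_y x) p.fst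
  -- Weak duality at the optimal multiplier carries over to the slack formulation, because the slack
  -- term and the penalty are nonnegative there.
  have h3 : K.val x ≤ K.lag x p us := by
    rw [hval]
    have h4 : inner ℝ us p.snd ≤ 0 := by
      rw [inner_eq_sum]
      exact Finset.sum_nonpos fun i _ => mul_nonpos_of_nonneg_of_nonpos (h1.nonneg i) (hmem i)
    have h5 : K.lag x p us = φ x p.fst + ρ / 2 * ‖slackMap P.A p - P.b‖ ^ 2
      + inner ℝ us (slackMap P.A p - P.b) := rfl
    have h6 : inner ℝ us (slackMap P.A p - P.b) = inner ℝ us (P.A p.fst - P.b)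
      - inner ℝ us p.snd := by
      rw [← inner_sub_right, slackMap_apply]; congr 1; abel
    have h7 : 0 ≤ ρ / 2 * ‖slackMap P.A p - P.b‖ ^ 2 := by positivity
    have h8 : 0 ≤ m / 2 * ‖p.fst - argminOn {y | ∀ i, (P.A y - P.b) i ≤ 0} (φ x)‖ ^ 2 := by
      positivity
    change φ x (argminOn {y | ∀ i, (P.A y - P.b) i ≤ 0} (φ x)) ≤ _
    rw [h5, h6]
    linarith
  rw [SaddleBlock.lag_dual_change x p u us] at h3
  have h9 : inner ℝ (us - u) (K.B p - K.b) ≤ ‖u - us‖ * ‖K.res x u‖ := by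
    rw [norm_sub_rev]; exact real_inner_le_norm _ _
  have h10 : K.dualVal x u = K.lag x p u := rfl
  linarith

/-- Accuracy and gap after a short step with small residual. -/
theorem block_accuracy (hφ : RegularObjective φ m ℓ) (hm : 0 < m) (hℓ : 0 ≤ ℓ)
    (hρ : 0 < ρ) (hA : ρ * ‖P.A‖ ^ 2 ≤ m) (hne : P.feasible.Nonempty) (hC0 : 0 ≤ C)
    (hC : ∀ w, ∃ w', P.A.adjoint w' = P.A.adjoint w ∧ SignConformal w' w ∧
      ‖w'‖ ≤ C * ‖P.A.adjoint w‖) {y₀ : EuclideanSpace ℝ (Fin dy)} (hL : P.LICQ y₀)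
    (hτ : ∀ y' b', ‖y' - y₀‖ ≤ τ → ‖b' - P.b‖ ≤ τ →
      ∀ i, (P.A y₀ - P.b) i ≠ 0 → (P.A y' - b') i ≠ 0)
    {x : EuclideanSpace ℝ (Fin dx)} {u u' α' : EuclideanSpace ℝ (Fin dh)}
    {y' : EuclideanSpace ℝ (Fin dy)}
    {p : WithLp 2 (EuclideanSpace ℝ (Fin dy) × EuclideanSpace ℝ (Fin dh))}
    (hy : ‖argminOn P.feasible (φ x) - y₀‖ + errConst C m ℓ ‖P.A‖ * r ≤ τ) (hrτ : r ≤ τ)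
    (hr0 : 0 ≤ r) (hs : (penaltyBlock φ P.A P.b ρ).IsStep ηu (smoothConst ℓ ρ ‖P.A‖)⁻¹ x p u
      (WithLp.toLp 2 (y', α')) u')
    (hsq : (penaltyBlock φ P.A P.b ρ).stepSq x p (WithLp.toLp 2 (y', α')) u' ≤ r ^ 2) :
    ‖y' - argminOn P.feasible (φ x)‖ ≤ (1 + 2 * smoothConst ℓ ρ ‖P.A‖ / convConst m ρ
        + errConst C m ℓ ‖P.A‖) * r ∧
      ‖(penaltyBlock φ P.A P.b ρ).res x u'‖ ≤ r ∧
      ‖P.resid (y', α')‖ ≤ (1 + slackBound ‖P.A‖ *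
        (1 + 2 * smoothConst ℓ ρ ‖P.A‖ / convConst m ρ)) * r ∧
      ‖u' - argmaxOn {u | ∀ i, 0 ≤ u i} (P.dual (φ x))‖ ≤
        multConst C ℓ (errConst C m ℓ ‖P.A‖) ρ * r ∧
      (penaltyBlock φ P.A P.b ρ).gap x (WithLp.toLp 2 (y', α')) u' ≤
        (2 * smoothConst ℓ ρ ‖P.A‖ ^ 2 / convConst m ρ
          + multConst C ℓ (errConst C m ℓ ‖P.A‖) ρ) * r ^ 2 := by
  have hK := penaltyBlock_regular hφ hm hℓ hρ hA hne hC0 hC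
  have hv := val_sub_dualVal_le (P := P) hφ hm hρ hA hne x u'
  have hn := norm_multiplier_sub_le (P := P) (u := u') (r := r) hφ hm hℓ hρ hA hne hC0 hC hL hτ hy hrτ
  have hσ : 0 < convConst m ρ := lt_min (by positivity) (by positivity)
  have hβ : 0 < slackBound ‖P.A‖ := by unfold slackBound; positivity
  have hΛ : 0 < smoothConst ℓ ρ ‖P.A‖ := by unfold smoothConst; positivity
  have hκ0 : 0 ≤ errConst C m ℓ ‖P.A‖ := errConst_nonneg hC0 hm hℓ (norm_nonneg _)
  set K := penaltyBlock φ P.A P.b ρ with hKdef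
  set p' : WithLp 2 (EuclideanSpace ℝ (Fin dy) × EuclideanSpace ℝ (Fin dh)) :=
    WithLp.toLp 2 (y', α') with hp'
  set κ := errConst C m ℓ ‖P.A‖
  set Λ := smoothConst ℓ ρ ‖P.A‖
  set σ := convConst m ρ
  set β := slackBound ‖P.A‖
  have hres : ‖K.res x u'‖ ≤ r := by
    refine abs_le_of_sq_le_sq' ?_ hr0 |>.2
    unfold SaddleBlock.stepSq at hsq
    linarith [sq_nonneg ‖p' - p‖]
  have hd : ‖p' - p‖ ≤ r := by
    refine abs_le_of_sq_le_sq' ?_ hr0 |>.2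
    unfold SaddleBlock.stepSq at hsq
    linarith [sq_nonneg ‖K.res x u'‖]
  have hn' := hn hres
  have hps : ‖p' - K.sol x u'‖ ≤ (1 + 2 * Λ / σ) * r :=
    (hK.norm_step_sub_sol_le hσ hΛ hs).trans (by gcongr)
  refine ⟨?_, hres, ?_, hn', ?_⟩
  · have h1 : y' - argminOn P.feasible (φ x) = (p' - K.opt x).fst := rfl
    rw [h1]
    refine (WithLp.norm_fst_le _ _).trans
      ((norm_sub_le_norm_sub_add_norm_sub _ (K.sol x u') _).trans ?_)
    have h2 := (hK.error_bound x u').trans (mul_le_mul_of_nonneg_left hres hκ0)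
    linarith
  · have h1 : P.resid (y', α') = K.res x u' + slackMap P.A (p' - K.sol x u') := by
      rw [map_sub]
      change P.A y' - P.b - α' = slackMap P.A (K.sol x u') - P.b + (P.A y' - α'
        - slackMap P.A (K.sol x u'))
      abel
    rw [h1]
    refine (norm_add_le _ _).trans ?_
    have h2 := (norm_slackMap_le P.A (p' - K.sol x u')).trans
      (mul_le_mul_of_nonneg_left hps hβ.le)
    linarith
  -- Both halves of the gap are of second order: the primal one is quadratic in the step, the dual
  -- one is multiplier error times residual.
  · have h1 := (hK.norm_sub_sol_le hσ hΛ hs).2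
    have h2 : 2 * Λ ^ 2 / σ * ‖p' - p‖ ^ 2 ≤ 2 * Λ ^ 2 / σ * r ^ 2 := by gcongr
    have h3 := mul_le_mul hn' hres (norm_nonneg _) ((norm_nonneg _).trans hn')
    unfold SaddleBlock.gap
    linarith

end Accuracy

/-! ### The reformulated objective, uniform gap bounds and the two runs. -/

namespace Bilevel

theorem val_penaltyBlock {φ : EuclideanSpace ℝ (Fin dx) → EuclideanSpace ℝ (Fin dy) → ℝ} {ρ : ℝ}
    (x : EuclideanSpace ℝ (Fin dx)) :
    (penaltyBlock φ P.A P.b ρ).val x = φ x (argminOn P.feasible (φ x)) := by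
  have h1 : (penaltyBlock φ P.A P.b ρ).val x = φ x (argminOn P.feasible (φ x))
      + ρ / 2 * ‖P.A (argminOn P.feasible (φ x)) - (P.A (argminOn P.feasible (φ x)) - P.b)
        - P.b‖ ^ 2 := rfl
  rw [h1, sub_sub_cancel, sub_self, norm_zero]
  ring

/-- The penalty vanishes at the solution with its exact slack, so `val` is the original optimal
value for every `ρ`. -/
theorem val_sub_val_eq {δ : ℝ} (hδ : 0 < δ) (ρ : ℝ) (x : EuclideanSpace ℝ (Fin dx)) :
    (P.blockY δ ρ).val x - (P.blockZ ρ).val x = δ * P.hyperPen δ x := by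
  have h1 : (P.blockY δ ρ).val x = P.gPen δ x (P.yPenStar δ x) := val_penaltyBlock x
  have h2 : (P.blockZ ρ).val x = P.g x (P.yStar x) := val_penaltyBlock x
  rw [h1, h2, gPen, hyperPen]
  field_simp
  ring

/-- This lets the gap bound for the first block, taken at `δ = 0`, serve for the second. -/
theorem blockY_zero (ρ : ℝ) : P.blockY 0 ρ = P.blockZ ρ := by
  rw [blockY, gPen_zero, blockZ]

namespace Assumptions

variable {lf0 lf1 lg1 μ δ : ℝ} (hP : P.Assumptions lf0 lf1 lg1 μ)
include hP

theorem yStar_spec (hμ : 0 < μ) (x : EuclideanSpace ℝ (Fin dx)) :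
    P.yStar x ∈ P.feasible ∧
      ∀ y ∈ P.feasible, P.g x (P.yStar x) + μ / 4 * ‖y - P.yStar x‖ ^ 2 ≤ P.g x y := by
  have hR := hP.regular_g hμ.le
  obtain ⟨u, hu⟩ := hR.exists_kkt (A := P.A) (b := P.b) (half_pos hμ) hP.feasible_nonempty x
  refine ⟨(hR.argmin_spec (A := P.A) (b := P.b) (half_pos hμ) hP.feasible_nonempty x).1,
    fun y hy => ?_⟩
  have h1 := hu.lagrangian_ge (hR.regular_y x) y
  have h2 : inner ℝ u (P.A y - P.b) ≤ 0 := by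
    rw [inner_eq_sum]
    exact Finset.sum_nonpos fun i _ => mul_nonpos_of_nonneg_of_nonpos (hu.nonneg i) (hy i)
  have h3 : argminOn {y | ∀ i, (P.A y - P.b) i ≤ 0} (P.g x) = P.yStar x := rfl
  rw [h3] at h1
  linarith

theorem yPenStar_spec (hμ : 0 < μ) (hδ : 0 ≤ δ) (hδμ : 2 * lf1 * δ ≤ μ)
    (x : EuclideanSpace ℝ (Fin dx)) : P.yPenStar δ x ∈ P.feasible ∧
      ∀ y ∈ P.feasible, P.gPen δ x (P.yPenStar δ x) ≤ P.gPen δ x y :=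
  (hP.regular_gPen hδ hδμ).argmin_spec (A := P.A) (b := P.b) (half_pos hμ) hP.feasible_nonempty x

theorem f_sub_le (x : EuclideanSpace ℝ (Fin dx)) {y y' : EuclideanSpace ℝ (Fin dy)}
    (hy : y ∈ P.feasible) (hy' : y' ∈ P.feasible) :
    P.f x y' - P.f x y ≤ |lf0| * ‖y - y'‖ := by
  have h1 := (abs_le.1 (hP.f_lipschitz x x y hy y' hy')).1
  rw [sub_self, jointNorm_zero_left] at h1
  have h2 := mul_le_mul_of_nonneg_right (le_abs_self lf0) (norm_nonneg (y - y'))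
  linarith

/-- The penalized solution is close to the lower-level solution. -/
theorem norm_yPenStar_sub_le (hμ : 0 < μ) (hδ : 0 ≤ δ) (hδμ : 2 * lf1 * δ ≤ μ)
    (x : EuclideanSpace ℝ (Fin dx)) :
    ‖P.yPenStar δ x - P.yStar x‖ ≤ 4 * |lf0| / μ * δ := by
  obtain ⟨h1, h2⟩ := hP.yStar_spec hμ x
  obtain ⟨h3, h4⟩ := hP.yPenStar_spec hμ hδ hδμ x
  have h5 := h2 _ h3
  have h6 := h4 _ h1
  have h7 := mul_le_mul_of_nonneg_left (hP.f_sub_le x h3 h1) hδ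
  unfold gPen at h6
  set t := ‖P.yPenStar δ x - P.yStar x‖
  rcases (norm_nonneg (P.yPenStar δ x - P.yStar x)).eq_or_lt with h0 | h0
  · change 0 = t at h0
    rw [← h0]; positivity
  · change 0 < t at h0
    have h8 : μ * t ≤ 4 * |lf0| * δ := by
      refine le_of_mul_le_mul_right ?_ h0
      nlinarith
    rw [div_mul_eq_mul_div, le_div_iff₀ hμ]
    linarith

/-- The reformulated objective compared with the hyper-objective. -/
theorem hyperPen_bounds (hμ : 0 < μ) (hδ : 0 < δ) (hδμ : 2 * lf1 * δ ≤ μ)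
    (x : EuclideanSpace ℝ (Fin dx)) :
    δ * (P.hyper x - lf0 ^ 2 / μ * δ) ≤ δ * P.hyperPen δ x ∧
      δ * P.hyperPen δ x ≤ δ * P.hyper x := by
  obtain ⟨h1, h2⟩ := hP.yStar_spec hμ x
  obtain ⟨h3, h4⟩ := hP.yPenStar_spec hμ hδ.le hδμ x
  have h5 := h2 _ h3
  have h6 := h4 _ h1
  have h7 := mul_le_mul_of_nonneg_left (hP.f_sub_le x h3 h1) hδ.le
  have e : δ * P.hyperPen δ x = P.gPen δ x (P.yPenStar δ x) - P.g x (P.yStar x) := by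
    rw [gPen, hyperPen]; field_simp; ring
  rw [e]
  unfold gPen hyper at *
  set t := ‖P.yPenStar δ x - P.yStar x‖
  constructor
  -- Completing the square in `t` weighs the Lipschitz gain of `f` against the quadratic growth of
  -- `g`.
  · have e2 : lf0 ^ 2 / μ * δ ^ 2 + μ / 4 * t ^ 2 - δ * (|lf0| * t) =
        (δ * |lf0| - μ * t / 2) ^ 2 / μ := by
      rw [← sq_abs lf0]; field_simp; ring
    have e3 : 0 ≤ (δ * |lf0| - μ * t / 2) ^ 2 / μ := by positivity
    linarith
  · linarith

/-- The gap at a given point is bounded uniformly in `δ`. -/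
theorem exists_gap_bound (hμ : 0 < μ) (hlg : 0 ≤ lg1) {ρ C : ℝ} (hρ : 0 < ρ)
    (hA : ρ * ‖P.A‖ ^ 2 ≤ μ / 2) (hC0 : 0 ≤ C)
    (hC : ∀ w, ∃ w', P.A.adjoint w' = P.A.adjoint w ∧ SignConformal w' w ∧
      ‖w'‖ ≤ C * ‖P.A.adjoint w‖) (x : EuclideanSpace ℝ (Fin dx))
    (p : WithLp 2 (EuclideanSpace ℝ (Fin dy) × EuclideanSpace ℝ (Fin dh)))
    (u : EuclideanSpace ℝ (Fin dh)) (δ₀ : ℝ) :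
    ∃ G, ∀ δ, 0 ≤ δ → δ ≤ δ₀ → 2 * lf1 * δ ≤ μ → (P.blockY δ ρ).gap x p u ≤ G := by
  have hσ : 0 < convConst (μ / 2) ρ := lt_min (by positivity) (by positivity)
  have hβ : 0 < slackBound ‖P.A‖ := by unfold slackBound; positivity
  -- A bound for the derivative of the Lagrangian with `δ` replaced by `δ₀`, so that it is uniform.
  let c : WithLp 2 (EuclideanSpace ℝ (Fin dy) × EuclideanSpace ℝ (Fin dh)) → ℝ := fun p =>
    δ₀ * ‖gradient (P.f x) p.fst‖ + ‖gradient (P.g x) p.fst‖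
      + (ρ * ‖slackMap P.A p - P.b‖ + ‖u‖) * slackBound ‖P.A‖
  have hc : ∀ δ, 0 ≤ δ → δ ≤ δ₀ → ∀ p v, -(c p * ‖v‖) ≤ (P.blockY δ ρ).dlag x p u v := by
    intro δ hδ hδ₀ p v
    rw [SaddleBlock.dlag_apply, blockY, penaltyBlock_inner_gp,
      (hP.hasGradientAt_gPen_y δ x p.fst).gradient]
    have hv : ‖v.fst‖ ≤ ‖v‖ := WithLp.norm_fst_le _ _
    have hB := norm_slackMap_le P.A v
    have h1 : ‖inner ℝ (δ • gradient (P.f x) p.fst + gradient (P.g x) p.fst) v.fst‖ ≤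
        (δ₀ * ‖gradient (P.f x) p.fst‖ + ‖gradient (P.g x) p.fst‖) * ‖v‖ := by
      have hδ' : 0 ≤ δ₀ := hδ.trans hδ₀
      refine (norm_inner_le_norm _ _).trans ?_
      refine mul_le_mul ((norm_add_le _ _).trans ?_) hv (norm_nonneg _) (by positivity)
      rw [norm_smul, Real.norm_of_nonneg hδ]
      gcongr
    have h2 : ‖inner ℝ (slackMap P.A p - P.b) (slackMap P.A v)‖ ≤
        ‖slackMap P.A p - P.b‖ * (slackBound ‖P.A‖ * ‖v‖) :=
      (norm_inner_le_norm _ _).trans (by gcongr)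
    have h3 : ‖inner ℝ u (slackMap P.A v)‖ ≤ ‖u‖ * (slackBound ‖P.A‖ * ‖v‖) :=
      (norm_inner_le_norm _ _).trans (by gcongr)
    have h4 := neg_le_of_abs_le h1
    have h5 := mul_le_mul_of_nonneg_left (neg_le_of_abs_le h2) hρ.le
    have h6 := neg_le_of_abs_le h3
    change _ ≤ _ + inner ℝ u (slackMap P.A v)
    simp only [c]
    linarith
  obtain ⟨yf, hyf⟩ := hP.feasible_nonempty
  let pf : WithLp 2 (EuclideanSpace ℝ (Fin dy) × EuclideanSpace ℝ (Fin dh)) :=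
    WithLp.toLp 2 (yf, P.h yf)
  refine ⟨c p ^ 2 / (2 * convConst (μ / 2) ρ) + c pf ^ 2 / (2 * convConst (μ / 2) ρ),
    fun δ hδ hδ₀ hδμ => ?_⟩
  have hK := penaltyBlock_regular (hP.regular_gPen hδ hδμ) (half_pos hμ)
    (by positivity : 0 ≤ lg1 + μ / 2) hρ hA hP.feasible_nonempty hC0 hC
  refine hK.gap_le hσ (hc δ hδ hδ₀ p) (hc δ hδ hδ₀ pf) (fun i => hyf i) ?_
  change P.A yf - P.h yf = P.b
  rw [Bilevel.h, sub_sub_cancel]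

end Assumptions

/-- The minimizers in the statement and `sol` are separate choices, over the plain product and over
`WithLp 2`; uniqueness under strong convexity identifies them. -/
theorem resid_eq_of_isMin {φ : EuclideanSpace ℝ (Fin dx) → EuclideanSpace ℝ (Fin dy) → ℝ}
    {ρ σ Λ ℓ κ β : ℝ} (hσ : 0 < σ) (hK : (penaltyBlock φ P.A P.b ρ).Regular σ Λ ℓ κ β)
    {x : EuclideanSpace ℝ (Fin dx)} {u : EuclideanSpace ℝ (Fin dh)}
    {a : EuclideanSpace ℝ (Fin dy) × EuclideanSpace ℝ (Fin dh)} (ha : a ∈ slackSet dy dh)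
    (hmin : ∀ q ∈ slackSet dy dh, (penaltyBlock φ P.A P.b ρ).lag x (WithLp.toLp 2 a) u ≤
      (penaltyBlock φ P.A P.b ρ).lag x (WithLp.toLp 2 q) u) :
    P.resid a = (penaltyBlock φ P.A P.b ρ).res x u := by
  have h1 := hK.eq_sol hσ (x := x) (u := u) (q := WithLp.toLp 2 a) (fun i => ha i)
    (hmin (WithLp.ofLp ((penaltyBlock φ P.A P.b ρ).sol x u)) (hK.sol_mem x u))
  rw [SaddleBlock.res, ← h1]
  change P.A a.1 - P.b - a.2 = P.A a.1 - a.2 - P.b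
  abel

theorem resid_yAugStar {prm : Params} {δ σ Λ ℓ κ β : ℝ} (hσ : 0 < σ)
    (hK : (P.blockY δ prm.ρ₁).Regular σ Λ ℓ κ β) (x : EuclideanSpace ℝ (Fin dx))
    (u : EuclideanSpace ℝ (Fin dh)) :
    P.resid (P.yAugStar prm δ x u) = (P.blockY δ prm.ρ₁).res x u := by
  have h1 := argminOn_spec (S := slackSet dy dh) (φ := fun p => P.augLag prm δ x p 0 u 0)
    ⟨WithLp.ofLp ((P.blockY δ prm.ρ₁).sol x u), hK.sol_mem x u, fun q hq => by
      rw [augLag_eq, augLag_eq]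
      exact sub_le_sub_right (hK.sol_min x u (WithLp.toLp 2 q) hq) _⟩
  refine resid_eq_of_isMin hσ hK h1.1 fun q hq => ?_
  have h2 := h1.2 q hq
  rw [augLag_eq, augLag_eq] at h2
  exact (sub_le_sub_iff_right _).1 h2

theorem resid_zAugStar {prm : Params} {σ Λ ℓ κ β : ℝ} (hσ : 0 < σ)
    (hK : (P.blockZ prm.ρ₂).Regular σ Λ ℓ κ β) (x : EuclideanSpace ℝ (Fin dx))
    (v : EuclideanSpace ℝ (Fin dh)) :
    P.resid (P.zAugStar prm x v) = (P.blockZ prm.ρ₂).res x v := by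
  have h1 := Classical.epsilon_spec (p := fun q => q ∈ slackSet dy dh ∧
      IsMaxOn (fun q => P.augLag prm 0 x 0 q 0 v) (slackSet dy dh) q)
    ⟨WithLp.ofLp ((P.blockZ prm.ρ₂).sol x v), hK.sol_mem x v, fun q hq => by
      change P.augLag prm 0 x 0 q 0 v ≤ P.augLag prm 0 x 0 _ 0 v
      rw [augLag_eq, augLag_eq]
      exact sub_le_sub_left (hK.sol_min x v (WithLp.toLp 2 q) hq) _⟩
  refine resid_eq_of_isMin hσ hK h1.1 fun q hq => ?_
  have h2 : P.augLag prm 0 x 0 q 0 v ≤ P.augLag prm 0 x 0 (P.zAugStar prm x v) 0 v := h1.2 hq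
  rw [augLag_eq, augLag_eq] at h2
  exact (sub_le_sub_iff_left _).1 h2

theorem run_succ (prm : Params) (δ : ℝ) (s : State dx dy dh) (n : ℕ) :
    P.run prm δ s (n + 1) = P.step prm δ (P.run prm δ s n) :=
  Function.iterate_succ_apply' _ _ _

theorem runFixed_succ (prm : Params) (δ : ℝ) (s : State dx dy dh) (n : ℕ) :
    P.runFixed prm δ s (n + 1) = P.stepFixed prm δ (P.runFixed prm δ s n) :=
  Function.iterate_succ_apply' _ _ _

theorem runFixed_x (prm : Params) (δ : ℝ) (s : State dx dy dh) (n : ℕ) :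
    (P.runFixed prm δ s n).x = s.x := by
  induction n with
  | zero => rfl
  | succ n ih => rw [runFixed_succ]; exact ih

/-- Step sizes tuned to the constants of the two blocks. -/
structure Tuned (prm : Params) (σ Λ ℓ κ β : ℝ) : Prop where
  σ_pos : 0 < σ
  Λ_pos : 0 < Λ
  ℓ_nonneg : 0 ≤ ℓ
  κ_nonneg : 0 ≤ κ
  β_nonneg : 0 ≤ β
  ηu_pos : 0 < prm.ηu
  ηv_eq : prm.ηv = prm.ηu
  ηy_eq : prm.ηy = Λ⁻¹
  ηz_eq : prm.ηz = Λ⁻¹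
  ηx_eq : prm.ηx = SaddleBlock.xStep σ Λ ℓ κ prm.ηu
  small : prm.ηu * (β * (2 * Λ / σ)) ^ 2 ≤ Λ / 4

/-- The gradient of the reformulated objective. -/
theorem hasGradientAt_hyperPen {δ : ℝ} {prm : Params} {σ Λ ℓ κ β : ℝ} (hσ : 0 < σ) (hℓ : 0 ≤ ℓ)
    (hK₁ : (P.blockY δ prm.ρ₁).Regular σ Λ ℓ κ β)
    (hK₂ : (P.blockZ prm.ρ₂).Regular σ Λ ℓ κ β) (hδ : 0 < δ) (hρ : prm.ρ₁ = prm.ρ₂)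
    (x : EuclideanSpace ℝ (Fin dx)) :
    HasGradientAt (P.hyperPen δ) (δ⁻¹ • ((P.blockY δ prm.ρ₁).gx x ((P.blockY δ prm.ρ₁).opt x)
      - (P.blockZ prm.ρ₂).gx x ((P.blockZ prm.ρ₂).opt x))) x := by
  have h1 := hasGradientAt_of_abs_sub_le (hK₁.val_sub_le hσ hℓ x)
  have h2 := hasGradientAt_of_abs_sub_le (hK₂.val_sub_le hσ hℓ x)
  have h3 := (h1.add' (h2.const_mul' (-1))).const_mul' δ⁻¹
  rw [neg_one_smul, ← sub_eq_add_neg] at h3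
  refine h3.congr_of_eventuallyEq (Filter.Eventually.of_forall fun x => ?_)
  have h4 := P.val_sub_val_eq hδ prm.ρ₁ x
  change P.hyperPen δ x = δ⁻¹ * ((P.blockY δ prm.ρ₁).val x + -1 * (P.blockZ prm.ρ₂).val x)
  rw [← hρ, neg_one_mul, ← sub_eq_add_neg, h4, inv_mul_cancel_left₀ hδ.ne']

/-! ### Averaging along the two phases. -/

section Runs

variable {lf0 lf1 lg1 μ δ : ℝ} {prm : Params} {σ Λ ℓ κ β : ℝ}
  (hP : P.Assumptions lf0 lf1 lg1 μ)
  (ht : Tuned prm σ Λ ℓ κ β) (hK₁ : (P.blockY δ prm.ρ₁).Regular σ Λ ℓ κ β)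
  (hK₂ : (P.blockZ prm.ρ₂).Regular σ Λ ℓ κ β)
include hP ht

theorem Tuned.isStep_blockY (s : State dx dy dh) :
    (P.blockY δ prm.ρ₁).IsStep prm.ηu Λ⁻¹ s.x s.p s.u (P.step prm δ s).p (P.step prm δ s).u := by
  rw [← ht.ηy_eq]; exact hP.isStep_blockY prm δ s

theorem Tuned.isStep_blockZ (s : State dx dy dh) :
    (P.blockZ prm.ρ₂).IsStep prm.ηu Λ⁻¹ s.x s.q s.v (P.step prm δ s).q (P.step prm δ s).v := by
  rw [← ht.ηz_eq, ← ht.ηv_eq]; exact hP.isStep_blockZ prm δ s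

include hK₁ hK₂

/-- The run with fixed `x` contains a short step with small residual. -/
theorem exists_short_step {s : State dx dy dh} (hy : (s.y, s.α) ∈ slackSet dy dh)
    (hz : (s.z, s.β) ∈ slackSet dy dh) {N : ℕ} (hN : 0 < N) :
    ∃ t < N, N * (SaddleBlock.rate prm.ηu Λ *
      ((P.blockY δ prm.ρ₁).stepSq s.x (P.runFixed prm δ s t).p (P.runFixed prm δ s (t + 1)).p
          (P.runFixed prm δ s (t + 1)).u
        + (P.blockZ prm.ρ₂).stepSq s.x (P.runFixed prm δ s t).q (P.runFixed prm δ s (t + 1)).q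
          (P.runFixed prm δ s (t + 1)).v)) ≤
      (P.blockY δ prm.ρ₁).gap s.x s.p s.u + (P.blockZ prm.ρ₂).gap s.x s.q s.v := by
  have hS : ∀ t, (P.runFixed prm δ s t).p ∈ (P.blockY δ prm.ρ₁).S ∧
      (P.runFixed prm δ s t).q ∈ (P.blockZ prm.ρ₂).S := by
    intro t
    cases t with
    | zero => exact ⟨hy, hz⟩
    | succ t =>
      rw [runFixed_succ]
      exact ⟨(ht.isStep_blockY hP _).mem, (ht.isStep_blockZ hP (δ := δ) _).mem⟩
  have := exists_decrement_le (a := 0) (W := fun t =>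
    (P.blockY δ prm.ρ₁).gap s.x (P.runFixed prm δ s t).p (P.runFixed prm δ s t).u
      + (P.blockZ prm.ρ₂).gap s.x (P.runFixed prm δ s t).q (P.runFixed prm δ s t).v)
    (D := fun t => SaddleBlock.rate prm.ηu Λ *
      ((P.blockY δ prm.ρ₁).stepSq s.x (P.runFixed prm δ s t).p (P.runFixed prm δ s (t + 1)).p
          (P.runFixed prm δ s (t + 1)).u
        + (P.blockZ prm.ρ₂).stepSq s.x (P.runFixed prm δ s t).q (P.runFixed prm δ s (t + 1)).q
          (P.runFixed prm δ s (t + 1)).v)) hN ?_ ?_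
  · rw [sub_zero] at this
    exact this
  · intro t
    have h1 := ht.isStep_blockY hP (δ := δ) (P.runFixed prm δ s t)
    have h2 := ht.isStep_blockZ hP (δ := δ) (P.runFixed prm δ s t)
    rw [runFixed_x] at h1 h2
    have g1 := hK₁.gap_step_rate ht.σ_pos ht.Λ_pos ht.ηu_pos.le ht.β_nonneg ht.small h1 (hS t).1
    have g2 := hK₂.gap_step_rate ht.σ_pos ht.Λ_pos ht.ηu_pos.le ht.β_nonneg ht.small h2 (hS t).2
    have e1 : (P.runFixed prm δ s (t + 1)).p = (P.step prm δ (P.runFixed prm δ s t)).p := by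
      rw [runFixed_succ]; rfl
    have e2 : (P.runFixed prm δ s (t + 1)).u = (P.step prm δ (P.runFixed prm δ s t)).u := by
      rw [runFixed_succ]; rfl
    have e3 : (P.runFixed prm δ s (t + 1)).q = (P.step prm δ (P.runFixed prm δ s t)).q := by
      rw [runFixed_succ]; rfl
    have e4 : (P.runFixed prm δ s (t + 1)).v = (P.step prm δ (P.runFixed prm δ s t)).v := by
      rw [runFixed_succ]; rfl
    simp only [e1, e2, e3, e4]
    linarith
  · intro t
    exact add_nonneg (hK₁.gap_nonneg ht.σ_pos _ _ (hS t).1) (hK₂.gap_nonneg ht.σ_pos _ _ (hS t).2)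

/-- The run reaches a point where the gradient of the reformulated objective is small. -/
theorem exists_small_gradient {s : State dx dy dh} (hy : (s.y, s.α) ∈ slackSet dy dh)
    (hz : (s.z, s.β) ∈ slackSet dy dh) {low : ℝ}
    (hlow : ∀ x, low ≤ (P.blockY δ prm.ρ₁).val x - (P.blockZ prm.ρ₂).val x) {N : ℕ} (hN : 0 < N) :
    ∃ t < N, N * ‖(P.blockY δ prm.ρ₁).gx (P.run prm δ s t).x
        ((P.blockY δ prm.ρ₁).opt (P.run prm δ s t).x)
      - (P.blockZ prm.ρ₂).gx (P.run prm δ s t).x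
        ((P.blockZ prm.ρ₂).opt (P.run prm δ s t).x)‖ ^ 2 ≤
      (5 / SaddleBlock.xStep σ Λ ℓ κ prm.ηu ^ 2
        + 10 * SaddleBlock.couplingConst σ Λ ℓ κ ^ 2 / SaddleBlock.rate prm.ηu Λ) *
        (SaddleBlock.merit (P.blockY δ prm.ρ₁) (P.blockZ prm.ρ₂) s.x s.p s.u s.q s.v - low) := by
  have hS : ∀ t, (P.run prm δ s t).p ∈ (P.blockY δ prm.ρ₁).S ∧
      (P.run prm δ s t).q ∈ (P.blockZ prm.ρ₂).S := by
    intro t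
    cases t with
    | zero => exact ⟨hy, hz⟩
    | succ t =>
      rw [run_succ]
      exact ⟨(ht.isStep_blockY hP _).mem, (ht.isStep_blockZ hP (δ := δ) _).mem⟩
  have hx : ∀ s : State dx dy dh, (P.step prm δ s).x = s.x - SaddleBlock.xStep σ Λ ℓ κ prm.ηu •
      ((P.blockY δ prm.ρ₁).gx s.x s.p - (P.blockZ prm.ρ₂).gx s.x s.q) := fun s => by
    rw [← ht.ηx_eq]; exact hP.step_x prm δ s
  obtain ⟨t, htN, hle⟩ := exists_decrement_le (a := low) (W := fun t =>
    SaddleBlock.merit (P.blockY δ prm.ρ₁) (P.blockZ prm.ρ₂) (P.run prm δ s t).x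
      (P.run prm δ s t).p (P.run prm δ s t).u (P.run prm δ s t).q (P.run prm δ s t).v)
    (D := fun t => SaddleBlock.rate prm.ηu Λ / 2 *
      ((P.blockY δ prm.ρ₁).stepSq (P.run prm δ s t).x (P.run prm δ s t).p
          (P.step prm δ (P.run prm δ s t)).p (P.step prm δ (P.run prm δ s t)).u
        + (P.blockZ prm.ρ₂).stepSq (P.run prm δ s t).x (P.run prm δ s t).q
          (P.step prm δ (P.run prm δ s t)).q (P.step prm δ (P.run prm δ s t)).v)
      + ‖(P.step prm δ (P.run prm δ s t)).x - (P.run prm δ s t).x‖ ^ 2) hN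
    (fun t => by
      simp only [run_succ]
      exact hK₁.merit_step hK₂ ht.σ_pos ht.Λ_pos ht.ℓ_nonneg ht.κ_nonneg ht.ηu_pos ht.β_nonneg
        ht.small (ht.isStep_blockY hP _) (hS t).1 (ht.isStep_blockZ hP _) (hS t).2 (hx _))
    (fun t => by
      have h1 := hK₁.gap_nonneg ht.σ_pos (P.run prm δ s t).x (P.run prm δ s t).u (hS t).1
      have h2 := hK₂.gap_nonneg ht.σ_pos (P.run prm δ s t).x (P.run prm δ s t).v (hS t).2
      have h3 := hlow (P.run prm δ s t).x
      unfold SaddleBlock.merit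
      linarith)
  refine ⟨t, htN, ?_⟩
  have h1 := hK₁.norm_gradient_sq_le hK₂ ht.σ_pos ht.Λ_pos ht.ℓ_nonneg ht.κ_nonneg ht.ηu_pos
    (ht.isStep_blockY hP (P.run prm δ s t)) (ht.isStep_blockZ hP (δ := δ) (P.run prm δ s t)) (hx _)
  have hc := SaddleBlock.rate_pos ht.Λ_pos ht.ηu_pos
  have h2 := mul_le_mul_of_nonneg_left h1 (Nat.cast_nonneg (α := ℝ) N)
  refine h2.trans ?_
  rw [mul_left_comm]
  gcongr
  exact hle

end Runs
end Bilevel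

/-! ### Choice of parameters and the final count. -/

/-- The penalty parameter for a lower-level modulus `μ` and `a = ‖A‖`. -/
def penaltyParam (μ a : ℝ) : ℝ := μ / (2 * (a ^ 2 + 1))

theorem penaltyParam_pos {μ : ℝ} (hμ : 0 < μ) (a : ℝ) : 0 < penaltyParam μ a := by
  unfold penaltyParam; positivity

theorem penaltyParam_mul_sq_le {μ : ℝ} (hμ : 0 < μ) (a : ℝ) : penaltyParam μ a * a ^ 2 ≤ μ / 2 := by
  have h : penaltyParam μ a * (a ^ 2 + 1) = μ / 2 := by
    unfold penaltyParam; field_simp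
  have := penaltyParam_pos hμ a
  linarith

/-- The multiplier step size. -/
def dualStep (σ Λ β : ℝ) : ℝ := Λ / (4 * ((β * (2 * Λ / σ)) ^ 2 + 1))

/-- Penalty parameters and step sizes of the algorithm in terms of `μ`, `ℓ`, `‖A‖` and the constant
`C` of the conformal decomposition of `A`. -/
def sflcbParams (μ ℓ C a : ℝ) : Params :=
  let ρ := penaltyParam μ a
  let σ := convConst (μ / 2) ρ
  let Λ := smoothConst ℓ ρ a
  let ηu := dualStep σ Λ (slackBound a)
  { ρ₁ := ρ
    ρ₂ := ρ
    ηx := SaddleBlock.xStep σ Λ ℓ (errConst C (μ / 2) ℓ a) ηu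
    ηy := Λ⁻¹
    ηz := Λ⁻¹
    ηu := ηu
    ηv := ηu }

theorem sflcbParams_tuned {μ ℓ C a : ℝ} (hμ : 0 < μ) (hℓ : 0 ≤ ℓ) (hC : 0 ≤ C) (ha : 0 ≤ a) :
    Bilevel.Tuned (sflcbParams μ ℓ C a) (convConst (μ / 2) (penaltyParam μ a))
      (smoothConst ℓ (penaltyParam μ a) a) ℓ (errConst C (μ / 2) ℓ a) (slackBound a) := by
  have hρ := penaltyParam_pos hμ a
  have hσ : 0 < convConst (μ / 2) (penaltyParam μ a) := lt_min (by positivity) (by positivity)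
  have hβ : 0 < slackBound a := by unfold slackBound; positivity
  have hΛ : 0 < smoothConst ℓ (penaltyParam μ a) a := by unfold smoothConst; positivity
  refine ⟨hσ, hΛ, hℓ, errConst_nonneg hC (half_pos hμ) hℓ ha, hβ.le, ?_, rfl, rfl, rfl, rfl, ?_⟩
  · simp only [sflcbParams, dualStep]; positivity
  · simp only [sflcbParams, dualStep]
    have ht0 := sq_nonneg (slackBound a * (2 * smoothConst ℓ (penaltyParam μ a) a /
      convConst (μ / 2) (penaltyParam μ a)))
    generalize (slackBound a * (2 * smoothConst ℓ (penaltyParam μ a) a /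
      convConst (μ / 2) (penaltyParam μ a))) ^ 2 = t at *
    generalize smoothConst ℓ (penaltyParam μ a) a = Λ at *
    rw [div_mul_eq_mul_div]
    refine div_le_of_le_mul₀ (by positivity) (by positivity) ?_
    linarith

theorem sflcbParams_admissible {dy dh : ℕ}
    (A : EuclideanSpace ℝ (Fin dy) →L[ℝ] EuclideanSpace ℝ (Fin dh)) {μ ℓ C : ℝ} (hμ : 0 < μ)
    (hℓ : 0 ≤ ℓ) (hC : 0 ≤ C) : (sflcbParams μ ℓ C ‖A‖).Admissible A μ := by
  have ht := sflcbParams_tuned hμ hℓ hC (norm_nonneg A)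
  have hρ := penaltyParam_pos hμ ‖A‖
  have hρA := penaltyParam_mul_sq_le hμ ‖A‖
  exact ⟨hρ, hρ, SaddleBlock.xStep_pos ht.σ_pos ht.Λ_pos hℓ ht.ηu_pos, inv_pos.2 ht.Λ_pos,
    inv_pos.2 ht.Λ_pos, ht.ηu_pos, ht.ηu_pos, hρA,
    (show penaltyParam μ ‖A‖ * ‖A‖ ^ 2 ≤ μ by linarith)⟩

/-- A number of iterations sufficient for an averaging argument. -/
theorem exists_iteration_count {c B e : ℝ} (hc : 0 < c) (hB : 0 ≤ B) (he : 0 < e) (he1 : e ≤ 1) :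
    ∃ N : ℕ, 0 < N ∧ (N : ℝ) ≤ (B / c + 2) / e ∧ B ≤ N * (c * e) := by
  have h0 : 0 ≤ B / (c * e) := by positivity
  -- The added one keeps the count positive when `B = 0`; since `e ≤ 1`, the term `2 / e` absorbs it
  -- together with the rounding.
  refine ⟨⌈B / (c * e)⌉₊ + 1, Nat.succ_pos _, ?_, ?_⟩
  · push_cast
    have h1 := (Nat.ceil_lt_add_one h0).le
    have h2 : (B / c + 2) / e = B / (c * e) + 2 / e := by field_simp
    have h3 : 2 ≤ 2 / e := by rw [le_div_iff₀ he]; linarith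
    linarith
  · push_cast
    have h1 := Nat.le_ceil (B / (c * e))
    rw [div_le_iff₀ (by positivity)] at h1
    have : 0 < c * e := by positivity
    linarith

/-- The accuracy constant of the first phase. -/
def accConst (μ ℓ C a : ℝ) : ℝ :=
  let ρ := penaltyParam μ a
  let θ := 1 + 2 * smoothConst ℓ ρ a / convConst (μ / 2) ρ
  let κ := errConst C (μ / 2) ℓ a
  (θ + κ) + 1 + (1 + slackBound a * θ) + multConst C ℓ κ ρ

-- Step sizes and `accConst` involve only `μ`, `lg1`, `‖A‖` and `C`; the starting values, `f`, `g`,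
-- `b`, `c₁` and `c₂` enter only through `B` and `ε₀`.
set_option maxHeartbeats 1000000 in
theorem sflcb_complexity {dx dy dh : ℕ} {P : Bilevel dx dy dh} {lf0 lf1 lg1 μ C : ℝ}
    (hlg1 : 0 ≤ lg1) (hμ : 0 < μ) (hP : P.Assumptions lf0 lf1 lg1 μ) (hC0 : 0 ≤ C)
    (hC : ∀ w, ∃ w', P.A.adjoint w' = P.A.adjoint w ∧ SignConformal w' w ∧
      ‖w'‖ ≤ C * ‖P.A.adjoint w‖) (s₀ : State dx dy dh)
    (hy₀ : (s₀.y, s₀.α) ∈ slackSet dy dh) (hz₀ : (s₀.z, s₀.β) ∈ slackSet dy dh)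
    (hL : P.LICQ (P.yStar s₀.x)) {c₁ c₂ : ℝ} (hc₁ : 0 < c₁) (hc₂ : c₁ ≤ c₂) :
    ∃ B ε₀ : ℝ, 0 < ε₀ ∧
      ∀ ε δ : ℝ, 0 < ε → ε ≤ ε₀ → c₁ * ε ≤ δ → δ ≤ c₂ * ε → 2 * lf1 * δ ≤ μ →
        P.LICQ (P.yPenStar δ s₀.x) →
        (∃! u, P.IsMultiplier (P.gPen δ s₀.x) u) ∧ (∃! v, P.IsMultiplier (P.g s₀.x) v) ∧
        ∃ n : ℕ, (n : ℝ) ≤ B / ε ^ 2 ∧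
          P.Accurate (sflcbParams μ (lg1 + μ / 2) C ‖P.A‖) δ
            (accConst μ (lg1 + μ / 2) C ‖P.A‖ * δ)
            (P.runFixed (sflcbParams μ (lg1 + μ / 2) C ‖P.A‖) δ s₀ n) ∧
          ∃ m : ℕ, (m : ℝ) ≤ B / ε ^ 3 ∧ (n : ℝ) + (m : ℝ) ≤ B / ε ^ 3 ∧
            IsEpsStationary (P.hyperPen δ) ε
              (P.run (sflcbParams μ (lg1 + μ / 2) C ‖P.A‖) δ
                (P.runFixed (sflcbParams μ (lg1 + μ / 2) C ‖P.A‖) δ s₀ n) m).x := by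
  set ℓ := lg1 + μ / 2 with hℓdef
  have hℓ : 0 ≤ ℓ := by positivity
  have hm : 0 < μ / 2 := half_pos hμ
  set a := ‖P.A‖ with hadef
  have ha : 0 ≤ a := norm_nonneg _
  have ht := sflcbParams_tuned hμ hℓ hC0 ha
  set prm := sflcbParams μ ℓ C a with hprm
  set ρ := penaltyParam μ a with hρdef
  have hρ : 0 < ρ := penaltyParam_pos hμ a
  have hρA : ρ * ‖P.A‖ ^ 2 ≤ μ / 2 := penaltyParam_mul_sq_le hμ a
  have hρ₁ : prm.ρ₁ = ρ := rfl
  have hρ₂ : prm.ρ₂ = ρ := rfl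
  have hne := hP.feasible_nonempty
  have hRg := hP.regular_g hμ.le
  have hK₂ : (P.blockZ ρ).Regular (convConst (μ / 2) ρ) (smoothConst ℓ ρ a) ℓ
      (errConst C (μ / 2) ℓ a) (slackBound a) :=
    penaltyBlock_regular hRg hm hℓ hρ hρA hne hC0 hC
  have hcr := SaddleBlock.rate_pos ht.Λ_pos ht.ηu_pos
  have hηx := SaddleBlock.xStep_pos (κ := errConst C (μ / 2) ℓ a) ht.σ_pos ht.Λ_pos hℓ ht.ηu_pos
  have hσ := ht.σ_pos
  have hΛ := ht.Λ_pos
  have hκ0 := ht.κ_nonneg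
  have hβ0 := ht.β_nonneg
  set σ := convConst (μ / 2) ρ with hσdef
  set Λ := smoothConst ℓ ρ a with hΛdef
  set κ := errConst C (μ / 2) ℓ a with hκdef
  set rt := SaddleBlock.rate prm.ηu Λ with hrt
  set D := 5 / SaddleBlock.xStep σ Λ ℓ κ prm.ηu ^ 2
    + 10 * SaddleBlock.couplingConst σ Λ ℓ κ ^ 2 / rt with hD
  have hD0 : 0 ≤ D := by positivity
  have hmult : 0 ≤ multConst C ℓ κ ρ := by unfold multConst; positivity
  set Q := 2 * Λ ^ 2 / σ + multConst C ℓ κ ρ with hQ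
  have hc₂0 : 0 < c₂ := hc₁.trans_le hc₂
  obtain ⟨τ, hτ0, hτ⟩ := exists_inactive_radius P.A P.b (P.yStar s₀.x)
  obtain ⟨G₁, hG₁⟩ := hP.exists_gap_bound hμ hlg1 hρ hρA hC0 hC s₀.x s₀.p s₀.u c₂
  obtain ⟨G₂, hG₂⟩ := hP.exists_gap_bound hμ hlg1 hρ hρA hC0 hC s₀.x s₀.q s₀.v c₂
  obtain ⟨L, hLow⟩ := hP.hyper_bddBelow
  -- `δ * M` bounds the initial excess of the potential over its lower bound: the range of the
  -- hyper-objective, the error of `hyperPen_bounds` and two gaps of size `Q * δ ^ 2`, with one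
  -- factor `δ` replaced by `c₂`.
  set M := |P.hyper s₀.x - L + (lf0 ^ 2 / μ + 2 * Q) * c₂| with hM
  set G := |G₁ + G₂| with hG
  set a₁ := G / (rt * c₁ ^ 2) + 2 with ha₁
  set a₂ := D * M / c₁ + 2 with ha₂
  have ha₁0 : 0 ≤ a₁ := by positivity
  have ha₂0 : 0 ≤ a₂ := by positivity
  -- `R * δ ≤ τ` keeps the penalized solution, the Lagrangian minimizers at distance `κ * δ` from
  -- the solutions, and the shifted right-hand side within the radius where inactive constraints
  -- stay inactive.
  set R := 4 * |lf0| / μ + κ + 1 with hR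
  have hR0 : 0 < R := by positivity
  refine ⟨a₁ + a₂, min 1 (τ / (c₂ * R)), lt_min one_pos (by positivity), ?_⟩
  intro ε δ hε hε₀ hδ₁ hδ₂ hδμ hLδ
  have hε1 : ε ≤ 1 := hε₀.trans (min_le_left _ _)
  have hδ : 0 < δ := lt_of_lt_of_le (by positivity) hδ₁
  have hδc : δ ≤ c₂ := hδ₂.trans (by nlinarith)
  have hRτ : R * δ ≤ τ := by
    have h1 : ε ≤ τ / (c₂ * R) := hε₀.trans (min_le_right _ _)
    rw [le_div_iff₀ (by positivity)] at h1
    have h2 := mul_le_mul_of_nonneg_left hδ₂ hR0.le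
    linarith
  have hδτ : δ ≤ τ := by
    have : 0 ≤ (4 * |lf0| / μ + κ) * δ := by positivity
    linarith
  have hRf := hP.regular_gPen hδ.le hδμ
  have hK₁ : (P.blockY δ ρ).Regular σ Λ ℓ κ (slackBound a) :=
    penaltyBlock_regular hRf hm hℓ hρ hρA hne hC0 hC
  obtain ⟨u₁, hu₁⟩ := hRf.exists_kkt (A := P.A) (b := P.b) hm hne s₀.x
  obtain ⟨u₂, hu₂⟩ := hRg.exists_kkt (A := P.A) (b := P.b) hm hne s₀.x
  refine ⟨hu₁.existsUnique (hRf.regular_y _) hm hLδ, hu₂.existsUnique (hRg.regular_y _) hm hL, ?_⟩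
  obtain ⟨N, hN0, hNle, hNge⟩ := exists_iteration_count (c := rt * c₁ ^ 2) (B := G) (e := ε ^ 2)
    (by positivity) (abs_nonneg _) (by positivity) (pow_le_one₀ hε.le hε1)
  obtain ⟨t, htN, hle⟩ := Bilevel.exists_short_step hP ht hK₁ hK₂ hy₀ hz₀ hN0
  have hgap : (P.blockY δ ρ).gap s₀.x s₀.p s₀.u + (P.blockZ ρ).gap s₀.x s₀.q s₀.v ≤ G := by
    have h1 := hG₁ δ hδ.le hδc hδμ
    have h2 := hG₂ 0 le_rfl hc₂0.le (by simpa using hμ.le)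
    rw [Bilevel.blockY_zero] at h2
    exact (add_le_add h1 h2).trans (le_abs_self _)
  rw [hρ₁, hρ₂] at hle
  set s := P.runFixed prm δ s₀ t with hs
  set s' := P.runFixed prm δ s₀ (t + 1) with hs'
  have hs's : s' = P.stepFixed prm δ s := P.runFixed_succ prm δ s₀ t
  have hsx : s.x = s₀.x := P.runFixed_x prm δ s₀ t
  have hsx' : s'.x = s₀.x := P.runFixed_x prm δ s₀ (t + 1)
  set S₁ := (P.blockY δ ρ).stepSq s₀.x s.p s'.p s'.u with hS₁
  set S₂ := (P.blockZ ρ).stepSq s₀.x s.q s'.q s'.v with hS₂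
  have hS₁0 : 0 ≤ S₁ := SaddleBlock.stepSq_nonneg _ _ _ _ _
  have hS₂0 : 0 ≤ S₂ := SaddleBlock.stepSq_nonneg _ _ _ _ _
  have hSsum : S₁ + S₂ ≤ δ ^ 2 := by
    have h1 : (N : ℝ) * (rt * (S₁ + S₂)) ≤ N * (rt * (c₁ ^ 2 * ε ^ 2)) := by linarith
    have h2 := le_of_mul_le_mul_left h1 (by exact_mod_cast hN0)
    have h3 := le_of_mul_le_mul_left h2 hcr
    have h4 : (c₁ * ε) ^ 2 ≤ δ ^ 2 := by gcongr
    linarith [mul_pow c₁ ε 2]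
  have hstep₁ : (P.blockY δ ρ).IsStep prm.ηu Λ⁻¹ s₀.x s.p s.u s'.p s'.u := by
    have := ht.isStep_blockY hP (δ := δ) s
    rw [hsx] at this
    rw [hs's]; exact this
  have hstep₂ : (P.blockZ ρ).IsStep prm.ηu Λ⁻¹ s₀.x s.q s.v s'.q s'.v := by
    have := ht.isStep_blockZ hP (δ := δ) s
    rw [hsx] at this
    rw [hs's]; exact this
  have hnear₁ : ‖argminOn P.feasible (P.gPen δ s₀.x) - P.yStar s₀.x‖ + κ * δ ≤ τ := by
    have h1 : ‖argminOn P.feasible (P.gPen δ s₀.x) - P.yStar s₀.x‖ ≤ 4 * |lf0| / μ * δ :=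
      hP.norm_yPenStar_sub_le hμ hδ.le hδμ s₀.x
    linarith
  have hnear₂ : ‖argminOn P.feasible (P.g s₀.x) - P.yStar s₀.x‖ + κ * δ ≤ τ := by
    have h1 : argminOn P.feasible (P.g s₀.x) = P.yStar s₀.x := rfl
    rw [h1, sub_self, norm_zero]
    have : 0 ≤ 4 * |lf0| / μ * δ := by positivity
    linarith
  have hacc₁ : ‖s'.y - P.yPenStar δ s₀.x‖ ≤ (1 + 2 * Λ / σ + κ) * δ ∧
      ‖(P.blockY δ ρ).res s₀.x s'.u‖ ≤ δ ∧
      ‖P.resid (s'.y, s'.α)‖ ≤ (1 + slackBound a * (1 + 2 * Λ / σ)) * δ ∧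
      ‖s'.u - P.uStar δ s₀.x‖ ≤ multConst C ℓ κ ρ * δ ∧
      (P.blockY δ ρ).gap s₀.x s'.p s'.u ≤ Q * δ ^ 2 :=
    block_accuracy hRf hm hℓ hρ hρA hne hC0 hC hL hτ hnear₁ hδτ hδ.le hstep₁
      (show S₁ ≤ δ ^ 2 by linarith)
  have hacc₂ : ‖s'.z - P.yStar s₀.x‖ ≤ (1 + 2 * Λ / σ + κ) * δ ∧
      ‖(P.blockZ ρ).res s₀.x s'.v‖ ≤ δ ∧
      ‖P.resid (s'.z, s'.β)‖ ≤ (1 + slackBound a * (1 + 2 * Λ / σ)) * δ ∧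
      ‖s'.v - P.vStar s₀.x‖ ≤ multConst C ℓ κ ρ * δ ∧
      (P.blockZ ρ).gap s₀.x s'.q s'.v ≤ Q * δ ^ 2 :=
    block_accuracy hRg hm hℓ hρ hρA hne hC0 hC hL hτ hnear₂ hδτ hδ.le hstep₂
      (show S₂ ≤ δ ^ 2 by linarith)
  obtain ⟨y1, y2, y3, y4, y5⟩ := hacc₁
  obtain ⟨z1, z2, z3, z4, z5⟩ := hacc₂
  have hθ : 0 ≤ 2 * Λ / σ := by positivity
  have hβθ : 0 ≤ slackBound a * (1 + 2 * Λ / σ) := by positivity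
  have hacc : ∀ {X k : ℝ}, X ≤ k * δ → k ≤ accConst μ ℓ C a → X ≤ accConst μ ℓ C a * δ :=
    fun h1 h2 => h1.trans (by gcongr)
  have haccdef : accConst μ ℓ C a = (1 + 2 * Λ / σ + κ) + 1 + (1 + slackBound a * (1 + 2 * Λ / σ))
    + multConst C ℓ κ ρ := rfl
  have hstart : ((t + 1 : ℕ) : ℝ) ≤ a₁ / ε ^ 2 := by
    have : ((t + 1 : ℕ) : ℝ) ≤ N := by exact_mod_cast htN
    exact this.trans hNle
  -- The accurate state is the one after the short step; `t < N` leaves room for the extra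
  -- iteration.
  refine ⟨t + 1, hstart.trans (by gcongr; linarith), ?_, ?_⟩
  · refine ⟨?_, ?_, ?_, ?_, ?_, ?_, ?_, ?_⟩
    · rw [hsx']; exact hacc y1 (by rw [haccdef]; linarith)
    · rw [hsx', Bilevel.resid_yAugStar hσ hK₁]
      exact hacc (k := 1) (by rw [one_mul]; exact y2) (by rw [haccdef]; linarith)
    · exact hacc y3 (by rw [haccdef]; linarith)
    · rw [hsx']; exact hacc y4 (by rw [haccdef]; linarith)
    · rw [hsx']; exact hacc z1 (by rw [haccdef]; linarith)
    · rw [hsx', Bilevel.resid_zAugStar hσ hK₂]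
      exact hacc (k := 1) (by rw [one_mul]; exact z2) (by rw [haccdef]; linarith)
    · exact hacc z3 (by rw [haccdef]; linarith)
    · rw [hsx']; exact hacc z4 (by rw [haccdef]; linarith)
  -- The averaged bound `D * δ * M / N'` must be at most `(δ * ε) ^ 2`; since `δ ≥ c₁ * ε`, it
  -- suffices that `N' * c₁ * ε ^ 3` reach `D * M`.
  obtain ⟨N', hN'0, hN'le, hN'ge⟩ := exists_iteration_count (c := c₁) (B := D * M) (e := ε ^ 3)
    hc₁ (by positivity) (by positivity) (pow_le_one₀ hε.le hε1)
  have hlow : ∀ x, δ * (L - lf0 ^ 2 / μ * δ) ≤ (P.blockY δ ρ).val x - (P.blockZ ρ).val x := by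
    intro x
    rw [P.val_sub_val_eq hδ]
    refine le_trans ?_ (hP.hyperPen_bounds hμ hδ hδμ x).1
    gcongr
    exact hLow ⟨x, rfl⟩
  obtain ⟨t', ht'N, hle'⟩ := Bilevel.exists_small_gradient hP ht hK₁ hK₂ (s := s')
    (fun i => hstep₁.mem i) (fun i => hstep₂.mem i) hlow hN'0
  have ht'le : (t' : ℝ) ≤ a₂ / ε ^ 3 := by
    have : (t' : ℝ) ≤ N' := by exact_mod_cast ht'N.le
    exact this.trans hN'le
  refine ⟨t', ht'le.trans (show a₂ / ε ^ 3 ≤ (a₁ + a₂) / ε ^ 3 by gcongr; linarith), ?_, ?_, ?_⟩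
  · have h1 : a₁ / ε ^ 2 ≤ a₁ / ε ^ 3 := by
      exact div_le_div_of_nonneg_left ha₁0 (pow_pos hε 3)
        (pow_le_pow_of_le_one hε.le hε1 (by norm_num))
    rw [add_div]
    linarith
  · exact fun x => (Bilevel.hasGradientAt_hyperPen (prm := prm) hσ hℓ hK₁ hK₂ hδ rfl x).differentiableAt
  · rw [(Bilevel.hasGradientAt_hyperPen (prm := prm) hσ hℓ hK₁ hK₂ hδ rfl _).gradient, norm_smul,
      Real.norm_of_nonneg (inv_nonneg.2 hδ.le), inv_mul_le_iff₀ hδ]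
    set x' := (P.run prm δ s' t').x
    have hmerit : SaddleBlock.merit (P.blockY δ ρ) (P.blockZ ρ) s'.x s'.p s'.u s'.q s'.v
        - δ * (L - lf0 ^ 2 / μ * δ) ≤ δ * M := by
      have h1 := (hP.hyperPen_bounds hμ hδ hδμ s₀.x).2
      rw [← P.val_sub_val_eq hδ ρ] at h1
      have h2 : (lf0 ^ 2 / μ + 2 * Q) * δ ≤ (lf0 ^ 2 / μ + 2 * Q) * c₂ := by
        have : 0 ≤ lf0 ^ 2 / μ + 2 * Q := by positivity
        gcongr
      have h3 := le_abs_self (P.hyper s₀.x - L + (lf0 ^ 2 / μ + 2 * Q) * c₂)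
      rw [← hM] at h3
      have h4 : δ * (P.hyper s₀.x - L + (lf0 ^ 2 / μ + 2 * Q) * δ) ≤ δ * M := by
        gcongr
        linarith
      rw [hsx', SaddleBlock.merit]
      linarith
    rw [hρ₁, hρ₂] at hle' ⊢
    refine abs_le_of_sq_le_sq' ?_ (by positivity) |>.2
    have hN'pos : (0 : ℝ) < N' := by exact_mod_cast hN'0
    refine le_of_mul_le_mul_left (hle'.trans ?_) hN'pos
    calc D * _ ≤ D * (δ * M) := by gcongr
      _ = δ * (D * M) := by ring
      _ ≤ δ * (N' * (c₁ * ε ^ 3)) := by gcongr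
      _ = N' * (δ * ε ^ 2 * (c₁ * ε)) := by ring
      _ ≤ N' * (δ * ε ^ 2 * δ) := by gcongr
      _ = N' * (δ * ε) ^ 2 := by ring

end

/-- The conformal constant is drawn from `A` alone, before the problem data; this is what lets the
parameters and `Cacc` precede the quantifier over `P`. -/
theorem mainTheorem6 {dx dy dh : ℕ}
    (A : EuclideanSpace ℝ (Fin dy) →L[ℝ] EuclideanSpace ℝ (Fin dh))
    (lf1 lg1 μ : ℝ) (hlf1 : 0 ≤ lf1) (hlg1 : 0 ≤ lg1) (hμ : 0 < μ) :
    ∃ (prm : Params) (Cacc : ℝ), prm.Admissible A μ ∧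
      ∀ (P : Bilevel dx dy dh) (lf0 : ℝ), P.A = A → P.Assumptions lf0 lf1 lg1 μ →
      ∀ s₀ : State dx dy dh,
        (s₀.y, s₀.α) ∈ slackSet dy dh → (s₀.z, s₀.β) ∈ slackSet dy dh →
        P.LICQ (P.yStar s₀.x) →
      ∀ c₁ c₂ : ℝ, 0 < c₁ → c₁ ≤ c₂ →
      ∃ C ε₀ : ℝ, 0 < ε₀ ∧
        ∀ ε δ : ℝ, 0 < ε → ε ≤ ε₀ → c₁ * ε ≤ δ → δ ≤ c₂ * ε → 2 * lf1 * δ ≤ μ →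
          P.LICQ (P.yPenStar δ s₀.x) →
          (∃! u, P.IsMultiplier (P.gPen δ s₀.x) u) ∧ (∃! v, P.IsMultiplier (P.g s₀.x) v) ∧
          ∃ n : ℕ, (n : ℝ) ≤ C / ε ^ 2 ∧
            P.Accurate prm δ (Cacc * δ) (P.runFixed prm δ s₀ n) ∧
            ∃ m : ℕ, (m : ℝ) ≤ C / ε ^ 3 ∧ (n : ℝ) + (m : ℝ) ≤ C / ε ^ 3 ∧
              IsEpsStationary (P.hyperPen δ) ε
                (P.run prm δ (P.runFixed prm δ s₀ n) m).x := by
  obtain ⟨C, hC0, hC⟩ := exists_conformal_norm_le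
    (A.adjoint : EuclideanSpace ℝ (Fin dh) →ₗ[ℝ] EuclideanSpace ℝ (Fin dy))
  refine ⟨sflcbParams μ (lg1 + μ / 2) C ‖A‖, accConst μ (lg1 + μ / 2) C ‖A‖,
    sflcbParams_admissible A hμ (by positivity) hC0, ?_⟩
  rintro P lf0 rfl hP s₀ hy hz hL c₁ c₂ hc₁ hc₂
  exact sflcb_complexity hlg1 hμ hP hC0 hC s₀ hy hz hL hc₁ hc₂
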